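/- Let $S$ be a locally noetherian scheme, $\pi : C \to S$ a morphism locally of finite type, and $P \subset C$ a closed subscheme which is a section of $\pi$ (that is, $\pi|_P : P \to S$ is an isomorphism) and an effective Cartier divisor (its ideal sheaf $\mathcal I \subset \mathcal O_C$ is locally generated by one element that is not a zero divisor). Let $\widehat{\mathcal O}_C = \varprojlim_n \mathcal O_C/\mathcal I^n$ be the formal completion of $\mathcal O_C$ along $P$, regarded as an $\mathcal O_P$-algebra through $\pi$ and $\pi|_P : P \cong S$; let $\mathcal O_P[[z]]$ be the sheaf with sections $\mathcal O_P(U)[[z]]$ over $U$; and for an $\mathcal O_C$-module $\mathcal F$ put $\widehat{\mathcal F} = \varprojlim_n \mathcal F/\mathcal I^n\mathcal F$, an $\widehat{\mathcal O}_C$-module. Assume that $H^1(S, \mathcal O_S) = 0$ and that $\mathcal I/\mathcal I^2$ is a free $\mathcal O_P$-module of rank $1$. Then: 1. $\widehat{\mathcal O}_C \cong \mathcal O_P[[z]]$ as sheaves of formal $\mathcal O_P$-algebras; that is, there is an isomorphism of sheaves of $\mathcal O_P$-algebras which, for every $n \ge 0$, carries the kernel of $\widehat{\mathcal O}_C \to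 \mathcal O_C/\mathcal I^n$ onto the ideal generated by $z^n$. 2. For every $r \ge 0$ and every coherent sheaf $\mathcal F$ of $\mathcal O_C$-modules that is locally free in a neighbourhood of $P$ and satisfies $\mathcal F|_P \cong \mathcal O_P^{\oplus r}$, one has $\widehat{\mathcal F} \cong \widehat{\mathcal O}_C^{\oplus r}$ as sheaves of $\widehat{\mathcal O}_C$-modules. -/

import Mathlib

open CategoryTheory AlgebraicGeometry TopologicalSpace

universe u

noncomputable section

namespace FormalCompletion

/-! ### Inverse limits of sequences of rings and of modules -/

section Limit

variable {R R' : ℕ → Type u} [∀ n, CommRing (R n)] [∀ n, CommRing (R' n)]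
  {M M' : ℕ → Type u} [∀ n, AddCommGroup (M n)] [∀ n, AddCommGroup (M' n)] [∀ n, Module (R n) (M n)]

/-- The limit of an inverse sequence of rings: the ring of compatible families. -/
def limRing (q : ∀ m n : ℕ, m ≤ n → R n →+* R m) : Subring (∀ n, R n) where
  carrier := {s | ∀ (m n : ℕ) (h : m ≤ n), q m n h (s n) = s m}
  mul_mem' hs ht m n h := by simp [hs m n h, ht m n h]
  one_mem' m n h := by simp
  add_mem' hs ht m n h := by simp [hs m n h, ht m n h]
  zero_mem' m n h := by simp
  neg_mem' hs m n h := by simp [hs m n h]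

/-- The homomorphism induced on limits by a compatible sequence of homomorphisms. -/
def limRingMap (q : ∀ m n : ℕ, m ≤ n → R n →+* R m) (q' : ∀ m n : ℕ, m ≤ n → R' n →+* R' m)
    (f : ∀ n, R n →+* R' n)
    (hf : ∀ (m n : ℕ) (h : m ≤ n) (a : R n), q' m n h (f n a) = f m (q m n h a)) :
    limRing q →+* limRing q' where
  toFun s := ⟨fun n ↦ f n (s.1 n), fun m n h ↦ by rw [hf, s.2 m n h]⟩
  map_one' := by ext; simp
  map_mul' s t := by ext; simp
  map_zero' := by ext; simp
  map_add' s t := by ext; simp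

/-- The limit of an inverse sequence of modules, as a module (componentwise) over the limit of the
rings: the compatible families. -/
def limModule (q : ∀ m n : ℕ, m ≤ n → R n →+* R m) (p : ∀ m n : ℕ, m ≤ n → M n →+ M m)
    (hp : ∀ (m n : ℕ) (h : m ≤ n) (a : R n) (x : M n), p m n h (a • x) = q m n h a • p m n h x) :
    Submodule (limRing q) (∀ n, M n) where
  carrier := {x | ∀ (m n : ℕ) (h : m ≤ n), p m n h (x n) = x m}
  add_mem' hx hy m n h := by simp [hx m n h, hy m n h]
  zero_mem' m n h := by simp
  smul_mem' s x hx m n h := by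
    change p m n h (s.1 n • x n) = s.1 m • x m
    rw [hp, hx m n h, s.2 m n h]

/-- The additive map induced on limits of modules by a compatible sequence of additive maps. -/
def limModuleMap [∀ n, Module (R' n) (M' n)] (q : ∀ m n : ℕ, m ≤ n → R n →+* R m)
    (p : ∀ m n : ℕ, m ≤ n → M n →+ M m)
    (hp : ∀ (m n : ℕ) (h : m ≤ n) (a : R n) (x : M n), p m n h (a • x) = q m n h a • p m n h x)
    (q' : ∀ m n : ℕ, m ≤ n → R' n →+* R' m) (p' : ∀ m n : ℕ, m ≤ n → M' n →+ M' m)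
    (hp' : ∀ (m n : ℕ) (h : m ≤ n) (a : R' n) (x : M' n),
      p' m n h (a • x) = q' m n h a • p' m n h x)
    (f : ∀ n, M n →+ M' n)
    (hf : ∀ (m n : ℕ) (h : m ≤ n) (a : M n), p' m n h (f n a) = f m (p m n h a)) :
    limModule q p hp →+ limModule q' p' hp' where
  toFun x := ⟨fun n ↦ f n (x.1 n), fun m n h ↦ by rw [hf, x.2 m n h]⟩
  map_zero' := by ext; simp
  map_add' x y := by ext; simp

end Limit

/-! ### Sections of sheaves of modules -/

lemma preimage_le_preimage {X Y Z : Scheme.{u}} (g : X ⟶ Y) (f : Y ⟶ Z) (h : X ⟶ Z)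
    (w : g ≫ f = h) (U : Z.Opens) : h ⁻¹ᵁ U ≤ g ⁻¹ᵁ f ⁻¹ᵁ U := by
  subst w; exact le_rfl

/-- The sections over `U` of an `𝒪_X`-module `G`. -/
def Sec {X : Scheme.{u}} (G : X.Modules) (U : X.Opens) : Type u := Γ(G, U)

instance instAddCommGroupSec {X : Scheme.{u}} (G : X.Modules) (U : X.Opens) :
    AddCommGroup (Sec G U) :=
  inferInstanceAs (AddCommGroup Γ(G, U))

instance instModuleSec {X : Scheme.{u}} (G : X.Modules) (U : X.Opens) :
    Module Γ(X, U) (Sec G U) :=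
  inferInstanceAs (Module Γ(X, U) Γ(G, U))

/-- Restriction of sections of an `𝒪_X`-module. -/
def secRes {X : Scheme.{u}} (G : X.Modules) {U V : X.Opens} (h : V ≤ U) : Sec G U →+ Sec G V :=
  (G.presheaf.map (homOfLE h).op).hom

lemma secRes_smul {X : Scheme.{u}} (G : X.Modules) {U V : X.Opens} (h : V ≤ U)
    (a : Γ(X, U)) (x : Sec G U) :
    secRes G h (a • x) = (X.presheaf.map (homOfLE h).op).hom a • secRes G h x :=
  Scheme.Modules.map_smul G (homOfLE h) a x

lemma secRes_secRes {X : Scheme.{u}} (G : X.Modules) {U V W : X.Opens} (h : V ≤ U) (h' : W ≤ V)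
    (x : Sec G U) : secRes G h' (secRes G h x) = secRes G (h'.trans h) x := by
  have : G.presheaf.map (homOfLE h).op ≫ G.presheaf.map (homOfLE h').op =
      G.presheaf.map (homOfLE (h'.trans h)).op := by
    rw [← Functor.map_comp]; rfl
  exact congr($(this).hom x)

/-- The map on sections induced by a morphism of `𝒪_X`-modules. -/
def secMap {X : Scheme.{u}} {G H : X.Modules} (φ : G ⟶ H) (U : X.Opens) : Sec G U →+ Sec H U :=
  (φ.app U).hom

lemma secMap_smul {X : Scheme.{u}} {G H : X.Modules} (φ : G ⟶ H) (U : X.Opens)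
    (a : Γ(X, U)) (x : Sec G U) : secMap φ U (a • x) = a • secMap φ U x :=
  φ.app_smul a x

lemma secMap_secRes {X : Scheme.{u}} {G H : X.Modules} (φ : G ⟶ H) {U V : X.Opens} (h : V ≤ U)
    (x : Sec G U) : secMap φ V (secRes G h x) = secRes H h (secMap φ U x) :=
  congr($(φ.mapPresheaf.naturality (homOfLE h).op).hom x)

/-- Pulling back sections: `Γ(V, G) ⟶ Γ(g⁻¹ V, g^* G)`. -/
def secPullback {X Y : Scheme.{u}} (g : X ⟶ Y) (G : Y.Modules) (V : Y.Opens) :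
    Sec G V →+ Sec ((Scheme.Modules.pullback g).obj G) (g ⁻¹ᵁ V) :=
  (((Scheme.Modules.pullbackPushforwardAdjunction g).unit.app G).app V).hom

lemma secPullback_smul {X Y : Scheme.{u}} (g : X ⟶ Y) (G : Y.Modules) (V : Y.Opens)
    (a : Γ(Y, V)) (x : Sec G V) :
    secPullback g G V (a • x) = (g.app V).hom a • secPullback g G V x :=
  ((Scheme.Modules.pullbackPushforwardAdjunction g).unit.app G).app_smul a x

lemma secPullback_secRes {X Y : Scheme.{u}} (g : X ⟶ Y) (G : Y.Modules) {U V : Y.Opens}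
    (h : V ≤ U) (x : Sec G U) :
    secPullback g G V (secRes G h x) =
      secRes _ (g.preimage_mono h) (secPullback g G U x) :=
  congr($(((Scheme.Modules.pullbackPushforwardAdjunction g).unit.app
    G).mapPresheaf.naturality (homOfLE h).op).hom x)

/-- The canonical isomorphism `g^* f^* F ⟶ h^* F` for `g ≫ f = h`. -/
def pullbackFactor {X Y Z : Scheme.{u}} (g : X ⟶ Y) (f : Y ⟶ Z) (h : X ⟶ Z) (w : g ≫ f = h)
    (F : Z.Modules) :
    (Scheme.Modules.pullback g).obj ((Scheme.Modules.pullback f).obj F) ⟶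
      (Scheme.Modules.pullback h).obj F :=
  (Scheme.Modules.pullbackComp g f).hom.app F ≫ (Scheme.Modules.pullbackCongr w).hom.app F

/-- For `g ≫ f = h`, the canonical map `f_* f^* F ⟶ h_* h^* F` on sections over `U`. -/
def pullbackRes {X Y Z : Scheme.{u}} (g : X ⟶ Y) (f : Y ⟶ Z) (h : X ⟶ Z) (w : g ≫ f = h)
    (F : Z.Modules) (U : Z.Opens) :
    Sec ((Scheme.Modules.pullback f).obj F) (f ⁻¹ᵁ U) →+
      Sec ((Scheme.Modules.pullback h).obj F) (h ⁻¹ᵁ U) :=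
  ((secRes _ (preimage_le_preimage g f h w U)).comp
    (secMap (pullbackFactor g f h w F) (g ⁻¹ᵁ f ⁻¹ᵁ U))).comp
    (secPullback g ((Scheme.Modules.pullback f).obj F) (f ⁻¹ᵁ U))

lemma pullbackRes_smul {X Y Z : Scheme.{u}} (g : X ⟶ Y) (f : Y ⟶ Z) (h : X ⟶ Z)
    (w : g ≫ f = h) (F : Z.Modules) (U : Z.Opens) (a : Γ(Y, f ⁻¹ᵁ U))
    (x : Sec ((Scheme.Modules.pullback f).obj F) (f ⁻¹ᵁ U)) :
    pullbackRes g f h w F U (a • x) =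
      (g.appLE (f ⁻¹ᵁ U) (h ⁻¹ᵁ U) (preimage_le_preimage g f h w U)).hom a •
        pullbackRes g f h w F U x := by
  simp only [pullbackRes, AddMonoidHom.comp_apply, secPullback_smul, secMap_smul, secRes_smul]
  rfl

lemma pullbackRes_secRes {X Y Z : Scheme.{u}} (g : X ⟶ Y) (f : Y ⟶ Z) (h : X ⟶ Z)
    (w : g ≫ f = h) (F : Z.Modules) {U V : Z.Opens} (i : V ≤ U)
    (x : Sec ((Scheme.Modules.pullback f).obj F) (f ⁻¹ᵁ U)) :
    pullbackRes g f h w F V (secRes _ (f.preimage_mono i) x) =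
      secRes _ (h.preimage_mono i) (pullbackRes g f h w F U x) := by
  simp only [pullbackRes, AddMonoidHom.comp_apply, secPullback_secRes, secMap_secRes,
    secRes_secRes]

/-! ### Formal completions

Both completions are formed along an increasing sequence of `C`-schemes `T_n`; in the case of
interest `T_n` is the closed subscheme of `C` defined by `I ^ n`. -/

/-- A sequence of `C`-schemes `T_0 ⟶ T_1 ⟶ T_2 ⟶ ⋯`. -/
structure Thickenings (C : Scheme.{u}) where
  /-- the `n`-th scheme -/
  obj : ℕ → Scheme.{u}
  /-- its structure morphism to `C` -/
  toBase (n : ℕ) : obj n ⟶ C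
  /-- the transition morphisms -/
  incl {m n : ℕ} (h : m ≤ n) : obj m ⟶ obj n
  incl_toBase {m n : ℕ} (h : m ≤ n) : incl h ≫ toBase n = toBase m

section Completion

variable {C : Scheme.{u}} (T : Thickenings C)

/-- The sections over `U` of the push-forward to `C` of the structure sheaf of `T_n`
(of `𝒪_C / I ^ n`, if `T_n` is the closed subscheme defined by `I ^ n`). -/
def QuotSections (U : C.Opens) (n : ℕ) : Type u := Γ(T.obj n, T.toBase n ⁻¹ᵁ U)

instance instCommRingQuotSections (U : C.Opens) (n : ℕ) : CommRing (QuotSections T U n) :=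
  inferInstanceAs (CommRing Γ(T.obj n, T.toBase n ⁻¹ᵁ U))

/-- The restriction maps of the sheaf `𝒪_C / I ^ n`. -/
def quotRes {U V : C.Opens} (i : V ≤ U) (n : ℕ) : QuotSections T U n →+* QuotSections T V n :=
  ((T.obj n).presheaf.map (homOfLE ((T.toBase n).preimage_mono i)).op).hom

/-- The projection `𝒪_C / I ^ n ⟶ 𝒪_C / I ^ m` for `m ≤ n`, over `U`. -/
def quotProj (U : C.Opens) (m n : ℕ) (h : m ≤ n) : QuotSections T U n →+* QuotSections T U m :=
  ((T.incl h).appLE (T.toBase n ⁻¹ᵁ U) (T.toBase m ⁻¹ᵁ U)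
    (preimage_le_preimage _ _ _ (T.incl_toBase h) U)).hom

lemma quotProj_quotRes {U V : C.Opens} (i : V ≤ U) (m n : ℕ) (h : m ≤ n)
    (a : QuotSections T U n) :
    quotProj T V m n h (quotRes T i n a) = quotRes T i m (quotProj T U m n h a) := by
  have key : (T.obj n).presheaf.map (homOfLE ((T.toBase n).preimage_mono i)).op ≫
      (T.incl h).appLE (T.toBase n ⁻¹ᵁ V) (T.toBase m ⁻¹ᵁ V)
        (preimage_le_preimage _ _ _ (T.incl_toBase h) V) =
      (T.incl h).appLE (T.toBase n ⁻¹ᵁ U) (T.toBase m ⁻¹ᵁ U)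
        (preimage_le_preimage _ _ _ (T.incl_toBase h) U) ≫
      (T.obj m).presheaf.map (homOfLE ((T.toBase m).preimage_mono i)).op := by
    rw [Scheme.Hom.map_appLE, Scheme.Hom.appLE_map]
  exact congr($(key).hom a)

/-- The ring of sections over `U` of the formal completion `𝒪̂_C = lim 𝒪_C / I ^ n`:
compatible families of sections of the `𝒪_C / I ^ n` over `U`. -/
abbrev completionRing (U : C.Opens) : Subring (∀ n : ℕ, QuotSections T U n) :=
  limRing (quotProj T U)

/-- The restriction maps of `𝒪̂_C`. -/
def completionRes {U V : C.Opens} (i : V ≤ U) : completionRing T U →+* completionRing T V :=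
  limRingMap (quotProj T U) (quotProj T V) (quotRes T i) (quotProj_quotRes T i)

variable (F : C.Modules)

/-- The sections over `U` of the push-forward to `C` of the pull-back of `F` to `T_n`
(of `F / I ^ n F = F ⊗ 𝒪_C / I ^ n`, if `T_n` is the closed subscheme defined by `I ^ n`). -/
def QuotModuleSections (U : C.Opens) (n : ℕ) : Type u :=
  Sec ((Scheme.Modules.pullback (T.toBase n)).obj F) (T.toBase n ⁻¹ᵁ U)

instance instAddCommGroupQuotModuleSections (U : C.Opens) (n : ℕ) :
    AddCommGroup (QuotModuleSections T F U n) :=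
  inferInstanceAs
    (AddCommGroup (Sec ((Scheme.Modules.pullback (T.toBase n)).obj F) (T.toBase n ⁻¹ᵁ U)))

instance instModuleQuotModuleSections (U : C.Opens) (n : ℕ) :
    Module (QuotSections T U n) (QuotModuleSections T F U n) :=
  inferInstanceAs (Module Γ(T.obj n, T.toBase n ⁻¹ᵁ U)
    (Sec ((Scheme.Modules.pullback (T.toBase n)).obj F) (T.toBase n ⁻¹ᵁ U)))

/-- The projection `F / I ^ n F ⟶ F / I ^ m F` for `m ≤ n`, over `U`. -/
def moduleProj (U : C.Opens) (m n : ℕ) (h : m ≤ n) :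
    QuotModuleSections T F U n →+ QuotModuleSections T F U m :=
  pullbackRes (T.incl h) (T.toBase n) (T.toBase m) (T.incl_toBase h) F U

lemma moduleProj_smul (U : C.Opens) (m n : ℕ) (h : m ≤ n) (a : QuotSections T U n)
    (x : QuotModuleSections T F U n) :
    moduleProj T F U m n h (a • x) = quotProj T U m n h a • moduleProj T F U m n h x :=
  pullbackRes_smul (T.incl h) (T.toBase n) (T.toBase m) (T.incl_toBase h) F U a x

/-- The restriction maps of `F / I ^ n F`. -/
def moduleRes {U V : C.Opens} (i : V ≤ U) (n : ℕ) :
    QuotModuleSections T F U n →+ QuotModuleSections T F V n :=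
  secRes ((Scheme.Modules.pullback (T.toBase n)).obj F) ((T.toBase n).preimage_mono i)

lemma moduleProj_moduleRes {U V : C.Opens} (i : V ≤ U) (m n : ℕ) (h : m ≤ n)
    (x : QuotModuleSections T F U n) :
    moduleProj T F V m n h (moduleRes T F i n x) =
      moduleRes T F i m (moduleProj T F U m n h x) :=
  pullbackRes_secRes (T.incl h) (T.toBase n) (T.toBase m) (T.incl_toBase h) F i x

/-- The sections over `U` of the formal completion `F̂ = lim F / I ^ n F`, as a module over the
sections of `𝒪̂_C`: compatible families of sections of the `F / I ^ n F` over `U`. -/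
abbrev completionModule (U : C.Opens) :
    Submodule (completionRing T U) (∀ n : ℕ, QuotModuleSections T F U n) :=
  @limModule (QuotSections T U) (instCommRingQuotSections T U) (QuotModuleSections T F U)
    (instAddCommGroupQuotModuleSections T F U) (instModuleQuotModuleSections T F U)
    (quotProj T U) (moduleProj T F U) (moduleProj_smul T F U)

/-- The restriction maps of `F̂`. -/
def completionModuleRes {U V : C.Opens} (i : V ≤ U) :
    completionModule T F U →+ completionModule T F V :=
  @limModuleMap (QuotSections T U) (QuotSections T V) (instCommRingQuotSections T U)
    (instCommRingQuotSections T V) (QuotModuleSections T F U) (QuotModuleSections T F V)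
    (instAddCommGroupQuotModuleSections T F U) (instAddCommGroupQuotModuleSections T F V)
    (instModuleQuotModuleSections T F U) (instModuleQuotModuleSections T F V)
    (quotProj T U) (moduleProj T F U) (moduleProj_smul T F U)
    (quotProj T V) (moduleProj T F V) (moduleProj_smul T F V)
    (moduleRes T F i) (moduleProj_moduleRes T F i)

end Completion

/-! ### Closed subschemes -/

section Ring

variable {C : Scheme.{u}} (I : C.IdealSheafData)

lemma pow_le_pow {m n : ℕ} (h : m ≤ n) : I ^ n ≤ I ^ m := by
  intro U
  simpa using Ideal.pow_le_pow_right h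

lemma sq_le : I ^ 2 ≤ I := by
  simpa using pow_le_pow I one_le_two

/-- The infinitesimal neighbourhoods of the closed subscheme defined by `I`: the closed subschemes
of `C` defined by the powers `I ^ n`. -/
def nbhds : Thickenings C where
  obj n := (I ^ n).subscheme
  toBase n := (I ^ n).subschemeι
  incl h := Scheme.IdealSheafData.inclusion (pow_le_pow I h)
  incl_toBase h := Scheme.IdealSheafData.inclusion_subschemeι (pow_le_pow I h)

/-- The sections over `U` of `𝒪_P = 𝒪_C / I`, viewed as a sheaf on `C`, where `P` is the closed
subscheme defined by `I`. -/
abbrev SubschemeSections (U : C.Opens) : Type u := Γ(I.subscheme, I.subschemeι ⁻¹ᵁ U)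

/-- Restriction of sections of `𝒪_P`. -/
def subschemeRes {U V : C.Opens} (h : V ≤ U) : SubschemeSections I U →+* SubschemeSections I V :=
  (I.subscheme.presheaf.map (homOfLE (I.subschemeι.preimage_mono h)).op).hom

/-- The map of sheaves `𝒪_C / J ⟶ 𝒪_C / J'`, for ideals `J ≤ J'`, on sections over `U`. -/
def subschemeProj {J J' : C.IdealSheafData} (h : J ≤ J') (U : C.Opens) :
    SubschemeSections J U →+* SubschemeSections J' U :=
  ((Scheme.IdealSheafData.inclusion h).appLE (J.subschemeι ⁻¹ᵁ U) (J'.subschemeι ⁻¹ᵁ U)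
    (preimage_le_preimage _ _ _ (Scheme.IdealSheafData.inclusion_subschemeι h) U)).hom

/-- The sections over `U` of the sheaf `𝒪_P⟦z⟧`. -/
abbrev PowerSeriesSections (U : C.Opens) : Type u := PowerSeries (SubschemeSections I U)

/-- The restriction maps of the sheaf `𝒪_P⟦z⟧`. -/
def powerSeriesRes {U V : C.Opens} (h : V ≤ U) :
    PowerSeriesSections I U →+* PowerSeriesSections I V :=
  PowerSeries.map (subschemeRes I h)

/-! ### Cartier divisors and the conormal sheaf -/

/-- The closed subscheme defined by `I` is an effective Cartier divisor: locally `I` is generated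
by one element which is not a zero divisor. -/
def IsEffectiveCartier : Prop :=
  ∀ x : C, ∃ U : C.affineOpens, x ∈ U.1 ∧
    ∃ f ∈ nonZeroDivisors Γ(C, U.1), I.ideal U = Ideal.span {f}

/-- The sections over `U` of the conormal sheaf `I / I ^ 2`, the kernel of
`𝒪_C / I ^ 2 ⟶ 𝒪_C / I`. -/
def conormal (U : C.Opens) : Ideal (SubschemeSections (I ^ 2) U) :=
  RingHom.ker (subschemeProj (sq_le I) U)

/-- The conormal sheaf `I / I ^ 2` is free of rank one over `𝒪_P`: there is an isomorphism of
sheaves of `𝒪_C`-modules `𝒪_P = 𝒪_C / I ≅ I / I ^ 2`. -/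
def IsConormalFreeOfRankOne : Prop :=
  ∃ e : ∀ U : C.Opens, SubschemeSections I U ≃+ conormal I U,
    (∀ (U V : C.Opens) (h : V ≤ U) (a : SubschemeSections I U),
      (e V (subschemeRes I h a)).1 = subschemeRes (I ^ 2) h (e U a).1) ∧
    ∀ (U : C.Opens) (c : Γ(C, U)) (a : SubschemeSections I U),
      (e U ((I.subschemeι.app U).hom c * a)).1 =
        ((I ^ 2).subschemeι.app U).hom c * (e U a).1

end Ring

/-! ### Conditions on a sheaf of modules -/

section Module

variable {C : Scheme.{u}} (I : C.IdealSheafData) (F : C.Modules)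

/-- `F` is locally free in some open neighbourhood of the closed subscheme defined by `I`. -/
def IsLocallyFreeNear : Prop :=
  ∃ W : C.Opens, (I.support : Set C) ⊆ W ∧
    SheafOfModules.IsLocallyFree (R := (W : Scheme.{u}).ringCatSheaf) (F.restrict W.ι)

/-- The restriction of `F` to the closed subscheme `P` defined by `I` is isomorphic
to `𝒪_P ^ r`. -/
def IsFreeOnSubscheme (r : ℕ) : Prop :=
  Nonempty ((Scheme.Modules.pullback I.subschemeι).obj F ≅
    SheafOfModules.free (R := I.subscheme.ringCatSheaf) (ULift.{u} (Fin r)))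

/-- `F̂ ≅ 𝒪̂_C ^ r` as sheaves of `𝒪̂_C`-modules. -/
def IsCompletionFree (r : ℕ) : Prop :=
  ∃ e : ∀ U : C.Opens, (Fin r → completionRing (nbhds I) U) ≃ₗ[completionRing (nbhds I) U]
      completionModule (nbhds I) F U,
    ∀ (U V : C.Opens) (h : V ≤ U) (s : Fin r → completionRing (nbhds I) U),
      e V (fun i ↦ completionRes (nbhds I) h (s i)) = completionModuleRes (nbhds I) F h (e U s)

end Module

/-! ### Sections of a morphism and the `𝒪_P`-algebra structure of `𝒪̂_C` -/

section Section

variable {C S : Scheme.{u}} (π : C ⟶ S) (I : C.IdealSheafData)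

/-- The closed subscheme defined by `I` is a section of `π`: it is mapped isomorphically to `S`. -/
abbrev IsSection : Prop := IsIso (I.subschemeι ≫ π)

/-- For a section `P` of `π`, the retraction onto `P` of the closed subscheme defined by `I ^ n`:
the composite of `π` with the inverse of `P ≅ S`. -/
def retraction [IsSection π I] (n : ℕ) : (I ^ n).subscheme ⟶ I.subscheme :=
  (I ^ n).subschemeι ≫ π ≫ inv (I.subschemeι ≫ π)

lemma preimage_le_retraction [IsSection π I] (n : ℕ) (U : C.Opens) :
    (I ^ n).subschemeι ⁻¹ᵁ U ≤ retraction π I n ⁻¹ᵁ (I.subschemeι ⁻¹ᵁ U) := by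
  intro x hx
  have hx' : (I ^ n).subschemeι x ∈ U := hx
  have hs : (I ^ n).subschemeι x ∈ (I ^ n).support := by
    rw [← SetLike.mem_coe, ← Scheme.IdealSheafData.range_subschemeι]
    exact ⟨x, rfl⟩
  rcases Nat.eq_zero_or_pos n with rfl | hn
  · have h0 : (I ^ 0).support = ⊥ := by simp
    rw [h0] at hs
    exact absurd hs (Set.notMem_empty _)
  · rw [Scheme.IdealSheafData.support_pow _ _ hn.ne', ← SetLike.mem_coe,
      ← Scheme.IdealSheafData.range_subschemeι] at hs
    obtain ⟨y, hy⟩ := hs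
    have h1 : retraction π I n x = y := by
      simp only [retraction, Scheme.Hom.comp_apply]
      rw [← hy, ← Scheme.Hom.comp_apply, ← Scheme.Hom.comp_apply, ← Category.assoc,
        IsIso.hom_inv_id]
      simp
    change I.subschemeι (retraction π I n x) ∈ U
    rw [h1, hy]
    exact hx'

lemma inclusion_retraction [IsSection π I] {m n : ℕ} (h : m ≤ n) :
    Scheme.IdealSheafData.inclusion (pow_le_pow I h) ≫ retraction π I n = retraction π I m := by
  simp only [retraction, Scheme.IdealSheafData.inclusion_subschemeι_assoc]

/-- The `𝒪_P`-algebra structure of `𝒪_C / I ^ n`, on sections over `U`: the homomorphism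
`𝒪_P ⟶ 𝒪_C / I ^ n` induced by the retraction. -/
def quotStructureMap [IsSection π I] (n : ℕ) (U : C.Opens) :
    SubschemeSections I U →+* QuotSections (nbhds I) U n :=
  ((retraction π I n).appLE (I.subschemeι ⁻¹ᵁ U) ((I ^ n).subschemeι ⁻¹ᵁ U)
    (preimage_le_retraction π I n U)).hom

lemma quotProj_quotStructureMap [IsSection π I] (U : C.Opens) {m n : ℕ} (h : m ≤ n)
    (a : SubschemeSections I U) :
    quotProj (nbhds I) U m n h (quotStructureMap π I n U a) = quotStructureMap π I m U a := by
  have key := Scheme.Hom.appLE_comp_appLE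
    (Scheme.IdealSheafData.inclusion (pow_le_pow I h)) (retraction π I n)
    (I.subschemeι ⁻¹ᵁ U) ((I ^ n).subschemeι ⁻¹ᵁ U) ((I ^ m).subschemeι ⁻¹ᵁ U)
    (preimage_le_retraction π I n U)
    (preimage_le_preimage _ _ _
      (Scheme.IdealSheafData.inclusion_subschemeι (pow_le_pow I h)) U)
  have key2 : (Scheme.IdealSheafData.inclusion (pow_le_pow I h) ≫
      retraction π I n).appLE
      (I.subschemeι ⁻¹ᵁ U) ((I ^ m).subschemeι ⁻¹ᵁ U)
      (by rw [inclusion_retraction π I h]; exact preimage_le_retraction π I m U) =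
      (retraction π I m).appLE (I.subschemeι ⁻¹ᵁ U) ((I ^ m).subschemeι ⁻¹ᵁ U)
        (preimage_le_retraction π I m U) := by
    congr 1
    exact inclusion_retraction π I h
  exact congr($(key.trans key2).hom a)

/-- The `𝒪_P`-algebra structure of `𝒪̂_C`, on sections over `U`: the homomorphism
`𝒪_P ⟶ lim 𝒪_C / I ^ n` induced by `π` and the isomorphism `P ≅ S`. -/
def structureMap [IsSection π I] (U : C.Opens) :
    SubschemeSections I U →+* completionRing (nbhds I) U :=
  (RingHom.pi fun n ↦ quotStructureMap π I n U).codRestrict (completionRing (nbhds I) U)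
    fun a _ _ h ↦ quotProj_quotStructureMap π I U h a

/-- `𝒪̂_C ≅ 𝒪_P⟦z⟧` as sheaves of formal `𝒪_P`-algebras: an isomorphism of sheaves of rings which
is `𝒪_P`-linear and which identifies, for every `n`, the kernel of `𝒪̂_C ⟶ 𝒪_C / I ^ n` with
the ideal generated by `z ^ n`, so that it is a homeomorphism for the given topologies. -/
def IsCompletionPowerSeries [IsSection π I] : Prop :=
  ∃ ρ : ∀ U : C.Opens, completionRing (nbhds I) U ≃+* PowerSeriesSections I U,
    (∀ (U V : C.Opens) (h : V ≤ U) (s : completionRing (nbhds I) U),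
      ρ V (completionRes (nbhds I) h s) = powerSeriesRes I h (ρ U s)) ∧
    (∀ (U : C.Opens) (a : SubschemeSections I U), ρ U (structureMap π I U a) = PowerSeries.C a) ∧
    ∀ (U : C.Opens) (n : ℕ) (s : completionRing (nbhds I) U),
      s.1 n = 0 ↔ (PowerSeries.X : PowerSeriesSections I U) ^ n ∣ ρ U s

end Section

/-- The structure sheaf of `S` as a sheaf of abelian groups. -/
def structureSheafAb (S : Scheme.{u}) :
    Sheaf (Opens.grothendieckTopology S) AddCommGrpCat.{u} :=
  (sheafCompose _ (forget₂ CommRingCat.{u} RingCat.{u} ⋙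
    forget₂ RingCat.{u} AddCommGrpCat.{u})).obj S.sheaf

end FormalCompletion

end

/-! Everything rests on the graded pieces. Since `I / I ^ 2` is free, it has a global generator `t`
(`IsConormalFreeOfRankOne.exists_generator`). Local lifts of `t` to `𝒪_C` differ by elements of `I ^
2`, so their `n`-th powers agree modulo `I ^ (n + 1)` and glue to a global section `g` of `𝒪_C / I ^
(n + 1)`. As `P` is a Cartier divisor, `a ↦ a * g` is an isomorphism of `𝒪_P` with `I ^ n / I ^ (n +
1)`, the kernel of `𝒪_C / I ^ (n + 1) ⟶ 𝒪_C / I ^ n`; here `𝒪_P` acts through the retraction onto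
`P` given by `π`.

The obstruction to lifting a global section from level `n` to level `n + 1` therefore lies in `H¹`
of a sheaf isomorphic to `𝒪_P`. All sheaves involved live on `P`, which `π` identifies with `S`;
after push-forward to `S` the kernel becomes `𝒪_S`, and the obstruction vanishes
(`surjective_app_top_of_isSupportedOn`). Hence `t` lifts to a global section `τ` of `𝒪̂_C`
(`exists_completionRing_eq`).

For the first claim, send `z` to `τ`. By induction along the graded pieces, `𝒪_P⟦z⟧ ⟶ 𝒪_C / I ^ n`
is surjective with kernel generated by `z ^ n` over every open (`seriesEval_surjective`,
`X_pow_dvd_of_seriesEval_eq_zero`); in the limit this gives the isomorphism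
(`completionEval_bijective`).

For the second claim, `F` has bases with `r` elements near the points of `P`, so multiplication by
`τ ^ n` identifies `F / I F` with the kernel of `F / I ^ (n + 1) F ⟶ F / I ^ n F`. This kernel is
thus isomorphic to `𝒪_P ^ r`, its `H¹` on `S` vanishes, and a basis of `F / I F` lifts to a
compatible sequence of families of global sections (`mProj_top_surjective`). By induction these are
bases at every level (`HasLocalBases.moduleComb_bijective`), hence in the limit (`isLimitFree`). -/

noncomputable section

namespace FormalCompletion

/-! ### Lifting sections along a morphism whose kernel is a power of an acyclic sheaf -/

section Lifting

open Opposite Limits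

variable {X : TopCat.{u}} {A E G : Sheaf (Opens.grothendieckTopology X) AddCommGrpCat.{u}}

/-- If the identity of `K` factors through finitely many copies of a sheaf without `H¹`, then
`H¹(K) = 0`. -/
lemma subsingleton_H_one_of_sum_comp_eq_id
    {K : Sheaf (Opens.grothendieckTopology X) AddCommGrpCat.{u}}
    {ι : Type*} [Fintype ι] (ψ : ι → (K ⟶ A)) (φ : ι → (A ⟶ K)) (h : ∑ i, ψ i ≫ φ i = 𝟙 K)
    (hA : Subsingleton (Sheaf.H A 1)) : Subsingleton (Sheaf.H K 1) := by
  have key : ∀ (s : Finset ι) (x : Sheaf.H K 1), Sheaf.H.map (∑ i ∈ s, ψ i ≫ φ i) 1 x = 0 := by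
    classical
    intro s x
    induction s using Finset.induction_on with
    | empty =>
      simp [Sheaf.H.map_apply]
    | insert i s hi ih =>
      rw [Finset.sum_insert hi, Sheaf.H.map_add_apply, ih, add_zero, Sheaf.H.map_comp_apply,
        Subsingleton.elim (Sheaf.H.map (ψ i) 1 x) 0, map_zero]
  refine subsingleton_of_forall_eq 0 fun x ↦ ?_
  have := key Finset.univ x
  rwa [h, Sheaf.H.map_id_apply] at this

/-- By the long exact sequence, the obstruction to lifting a global section of `G` is its image in
`H¹(kernel p)`. -/
lemma surjective_app_top_of_subsingleton_H_one_kernel (p : E ⟶ G) [Epi p]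
    (hK : Subsingleton (Sheaf.H (kernel p) 1)) :
    Function.Surjective (p.hom.app (op ⊤)) := by
  have hS : (ShortComplex.mk (kernel.ι p) p (kernel.condition p)).ShortExact :=
    { exact := ShortComplex.exact_of_f_is_kernel _ (kernelIsKernel p) }
  intro s
  have hT : IsTerminal (⊤ : Opens X) := isTerminalTop
  obtain ⟨x, hx⟩ := Abelian.Ext.covariant_sequence_exact₃ _ hS
    ((Sheaf.H.equiv₀ G hT).symm s) (n₁ := 1) rfl (Subsingleton.elim (α := Sheaf.H (kernel p) 1) _ _)
  refine ⟨Sheaf.H.equiv₀ E hT x, ?_⟩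
  rw [Sheaf.H.equiv₀_naturality, Sheaf.H.map_apply, hx, AddEquiv.apply_symm_apply]

/-- Over every open, `hinj` and `hker` identify `A ^ r` with the kernel of `p`. The coordinates of a
section of the kernel are morphisms of sheaves, and they exhibit the kernel as a retract of `r`
copies of `A`, so its `H¹` vanishes. -/
lemma surjective_app_top_of_kernel_eq_pow (hA : Subsingleton (Sheaf.H A 1)) (p : E ⟶ G) {r : ℕ}
    (φ : Fin r → (A ⟶ E)) (hφ : ∀ i, φ i ≫ p = 0)
    (hinj : ∀ (U : Opens X) (a : Fin r → A.obj.obj (op U)),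
      ∑ i, (φ i).hom.app (op U) (a i) = 0 → a = 0)
    (hker : ∀ (U : Opens X) (x : E.obj.obj (op U)), p.hom.app (op U) x = 0 →
      ∃ a : Fin r → A.obj.obj (op U), ∑ i, (φ i).hom.app (op U) (a i) = x)
    (hsurj : ∀ (U : Opens X) (t : G.obj.obj (op U)), ∀ x ∈ U, ∃ (V : Opens X) (i : V ⟶ U),
      x ∈ V ∧ ∃ s : E.obj.obj (op V), p.hom.app (op V) s = G.obj.map i.op t) :
    Function.Surjective (p.hom.app (op ⊤)) := by
  have : Epi p := by
    refine (TopCat.Sheaf.isLocallySurjective_iff_epi p).mp ?_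
    refine ⟨fun {U} s x hx ↦ ?_⟩
    obtain ⟨V, i, hxV, t, ht⟩ := hsurj U s x hx
    exact ⟨V, i, ⟨t, ht⟩, hxV⟩
  refine surjective_app_top_of_subsingleton_H_one_kernel p ?_
  have hk : ∀ (U : (Opens X)ᵒᵖ) (x : (kernel p).obj.obj U),
      ∃ a : Fin r → A.obj.obj U, ∑ i, (φ i).hom.app U (a i) = (kernel.ι p).hom.app U x := by
    intro U x
    refine hker U.unop _ ?_
    exact congr($(congr($(kernel.condition p).hom.app U)) x)
  choose c hc using hk
  have huniq : ∀ (U : (Opens X)ᵒᵖ) (a b : Fin r → A.obj.obj U),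
      ∑ i, (φ i).hom.app U (a i) = ∑ i, (φ i).hom.app U (b i) → a = b := by
    intro U a b h
    rw [← sub_eq_zero]
    refine hinj U.unop _ ?_
    simp only [Pi.sub_apply, map_sub, Finset.sum_sub_distrib]
    exact sub_eq_zero.mpr h
  have hadd : ∀ U x y, c U (x + y) = c U x + c U y := by
    intro U x y
    apply huniq
    simp [hc, Finset.sum_add_distrib]
  have hnat : ∀ {U V : (Opens X)ᵒᵖ} (f : U ⟶ V) (x : (kernel p).obj.obj U),
      c V ((kernel p).obj.map f x) = fun i ↦ A.obj.map f (c U x i) := by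
    intro U V f x
    apply huniq
    have h1 : ∀ i, (φ i).hom.app V (A.obj.map f (c U x i)) =
        E.obj.map f ((φ i).hom.app U (c U x i)) := fun i ↦
      congr($((φ i).hom.naturality f) (c U x i))
    rw [hc, Finset.sum_congr rfl fun i _ ↦ h1 i, ← map_sum, hc]
    exact congr($((kernel.ι p).hom.naturality f) x)
  let ψ : Fin r → (kernel p ⟶ A) := fun i ↦ ⟨{
    app U := AddCommGrpCat.ofHom (AddMonoidHom.mk' (fun x ↦ c U x i) fun x y ↦ by rw [hadd]; rfl)
    naturality U V f := by
      ext x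
      exact congr_fun (hnat f x) i }⟩
  refine subsingleton_H_one_of_sum_comp_eq_id ψ (fun i ↦ kernel.lift p (φ i) (hφ i)) ?_ hA
  rw [← cancel_mono (kernel.ι p), Preadditive.sum_comp]
  simp only [Category.assoc, kernel.lift_ι, Category.id_comp]
  ext U x
  let ev : (kernel p ⟶ E) →+ E.obj.obj U := AddMonoidHom.mk' (fun f ↦ f.hom.app U x) fun _ _ ↦ rfl
  exact (map_sum ev (fun i ↦ ψ i ≫ φ i) Finset.univ).trans (hc U x)

end Lifting

/-! ### Gluing sections characterized by a property -/

section Gluing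

open Opposite

variable {X : TopCat.{u}} (F : TopCat.Sheaf AddCommGrpCat.{u} X)

lemma sheaf_ext {U : Opens X} (s t : F.obj.obj (op U))
    (h : ∀ x ∈ U, ∃ (V : Opens X) (i : V ≤ U), x ∈ V ∧
      F.obj.map (homOfLE i).op s = F.obj.map (homOfLE i).op t) : s = t := by
  choose! V hV hx hst using h
  refine F.eq_of_locally_eq' (fun x : U ↦ V x.1) U (fun x ↦ homOfLE (hV x.1 x.2)) ?_ s t
    fun x ↦ hst x.1 x.2
  intro x hx'
  exact Opens.mem_iSup.mpr ⟨⟨x, hx'⟩, hx x hx'⟩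

/-- Uniqueness forces agreement on overlaps. `P` is not assumed to be local, so it is recovered only
on a neighbourhood of each point. -/
lemma sheaf_glue {U : Opens X} (P : ∀ V : Opens X, F.obj.obj (op V) → Prop)
    (hres : ∀ (V W : Opens X) (i : W ≤ V) (s : F.obj.obj (op V)), P V s →
      P W (F.obj.map (homOfLE i).op s))
    (huniq : ∀ (V : Opens X) (s t : F.obj.obj (op V)), V ≤ U → P V s → P V t → s = t)
    (hloc : ∀ x ∈ U, ∃ V : Opens X, x ∈ V ∧ V ≤ U ∧ ∃ s, P V s) :
    ∃ s : F.obj.obj (op U), ∀ x ∈ U, ∃ (V : Opens X) (i : V ≤ U), x ∈ V ∧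
      P V (F.obj.map (homOfLE i).op s) := by
  choose! V hx hV s hs using hloc
  obtain ⟨t, ht, -⟩ := F.existsUnique_gluing' (fun x : U ↦ V x.1) U
    (fun x ↦ homOfLE (hV x.1 x.2))
    (fun x hx' ↦ Opens.mem_iSup.mpr ⟨⟨x, hx'⟩, hx x hx'⟩) (fun x ↦ s x.1) (by
      intro x y
      refine huniq _ _ _ (inf_le_left.trans (hV x.1 x.2)) (hres _ _ _ _ (hs x.1 x.2))
        (hres _ _ _ _ (hs y.1 y.2)))
  refine ⟨t, fun x hx' ↦ ⟨V x, hV x hx', hx x hx', ?_⟩⟩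
  have := ht ⟨x, hx'⟩
  exact this ▸ hs x hx'

end Gluing

/-! ### The quotients `𝒪_C / I ^ n` as sheaves on `C`. -/

section QuotSheaf

variable {C : Scheme.{u}} (T : Thickenings C)

/-- The push-forward to `C` of the structure sheaf of `T_n`, as a sheaf of abelian groups. -/
def quotSheaf (n : ℕ) : TopCat.Sheaf AddCommGrpCat.{u} C :=
  (TopCat.Sheaf.pushforward _ (T.toBase n).base).obj (structureSheafAb (T.obj n))

/-- The push-forward to `C` of the pull-back of `F` to `T_n`, as a sheaf of abelian groups. -/
def quotModuleSheaf (F : C.Modules) (n : ℕ) : TopCat.Sheaf AddCommGrpCat.{u} C :=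
  (TopCat.Sheaf.pushforward _ (T.toBase n).base).obj
    ⟨((Scheme.Modules.pullback (T.toBase n)).obj F).presheaf, Scheme.Modules.isSheaf _⟩

/-- The projection `𝒪_C / I ^ n ⟶ 𝒪_C / I ^ m`, as a morphism of sheaves. -/
def quotSheafProj {m n : ℕ} (h : m ≤ n) : quotSheaf T n ⟶ quotSheaf T m := ⟨{
  app U := AddCommGrpCat.ofHom (quotProj T U.unop m n h).toAddMonoidHom
  naturality U V f := by
    ext x
    exact quotProj_quotRes T f.unop.le m n h x }⟩

lemma quotRes_quotRes {U V W : C.Opens} (h : V ≤ U) (h' : W ≤ V) (n : ℕ)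
    (a : QuotSections T U n) : quotRes T h' n (quotRes T h n a) = quotRes T (h'.trans h) n a := by
  have : (T.obj n).presheaf.map (homOfLE ((T.toBase n).preimage_mono h)).op ≫
      (T.obj n).presheaf.map (homOfLE ((T.toBase n).preimage_mono h')).op =
      (T.obj n).presheaf.map (homOfLE ((T.toBase n).preimage_mono (h'.trans h))).op := by
    rw [← Functor.map_comp]; rfl
  exact congr($(this).hom a)

lemma quotProj_quotProj (U : C.Opens) {l m n : ℕ} (h : l ≤ m) (h' : m ≤ n)
    (hi : T.incl h ≫ T.incl h' = T.incl (h.trans h'))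
    (a : QuotSections T U n) :
    quotProj T U l m h (quotProj T U m n h' a) = quotProj T U l n (h.trans h') a := by
  have key := Scheme.Hom.appLE_comp_appLE (T.incl h) (T.incl h') (T.toBase n ⁻¹ᵁ U)
    (T.toBase m ⁻¹ᵁ U) (T.toBase l ⁻¹ᵁ U) (preimage_le_preimage _ _ _ (T.incl_toBase h') U)
    (preimage_le_preimage _ _ _ (T.incl_toBase h) U)
  have key2 : (T.incl h ≫ T.incl h').appLE (T.toBase n ⁻¹ᵁ U) (T.toBase l ⁻¹ᵁ U)
      (by rw [hi]; exact preimage_le_preimage _ _ _ (T.incl_toBase _) U) =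
      (T.incl (h.trans h')).appLE (T.toBase n ⁻¹ᵁ U) (T.toBase l ⁻¹ᵁ U)
        (preimage_le_preimage _ _ _ (T.incl_toBase _) U) := by
    congr 1
  exact congr($(key.trans key2).hom a)

/-- The projection from the sections of `𝒪_C` to those of `𝒪_C / I ^ n`. -/
def toQuot (U : C.Opens) (n : ℕ) : Γ(C, U) →+* QuotSections T U n :=
  ((T.toBase n).app U).hom

lemma quotRes_toQuot {U V : C.Opens} (h : V ≤ U) (n : ℕ) (c : Γ(C, U)) :
    quotRes T h n (toQuot T U n c) = toQuot T V n ((C.presheaf.map (homOfLE h).op).hom c) :=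
  congr($((T.toBase n).naturality (homOfLE h).op).hom c).symm

lemma quotProj_toQuot (U : C.Opens) {m n : ℕ} (h : m ≤ n) (c : Γ(C, U)) :
    quotProj T U m n h (toQuot T U n c) = toQuot T U m c := by
  have key : (T.toBase n).app U ≫ (T.incl h).appLE (T.toBase n ⁻¹ᵁ U) (T.toBase m ⁻¹ᵁ U)
      (preimage_le_preimage _ _ _ (T.incl_toBase h) U) = (T.toBase m).app U := by
    have e1 : (T.toBase n).app U = (T.toBase n).appLE U (T.toBase n ⁻¹ᵁ U) le_rfl :=
      ((T.toBase n).app_eq_appLE)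
    rw [e1, Scheme.Hom.appLE_comp_appLE, Scheme.Hom.app_eq_appLE]
    congr 1
    exact T.incl_toBase h
  exact congr($(key).hom c)

lemma quot_ext {n : ℕ} {U : C.Opens} (s t : QuotSections T U n)
    (h : ∀ x ∈ U, ∃ (V : C.Opens) (i : V ≤ U), x ∈ V ∧ quotRes T i n s = quotRes T i n t) :
    s = t :=
  sheaf_ext (quotSheaf T n) s t h

lemma quot_glue {n : ℕ} {U : C.Opens} (P : ∀ V : C.Opens, QuotSections T V n → Prop)
    (hres : ∀ (V W : C.Opens) (i : W ≤ V) (s : QuotSections T V n), P V s → P W (quotRes T i n s))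
    (huniq : ∀ (V : C.Opens) (s t : QuotSections T V n), V ≤ U → P V s → P V t → s = t)
    (hloc : ∀ x ∈ U, ∃ V : C.Opens, x ∈ V ∧ V ≤ U ∧ ∃ s, P V s) :
    ∃ s : QuotSections T U n, ∀ x ∈ U, ∃ (V : C.Opens) (i : V ≤ U), x ∈ V ∧
      P V (quotRes T i n s) :=
  sheaf_glue (quotSheaf T n) P hres huniq hloc

end QuotSheaf

/-! ### Closed subschemes over affine opens. -/

section Subscheme

variable {C : Scheme.{u}} (I : C.IdealSheafData)

/-- The push-forward to `C` of the structure sheaf of the closed subscheme defined by `I`, as a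
sheaf of abelian groups. -/
def subschemeSheaf : TopCat.Sheaf AddCommGrpCat.{u} C :=
  (TopCat.Sheaf.pushforward _ I.subschemeι.base).obj (structureSheafAb I.subscheme)

lemma subscheme_ext {U : C.Opens} (s t : SubschemeSections I U)
    (h : ∀ x ∈ U, ∃ (V : C.Opens) (i : V ≤ U), x ∈ V ∧ subschemeRes I i s = subschemeRes I i t) :
    s = t :=
  sheaf_ext (subschemeSheaf I) s t h

lemma subscheme_glue {U : C.Opens} (P : ∀ V : C.Opens, SubschemeSections I V → Prop)
    (hres : ∀ (V W : C.Opens) (i : W ≤ V) (s : SubschemeSections I V), P V s →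
      P W (subschemeRes I i s))
    (huniq : ∀ (V : C.Opens) (s t : SubschemeSections I V), V ≤ U → P V s → P V t → s = t)
    (hloc : ∀ x ∈ U, ∃ V : C.Opens, x ∈ V ∧ V ≤ U ∧ ∃ s, P V s) :
    ∃ s : SubschemeSections I U, ∀ x ∈ U, ∃ (V : C.Opens) (i : V ≤ U), x ∈ V ∧
      P V (subschemeRes I i s) :=
  sheaf_glue (subschemeSheaf I) P hres huniq hloc

lemma toQuot_surjective (U : C.affineOpens) (n : ℕ) :
    Function.Surjective (toQuot (nbhds I) U.1 n) :=
  (I ^ n).subschemeι_app_surjective U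

lemma toQuot_eq_zero_iff (U : C.affineOpens) (n : ℕ) (c : Γ(C, U.1)) :
    toQuot (nbhds I) U.1 n c = 0 ↔ c ∈ I.ideal U ^ n := by
  have := (I ^ n).ker_subschemeι_app U
  rw [← RingHom.mem_ker]
  exact iff_of_eq congr(c ∈ $this)

lemma toSubscheme_eq_zero_iff (U : C.affineOpens) (c : Γ(C, U.1)) :
    (I.subschemeι.app U.1).hom c = 0 ↔ c ∈ I.ideal U := by
  rw [← I.ker_subschemeι_app U, RingHom.mem_ker]

end Subscheme

/-! ### Powers of a local equation of a Cartier divisor -/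

section Algebra

variable {B : Type*} [CommRing B]

/-- This makes the `n`-th power of a lift of a class in `J / J ^ 2` well defined in `J ^ n / J ^ (n
+ 1)`. -/
lemma pow_sub_pow_mem {J : Ideal B} {t t' : B} (ht : t ∈ J) (ht' : t' ∈ J) (h : t - t' ∈ J ^ 2)
    (n : ℕ) : t ^ n - t' ^ n ∈ J ^ (n + 1) := by
  induction n with
  | zero => simp
  | succ n ih =>
    have e : t ^ (n + 1) - t' ^ (n + 1) = (t ^ n - t' ^ n) * t + t' ^ n * (t - t') := by ring
    rw [e]
    refine add_mem ?_ ?_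
    · rw [pow_succ J (n + 1)]
      exact Ideal.mul_mem_mul ih ht
    · rw [show n + 1 + 1 = n + 2 from rfl, pow_add]
      exact Ideal.mul_mem_mul (Ideal.pow_mem_pow ht' n) h

variable {f t c : B}

/-- Since `c * t` and `f` agree modulo `f ^ 2`, one has `y * f ^ n ≡ y * c ^ n * t ^ n` modulo `f ^
(n + 1)`: the power `t ^ n` generates the graded piece. -/
lemma exists_sub_mul_pow_mem (ht : t ∈ Ideal.span {f}) (hc : f - c * t ∈ Ideal.span {f} ^ 2)
    {n : ℕ} {x : B} (hx : x ∈ Ideal.span {f} ^ n) :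
    ∃ a, x - a * t ^ n ∈ Ideal.span {f} ^ (n + 1) := by
  have h := pow_sub_pow_mem (Ideal.mem_span_singleton_self f) (Ideal.mul_mem_left _ c ht) hc n
  rw [Ideal.span_singleton_pow] at hx
  obtain ⟨y, rfl⟩ := Ideal.mem_span_singleton'.mp hx
  refine ⟨y * c ^ n, ?_⟩
  have := Ideal.mul_mem_left _ y h
  convert this using 1
  ring

/-- Multiplying by `c ^ n` replaces `t ^ n` by `f ^ n`, which can be cancelled because `f` is not a
zero divisor. -/
lemma mem_of_mul_pow_mem (hf : f ∈ nonZeroDivisors B) (hc : f - c * t ∈ Ideal.span {f} ^ 2)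
    (ht : t ∈ Ideal.span {f}) {n : ℕ} {a : B} (ha : a * t ^ n ∈ Ideal.span {f} ^ (n + 1)) :
    a ∈ Ideal.span {f} := by
  have h := pow_sub_pow_mem (Ideal.mem_span_singleton_self f) (Ideal.mul_mem_left _ c ht) hc n
  have h1 : a * f ^ n ∈ Ideal.span {f} ^ (n + 1) := by
    have := add_mem (Ideal.mul_mem_left _ a h) (Ideal.mul_mem_left _ (c ^ n) ha)
    convert this using 1
    ring
  rw [Ideal.span_singleton_pow] at h1
  obtain ⟨y, hy⟩ := Ideal.mem_span_singleton'.mp h1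
  refine Ideal.mem_span_singleton'.mpr ⟨y, ?_⟩
  have h2 : (y * f - a) * f ^ n = 0 := by rw [sub_mul, ← hy]; ring
  exact sub_eq_zero.mp ((mul_right_mem_nonZeroDivisors_eq_zero_iff (pow_mem hf n)).mp h2)

end Algebra

/-! ### Local equations on small affine opens. -/

section Cartier

variable {C : Scheme.{u}} {I : C.IdealSheafData}

/-- On a basic open the equation remains a generator, and localization keeps it a nonzerodivisor. -/
lemma IsEffectiveCartier.exists_le (hI : IsEffectiveCartier I) {U : C.Opens} {x : C}
    (hx : x ∈ U) : ∃ V : C.affineOpens, x ∈ V.1 ∧ V.1 ≤ U ∧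
      ∃ f ∈ nonZeroDivisors Γ(C, V.1), I.ideal V = Ideal.span {f} := by
  obtain ⟨W, hxW, f, hf, hW⟩ := hI x
  obtain ⟨s, hsU, hxs⟩ := W.2.exists_basicOpen_le (V := U) ⟨x, hx⟩ hxW
  have hs := W.2.isLocalization_basicOpen s
  have hle : C.basicOpen s ≤ W.1 := C.basicOpen_le s
  let V : C.affineOpens := ⟨C.basicOpen s, W.2.basicOpen s⟩
  refine ⟨V, hxs, hsU, (C.presheaf.map (homOfLE hle).op).hom f, ?_, ?_⟩
  · exact IsLocalization.map_nonZeroDivisors_le (Submonoid.powers s) Γ(C, C.basicOpen s)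
      ⟨f, hf, rfl⟩
  · rw [← I.map_ideal (U := V) (V := W) hle, hW, Ideal.map_span, Set.image_singleton]
    rfl

end Cartier

/-! ### Projections between closed subschemes. -/

section Projections

variable {C : Scheme.{u}} (I : C.IdealSheafData)

lemma appLE_congr_hom {X Y : Scheme.{u}} {f g : X ⟶ Y} (h : f = g) {U : Y.Opens} {V : X.Opens}
    (e : V ≤ f ⁻¹ᵁ U) (e' : V ≤ g ⁻¹ᵁ U) : f.appLE U V e = g.appLE U V e' := by
  subst h; rfl

lemma appLE_eq_id {X : Scheme.{u}} {f : X ⟶ X} (h : f = 𝟙 X) {U : X.Opens} (e : U ≤ f ⁻¹ᵁ U) :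
    f.appLE U U e = 𝟙 _ := by
  subst h
  rw [Scheme.Hom.appLE, Scheme.Hom.id_app]
  exact (Category.id_comp _).trans (X.presheaf.map_id _)

lemma subschemeProj_toSubscheme {J J' : C.IdealSheafData} (h : J ≤ J') (U : C.Opens)
    (c : Γ(C, U)) :
    subschemeProj h U ((J.subschemeι.app U).hom c) = (J'.subschemeι.app U).hom c := by
  have key : J.subschemeι.app U ≫ (Scheme.IdealSheafData.inclusion h).appLE (J.subschemeι ⁻¹ᵁ U)
      (J'.subschemeι ⁻¹ᵁ U) (preimage_le_preimage _ _ _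
        (Scheme.IdealSheafData.inclusion_subschemeι h) U) = J'.subschemeι.app U := by
    rw [J.subschemeι.app_eq_appLE, J'.subschemeι.app_eq_appLE, Scheme.Hom.appLE_comp_appLE]
    exact appLE_congr_hom (Scheme.IdealSheafData.inclusion_subschemeι h) _ _
  exact congr($(key).hom c)

lemma subschemeProj_toQuot (n : ℕ) {J : C.IdealSheafData} (h : I ^ n ≤ J) (U : C.Opens)
    (c : Γ(C, U)) : subschemeProj h U (toQuot (nbhds I) U n c) = (J.subschemeι.app U).hom c :=
  subschemeProj_toSubscheme h U c

lemma subschemeProj_subschemeRes {J J' : C.IdealSheafData} (h : J ≤ J') {U V : C.Opens}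
    (i : V ≤ U) (a : SubschemeSections J U) :
    subschemeProj h V (subschemeRes J i a) = subschemeRes J' i (subschemeProj h U a) := by
  have key : J.subscheme.presheaf.map (homOfLE (J.subschemeι.preimage_mono i)).op ≫
      (Scheme.IdealSheafData.inclusion h).appLE (J.subschemeι ⁻¹ᵁ V) (J'.subschemeι ⁻¹ᵁ V)
        (preimage_le_preimage _ _ _ (Scheme.IdealSheafData.inclusion_subschemeι h) V) =
      (Scheme.IdealSheafData.inclusion h).appLE (J.subschemeι ⁻¹ᵁ U) (J'.subschemeι ⁻¹ᵁ U)
        (preimage_le_preimage _ _ _ (Scheme.IdealSheafData.inclusion_subschemeι h) U) ≫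
      J'.subscheme.presheaf.map (homOfLE (J'.subschemeι.preimage_mono i)).op := by
    rw [Scheme.Hom.map_appLE, Scheme.Hom.appLE_map]
  exact congr($(key).hom a)

lemma quotProj_nbhds (U : C.Opens) {l m n : ℕ} (h : l ≤ m) (h' : m ≤ n)
    (a : QuotSections (nbhds I) U n) :
    quotProj (nbhds I) U l m h (quotProj (nbhds I) U m n h' a) =
      quotProj (nbhds I) U l n (h.trans h') a :=
  quotProj_quotProj (nbhds I) U h h'
    (Scheme.IdealSheafData.inclusion_comp (pow_le_pow I h') (pow_le_pow I h)) a

lemma quotProj_rfl (U : C.Opens) (n : ℕ) (a : QuotSections (nbhds I) U n) :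
    quotProj (nbhds I) U n n le_rfl a = a := by
  have key : (Scheme.IdealSheafData.inclusion (pow_le_pow I (le_refl n))).appLE
      ((I ^ n).subschemeι ⁻¹ᵁ U) ((I ^ n).subschemeι ⁻¹ᵁ U) (preimage_le_preimage _ _ _
        (Scheme.IdealSheafData.inclusion_subschemeι _) U) = 𝟙 _ :=
    appLE_eq_id (Scheme.IdealSheafData.inclusion_id (I ^ n)) _
  exact congr($(key).hom a)

end Projections

/-! ### The action of `𝒪_P` on `𝒪_C / I ^ n`. -/

section Retraction

variable {C S : Scheme.{u}} (π : C ⟶ S) (I : C.IdealSheafData) [IsSection π I]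

lemma subschemeProj_quotStructureMap (n : ℕ) (h : I ^ n ≤ I) (U : C.Opens)
    (a : SubschemeSections I U) :
    subschemeProj h U (quotStructureMap π I n U a) = a := by
  have e : Scheme.IdealSheafData.inclusion h ≫ retraction π I n = 𝟙 _ := by
    rw [retraction, Scheme.IdealSheafData.inclusion_subschemeι_assoc, ← Category.assoc,
      IsIso.hom_inv_id]
  have key : (retraction π I n).appLE (I.subschemeι ⁻¹ᵁ U) ((I ^ n).subschemeι ⁻¹ᵁ U)
      (preimage_le_retraction π I n U) ≫ (Scheme.IdealSheafData.inclusion h).appLE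
        ((I ^ n).subschemeι ⁻¹ᵁ U) (I.subschemeι ⁻¹ᵁ U) (preimage_le_preimage _ _ _
          (Scheme.IdealSheafData.inclusion_subschemeι h) U) = 𝟙 _ := by
    rw [Scheme.Hom.appLE_comp_appLE]
    exact appLE_eq_id e _
  exact congr($(key).hom a)

lemma quotRes_quotStructureMap {U V : C.Opens} (h : V ≤ U) (n : ℕ) (a : SubschemeSections I U) :
    quotRes (nbhds I) h n (quotStructureMap π I n U a) =
      quotStructureMap π I n V (subschemeRes I h a) := by
  have key : (retraction π I n).appLE (I.subschemeι ⁻¹ᵁ U) ((I ^ n).subschemeι ⁻¹ᵁ U)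
      (preimage_le_retraction π I n U) ≫
      (I ^ n).subscheme.presheaf.map (homOfLE ((I ^ n).subschemeι.preimage_mono h)).op =
      I.subscheme.presheaf.map (homOfLE (I.subschemeι.preimage_mono h)).op ≫
      (retraction π I n).appLE (I.subschemeι ⁻¹ᵁ V) ((I ^ n).subschemeι ⁻¹ᵁ V)
        (preimage_le_retraction π I n V) := by
    rw [Scheme.Hom.map_appLE, Scheme.Hom.appLE_map]
  exact congr($(key).hom a)

lemma pow_succ_le (n : ℕ) : I ^ (n + 1) ≤ I := by
  simpa using pow_le_pow I (Nat.succ_le_succ n.zero_le)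

/-- On an affine open, a section of `𝒪_P` acts on `𝒪_C / I ^ (n + 1)` through a lift which
represents it modulo `I`. -/
lemma exists_toQuot_eq_quotStructureMap (V : C.affineOpens) (n : ℕ) (a : SubschemeSections I V.1) :
    ∃ d : Γ(C, V.1), toQuot (nbhds I) V.1 (n + 1) d = quotStructureMap π I (n + 1) V.1 a ∧
      (I.subschemeι.app V.1).hom d = a := by
  obtain ⟨d, hd⟩ := toQuot_surjective I V (n + 1) (quotStructureMap π I (n + 1) V.1 a)
  refine ⟨d, hd, ?_⟩
  rw [← subschemeProj_toQuot I (n + 1) (pow_succ_le I n), hd, subschemeProj_quotStructureMap]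

end Retraction

/-! ### Generators of the conormal sheaf -/

section Generator

variable {C : Scheme.{u}} {I : C.IdealSheafData}

/-- A global section `t` of `𝒪_C / I ^ 2` which generates `I / I ^ 2`. -/
structure IsConormalGenerator (t : QuotSections (nbhds I) ⊤ 2) : Prop where
  proj_eq_zero : subschemeProj (sq_le I) ⊤ t = 0
  exists_eq_mul (V : C.affineOpens) (x : QuotSections (nbhds I) V.1 2)
    (hx : subschemeProj (sq_le I) V.1 x = 0) :
    ∃ c : Γ(C, V.1), x = toQuot (nbhds I) V.1 2 c * quotRes (nbhds I) le_top 2 t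

/-- The generator is the image of `1`. Over an affine open every section of `𝒪_P` comes from `𝒪_C`,
so `𝒪_C`-linearity of the isomorphism expresses every section as a multiple of it. -/
lemma IsConormalFreeOfRankOne.exists_generator (h : IsConormalFreeOfRankOne I) :
    ∃ t : QuotSections (nbhds I) ⊤ 2, IsConormalGenerator t := by
  obtain ⟨e, hres, hlin⟩ := h
  refine ⟨(e ⊤ 1).1, (e ⊤ 1).2, fun V x hx ↦ ?_⟩
  obtain ⟨c, hc⟩ := I.subschemeι_app_surjective V ((e V.1).symm ⟨x, hx⟩)
  refine ⟨c, ?_⟩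
  have h1 := hlin V.1 c 1
  have h2 := hres ⊤ V.1 le_top 1
  rw [map_one] at h2
  rw [mul_one, h2] at h1
  refine Eq.trans ?_ h1
  erw [hc, AddEquiv.apply_symm_apply]

variable {t : QuotSections (nbhds I) ⊤ 2} (ht : IsConormalGenerator t)
include ht

lemma IsConormalGenerator.mem_of_toQuot_eq {V : C.affineOpens} {t' : Γ(C, V.1)}
    (h : toQuot (nbhds I) V.1 2 t' = quotRes (nbhds I) le_top 2 t) : t' ∈ I.ideal V := by
  rw [← toSubscheme_eq_zero_iff, ← subschemeProj_toQuot I 2 (sq_le I), h]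
  refine (subschemeProj_subschemeRes (sq_le I) le_top t).trans ?_
  rw [ht.proj_eq_zero, map_zero]

lemma IsConormalGenerator.exists_sub_mul_mem {V : C.affineOpens} {t' f : Γ(C, V.1)}
    (h : toQuot (nbhds I) V.1 2 t' = quotRes (nbhds I) le_top 2 t) (hf : f ∈ I.ideal V) :
    ∃ c, f - c * t' ∈ I.ideal V ^ 2 := by
  obtain ⟨c, hc⟩ := ht.exists_eq_mul V (toQuot (nbhds I) V.1 2 f) (by
    rwa [subschemeProj_toQuot, toSubscheme_eq_zero_iff])
  refine ⟨c, ?_⟩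
  rw [← toQuot_eq_zero_iff, map_sub, map_mul, h, hc, sub_self]

end Generator

/-! ### Generators of the kernel of `𝒪_C / I ^ (n + 1) ⟶ 𝒪_C / I ^ n` -/

section KernelGenerator

variable {C : Scheme.{u}} {I : C.IdealSheafData}

/-- `g` is the `n`-th power of every local lift of `t` to `𝒪_C / I ^ (n + 1)`. -/
def IsPowLift (t : QuotSections (nbhds I) ⊤ 2) (n : ℕ) {U : C.Opens}
    (g : QuotSections (nbhds I) U (n + 1)) : Prop :=
  ∀ (W : C.affineOpens) (h : W.1 ≤ U) (t' : Γ(C, W.1)),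
    toQuot (nbhds I) W.1 2 t' = quotRes (nbhds I) le_top 2 t →
    toQuot (nbhds I) W.1 (n + 1) (t' ^ n) = quotRes (nbhds I) h (n + 1) g

lemma exists_affine_le {U : C.Opens} {x : C} (hx : x ∈ U) :
    ∃ V : C.affineOpens, x ∈ V.1 ∧ V.1 ≤ U := by
  obtain ⟨V, hV, hxV, hle⟩ := Opens.isBasis_iff_nbhd.mp C.isBasis_affineOpens hx
  exact ⟨⟨V, hV⟩, hxV, hle⟩

variable {t : QuotSections (nbhds I) ⊤ 2} {n : ℕ}

lemma IsPowLift.res {U V : C.Opens} {g : QuotSections (nbhds I) U (n + 1)} (hg : IsPowLift t n g)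
    (i : V ≤ U) : IsPowLift t n (quotRes (nbhds I) i (n + 1) g) := by
  intro W h t' ht'
  rw [quotRes_quotRes]
  exact hg W _ t' ht'

/-- Over an affine open `t` has a lift to `𝒪_C`, and the power of that lift determines the section.
-/
lemma IsPowLift.unique {U : C.Opens} {g g' : QuotSections (nbhds I) U (n + 1)}
    (hg : IsPowLift t n g) (hg' : IsPowLift t n g') : g = g' := by
  refine quot_ext _ _ _ fun x hx ↦ ?_
  obtain ⟨V, hxV, hV⟩ := exists_affine_le hx
  obtain ⟨t', ht'⟩ := toQuot_surjective I V 2 (quotRes (nbhds I) le_top 2 t)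
  exact ⟨V, hV, hxV, (hg V hV t' ht').symm.trans (hg' V hV t' ht')⟩

lemma toQuot_res_eq {V W : C.Opens} (h : W ≤ V) {t' : Γ(C, V)}
    (ht' : toQuot (nbhds I) V 2 t' = quotRes (nbhds I) le_top 2 t) :
    toQuot (nbhds I) W 2 ((C.presheaf.map (homOfLE h).op).hom t') =
      quotRes (nbhds I) le_top 2 t := by
  rw [← quotRes_toQuot, ht', quotRes_quotRes]

/-- The section `t` itself may have no global lift at this stage; only the `n`-th powers of its
local lifts are independent of choices and glue. -/
lemma IsConormalGenerator.exists_isPowLift (ht : IsConormalGenerator t) (n : ℕ) :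
    ∃ g : QuotSections (nbhds I) ⊤ (n + 1), IsPowLift t n g := by
  obtain ⟨g, hg⟩ := quot_glue (nbhds I) (n := n + 1) (U := ⊤) (fun _ g ↦ IsPowLift t n g)
    (fun V W i s hs ↦ hs.res i) (fun V s s' _ hs hs' ↦ hs.unique hs') (by
      intro x hx
      obtain ⟨V, hxV, hV⟩ := exists_affine_le hx
      obtain ⟨t', ht'⟩ := toQuot_surjective I V 2 (quotRes (nbhds I) le_top 2 t)
      refine ⟨V, hxV, hV, toQuot (nbhds I) V.1 (n + 1) (t' ^ n), fun W h t'' ht'' ↦ ?_⟩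
      rw [quotRes_toQuot, ← sub_eq_zero, ← map_sub, toQuot_eq_zero_iff, map_pow]
      have h1 := toQuot_res_eq h ht'
      refine pow_sub_pow_mem (ht.mem_of_toQuot_eq ht'') (ht.mem_of_toQuot_eq h1) ?_ n
      rw [← toQuot_eq_zero_iff, map_sub, h1, ht'', sub_self])
  refine ⟨g, fun W h t' ht' ↦ quot_ext _ _ _ fun x hx ↦ ?_⟩
  obtain ⟨V, hV, hxV, hPV⟩ := hg x trivial
  -- The glued section has the property only near each point, so the comparison is made on an affine
  -- open inside both `W` and `V`.
  obtain ⟨W', hxW', hW'⟩ := exists_affine_le (U := W.1 ⊓ V) ⟨hx, hxV⟩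
  refine ⟨W', hW'.trans inf_le_left, hxW', ?_⟩
  have := hPV W' (hW'.trans inf_le_right) _ (toQuot_res_eq (hW'.trans inf_le_left) ht')
  rw [quotRes_quotRes, ← map_pow, ← quotRes_toQuot] at this
  rw [this, quotRes_quotRes]

lemma IsPowLift.quotProj_eq_zero (ht : IsConormalGenerator t)
    {g : QuotSections (nbhds I) ⊤ (n + 1)} (hg : IsPowLift t n g) :
    quotProj (nbhds I) ⊤ n (n + 1) n.le_succ g = 0 := by
  refine quot_ext _ _ _ fun x hx ↦ ?_
  obtain ⟨V, hxV, hV⟩ := exists_affine_le hx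
  obtain ⟨t', ht'⟩ := toQuot_surjective I V 2 (quotRes (nbhds I) le_top 2 t)
  refine ⟨V, hV, hxV, ?_⟩
  rw [← quotProj_quotRes, ← hg V hV t' ht', quotProj_toQuot, map_zero, toQuot_eq_zero_iff]
  exact Ideal.pow_mem_pow (ht.mem_of_toQuot_eq ht') n

variable {S : Scheme.{u}} (π : C ⟶ S) [IsSection π I]

/-- Injectivity of `𝒪_P ⟶ I ^ n / I ^ (n + 1)`, `a ↦ a * g`. Near each point the claim is about an
equation `f` of `P`, and `mem_of_mul_pow_mem` applies. -/
lemma IsPowLift.eq_zero_of_quotStructureMap_mul (hI : IsEffectiveCartier I)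
    (ht : IsConormalGenerator t) {g : QuotSections (nbhds I) ⊤ (n + 1)} (hg : IsPowLift t n g)
    {U : C.Opens} {a : SubschemeSections I U}
    (h : quotStructureMap π I (n + 1) U a * quotRes (nbhds I) le_top (n + 1) g = 0) : a = 0 := by
  refine subscheme_ext _ _ _ fun x hx ↦ ?_
  obtain ⟨V, hxV, hV, f, hf, hIf⟩ := hI.exists_le hx
  refine ⟨V, hV, hxV, ?_⟩
  obtain ⟨t', ht'⟩ := toQuot_surjective I V 2 (quotRes (nbhds I) le_top 2 t)
  obtain ⟨d, hd, hd'⟩ := exists_toQuot_eq_quotStructureMap π I V n (subschemeRes I hV a)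
  obtain ⟨c, hc⟩ := ht.exists_sub_mul_mem ht' (f := f) (by
    rw [hIf]; exact Ideal.mem_span_singleton_self f)
  have h1 := congr(quotRes (nbhds I) hV (n + 1) $h)
  rw [map_mul, quotRes_quotStructureMap, ← hd, quotRes_quotRes, ← hg V le_top t' ht', ← map_mul,
    map_zero, toQuot_eq_zero_iff, hIf] at h1
  have h2 := ht.mem_of_toQuot_eq ht'
  rw [hIf] at hc h2
  rw [map_zero, ← hd', toSubscheme_eq_zero_iff, hIf]
  exact mem_of_mul_pow_mem hf hc h2 h1

/-- Surjectivity of the same map onto the kernel of the projection. Coefficients exist locally by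
`exists_sub_mul_pow_mem` and glue because they are unique by the injectivity just proved. -/
lemma IsPowLift.exists_quotStructureMap_mul_eq (hI : IsEffectiveCartier I)
    (ht : IsConormalGenerator t) {g : QuotSections (nbhds I) ⊤ (n + 1)} (hg : IsPowLift t n g)
    {U : C.Opens} {x : QuotSections (nbhds I) U (n + 1)}
    (h : quotProj (nbhds I) U n (n + 1) n.le_succ x = 0) :
    ∃ a : SubschemeSections I U,
      quotStructureMap π I (n + 1) U a * quotRes (nbhds I) le_top (n + 1) g = x := by
  obtain ⟨a, ha⟩ := subscheme_glue I (U := U) (fun V a ↦ ∃ hV : V ≤ U,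
    quotStructureMap π I (n + 1) V a * quotRes (nbhds I) le_top (n + 1) g =
      quotRes (nbhds I) hV (n + 1) x) (by
      rintro V W i a ⟨hV, ha⟩
      refine ⟨i.trans hV, ?_⟩
      have := congr(quotRes (nbhds I) i (n + 1) $ha)
      rwa [map_mul, quotRes_quotStructureMap, quotRes_quotRes, quotRes_quotRes] at this) (by
      rintro V a b hV ⟨_, ha⟩ ⟨_, hb⟩
      rw [← sub_eq_zero]
      refine hg.eq_zero_of_quotStructureMap_mul π hI ht ?_
      rw [map_sub, sub_mul, ha, hb, sub_self]) (by
      intro y hy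
      obtain ⟨V, hyV, hV, f, hf, hIf⟩ := hI.exists_le hy
      obtain ⟨t', ht'⟩ := toQuot_surjective I V 2 (quotRes (nbhds I) le_top 2 t)
      obtain ⟨c, hc⟩ := ht.exists_sub_mul_mem ht' (f := f) (by
        rw [hIf]; exact Ideal.mem_span_singleton_self f)
      obtain ⟨b, hb⟩ := toQuot_surjective I V (n + 1) (quotRes (nbhds I) hV (n + 1) x)
      have h1 := congr(quotRes (nbhds I) hV n $h)
      rw [← quotProj_quotRes, ← hb, quotProj_toQuot, map_zero, toQuot_eq_zero_iff] at h1
      have h2 := ht.mem_of_toQuot_eq ht'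
      rw [hIf] at hc h2 h1
      obtain ⟨d, hd⟩ := exists_sub_mul_pow_mem h2 hc h1
      -- The action of `𝒪_P` goes through the retraction, so it is represented by some `d'` in
      -- general different from `d`. The two differ by an element of `I`, and `(d' - d) * t' ^ n`
      -- vanishes modulo `I ^ (n + 1)`.
      obtain ⟨d', hd', hdd⟩ := exists_toQuot_eq_quotStructureMap π I V n
        ((I.subschemeι.app V.1).hom d)
      refine ⟨V, hyV, hV, (I.subschemeι.app V.1).hom d, hV, ?_⟩
      rw [← hd', ← hg V le_top t' ht', ← hb, ← map_mul, ← sub_eq_zero, ← map_sub,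
        toQuot_eq_zero_iff]
      have h3 : d' - d ∈ I.ideal V := by
        rw [← toSubscheme_eq_zero_iff, map_sub, hdd, sub_self]
      have h4 : (d' - d) * t' ^ n ∈ I.ideal V ^ (n + 1) := by
        rw [pow_succ']
        exact Ideal.mul_mem_mul h3 (Ideal.pow_mem_pow (ht.mem_of_toQuot_eq ht') n)
      rw [← hIf] at hd
      convert sub_mem h4 hd using 1
      ring)
  refine ⟨a, quot_ext _ _ _ fun y hy ↦ ?_⟩
  obtain ⟨V, i, hyV, _, hPV⟩ := ha y hy
  refine ⟨V, i, hyV, ?_⟩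
  rw [map_mul, quotRes_quotStructureMap, quotRes_quotRes, hPV]

end KernelGenerator

/-! ### Lifting global sections of sheaves supported on a section -/

section SupportedOn

open Opposite

variable {C S : Scheme.{u}} (π : C ⟶ S) (I : C.IdealSheafData)

/-- The restriction maps of `F` between opens with the same trace on the closed subscheme defined
by `I` are bijective. -/
def IsSupportedOn (F : TopCat.Sheaf AddCommGrpCat.{u} C) : Prop :=
  ∀ (U V : C.Opens) (h : V ≤ U), I.subschemeι ⁻¹ᵁ U ≤ I.subschemeι ⁻¹ᵁ V →
    Function.Bijective (F.obj.map (homOfLE h).op)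

/-- For `n > 0` the thickening has the same points as `P`; for `n = 0` it is empty. -/
lemma preimage_le_of_subscheme {U V : C.Opens} (h : I.subschemeι ⁻¹ᵁ U ≤ I.subschemeι ⁻¹ᵁ V)
    (n : ℕ) : (I ^ n).subschemeι ⁻¹ᵁ U ≤ (I ^ n).subschemeι ⁻¹ᵁ V := by
  intro x hx
  have hs : (I ^ n).subschemeι x ∈ (I ^ n).support := by
    rw [← SetLike.mem_coe, ← Scheme.IdealSheafData.range_subschemeι]
    exact ⟨x, rfl⟩
  rcases Nat.eq_zero_or_pos n with rfl | hn
  · have h0 : (I ^ 0).support = ⊥ := by simp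
    rw [h0] at hs
    exact absurd hs (Set.notMem_empty _)
  · rw [Scheme.IdealSheafData.support_pow _ _ hn.ne', ← SetLike.mem_coe,
      ← Scheme.IdealSheafData.range_subschemeι] at hs
    obtain ⟨y, hy⟩ := hs
    change (I ^ n).subschemeι x ∈ V
    rw [← hy]
    refine h (x := y) ?_
    change I.subschemeι y ∈ U
    rw [hy]
    exact hx

lemma bijective_map_of_le {X : TopCat.{u}} (F : TopCat.Presheaf AddCommGrpCat.{u} X)
    {U V : Opens X} (i : V ⟶ U) (h : U ≤ V) : Function.Bijective (F.map i.op) := by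
  have : IsIso i := ⟨homOfLE h, Subsingleton.elim _ _, Subsingleton.elim _ _⟩
  exact ConcreteCategory.bijective_of_isIso _

lemma isSupportedOn_quotSheaf (n : ℕ) : IsSupportedOn I (quotSheaf (nbhds I) n) :=
  fun _ _ h h' ↦ bijective_map_of_le (structureSheafAb (I ^ n).subscheme).obj
    (homOfLE ((I ^ n).subschemeι.preimage_mono h)) (preimage_le_of_subscheme I h' n)

/-- The isomorphism of `𝒪_S` with the push-forward of the structure sheaf of a section. -/
def structureSheafAbToSection : structureSheafAb S ⟶
    (TopCat.Sheaf.pushforward _ π.base).obj (subschemeSheaf I) := ⟨{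
  app U := AddCommGrpCat.ofHom ((I.subschemeι ≫ π).app U.unop).hom.toAddMonoidHom
  naturality U V f := by
    ext x
    exact congr($((I.subschemeι ≫ π).naturality f).hom x) }⟩

lemma structureSheafAbToSection_bijective [IsSection π I] (U : S.Opens) :
    Function.Bijective ((structureSheafAbToSection π I).hom.app (op U)) :=
  ConcreteCategory.bijective_of_isIso ((I.subschemeι ≫ π).app U)

/-- The cohomological hypothesis lives on `S`, so `p` is pushed forward along `π`. The kernel
becomes `𝒪_S ^ r`; local surjectivity survives since only the traces of opens on `P` matter, and
these correspond to opens of `S`. -/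
lemma surjective_app_top_of_isSupportedOn [IsSection π I]
    (hH1 : Subsingleton (Sheaf.H (structureSheafAb S) 1))
    {E G : TopCat.Sheaf AddCommGrpCat.{u} C} (hE : IsSupportedOn I E) (hG : IsSupportedOn I G)
    (p : E ⟶ G) {r : ℕ}
    (φ : Fin r → (subschemeSheaf I ⟶ E)) (hφ : ∀ i, φ i ≫ p = 0)
    (hinj : ∀ (U : C.Opens) (a : Fin r → SubschemeSections I U),
      ∑ i, (φ i).hom.app (op U) (a i) = 0 → a = 0)
    (hker : ∀ (U : C.Opens) (x : E.obj.obj (op U)), p.hom.app (op U) x = 0 →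
      ∃ a : Fin r → SubschemeSections I U, ∑ i, (φ i).hom.app (op U) (a i) = x)
    (hsurj : ∀ (U : C.Opens) (t : G.obj.obj (op U)), ∀ x ∈ U, x ∈ I.support →
      ∃ (V : C.Opens) (i : V ≤ U), x ∈ V ∧
        ∃ s : E.obj.obj (op V), p.hom.app (op V) s = G.obj.map (homOfLE i).op t) :
    Function.Surjective (p.hom.app (op ⊤)) := by
  refine surjective_app_top_of_kernel_eq_pow hH1
    ((TopCat.Sheaf.pushforward AddCommGrpCat.{u} π.base).map p)
    (fun i ↦ structureSheafAbToSection π I ≫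
      (TopCat.Sheaf.pushforward AddCommGrpCat.{u} π.base).map (φ i)) (fun i ↦ ?_)
    (fun U a ha ↦ ?_) (fun U x hx ↦ ?_) (fun U t x hx ↦ ?_)
  · ext U a
    exact congr(($(hφ i)).hom.app (op (π ⁻¹ᵁ U.unop))
      ((structureSheafAbToSection π I).hom.app U a))
  · have h0 := hinj (π ⁻¹ᵁ U) (fun i ↦ (structureSheafAbToSection π I).hom.app (op U) (a i)) ha
    ext i
    refine (structureSheafAbToSection_bijective π I U).1 ((congr_fun h0 i).trans ?_)
    exact (map_zero ((structureSheafAbToSection π I).hom.app (op U)).hom).symm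
  · obtain ⟨a, ha⟩ := hker (π ⁻¹ᵁ U) x hx
    choose b hb using fun i ↦ (structureSheafAbToSection_bijective π I U).2 (a i)
    refine ⟨b, Eq.trans (Finset.sum_congr rfl fun i _ ↦ ?_) ha⟩
    exact congr((φ i).hom.app (op (π ⁻¹ᵁ U)) $(hb i))
  · let y : I.subscheme := inv (I.subschemeι ≫ π) x
    have hy : π (I.subschemeι y) = x := by
      have : inv (I.subschemeι ≫ π) ≫ I.subschemeι ≫ π = 𝟙 S := by simp
      exact congr($this x)
    obtain ⟨V, i, hxV, s, hs⟩ := hsurj (π ⁻¹ᵁ U) t (I.subschemeι y) (by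
      change π (I.subschemeι y) ∈ U
      rwa [hy]) (by
      rw [← SetLike.mem_coe, ← Scheme.IdealSheafData.range_subschemeι]
      exact ⟨y, rfl⟩)
    -- `W` is the trace of `V` on `P`, transported to `S`. The opens `π ⁻¹ᵁ W` and `π ⁻¹ᵁ W ⊓ V`
    -- have the same trace on `P`, so the lift found over `V` extends from the intersection to `π
    -- ⁻¹ᵁ W`.
    let W : S.Opens := inv (I.subschemeι ≫ π) ⁻¹ᵁ (I.subschemeι ⁻¹ᵁ V)
    have hWV : I.subschemeι ⁻¹ᵁ (π ⁻¹ᵁ W) = I.subschemeι ⁻¹ᵁ V := by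
      have : (I.subschemeι ≫ π) ≫ inv (I.subschemeι ≫ π) = 𝟙 _ := by simp
      change ((I.subschemeι ≫ π) ≫ inv (I.subschemeι ≫ π)) ⁻¹ᵁ (I.subschemeι ⁻¹ᵁ V) = _
      rw [this]
      rfl
    have hWU : W ≤ U := by
      intro z hz
      have : inv (I.subschemeι ≫ π) ≫ I.subschemeι ≫ π = 𝟙 S := by simp
      have h1 : π (I.subschemeι (inv (I.subschemeι ≫ π) z)) = z := congr($this z)
      have h2 : π (I.subschemeι (inv (I.subschemeι ≫ π) z)) ∈ U := i hz
      rwa [h1] at h2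
    have hb : I.subschemeι ⁻¹ᵁ (π ⁻¹ᵁ W) ≤ I.subschemeι ⁻¹ᵁ (π ⁻¹ᵁ W ⊓ V) := by
      intro z hz
      exact ⟨hz, hWV.le hz⟩
    obtain ⟨s', hs'⟩ := (hE _ _ inf_le_left hb).2
      (E.obj.map (homOfLE (inf_le_right : π ⁻¹ᵁ W ⊓ V ≤ V)).op s)
    refine ⟨W, homOfLE hWU, hxV, s', ?_⟩
    refine (hG _ _ inf_le_left hb).1 ?_
    have n1 := congr($(p.hom.naturality (homOfLE (inf_le_left : π ⁻¹ᵁ W ⊓ V ≤ π ⁻¹ᵁ W)).op) s')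
    have n2 := congr($(p.hom.naturality (homOfLE (inf_le_right : π ⁻¹ᵁ W ⊓ V ≤ V)).op) s)
    have m1 := congr($(G.obj.map_comp (homOfLE i).op
      (homOfLE (inf_le_right : π ⁻¹ᵁ W ⊓ V ≤ V)).op) t)
    have m2 := congr($(G.obj.map_comp (homOfLE (π.preimage_mono hWU)).op
      (homOfLE (inf_le_left : π ⁻¹ᵁ W ⊓ V ≤ π ⁻¹ᵁ W)).op) t)
    refine n1.symm.trans ((congr(p.hom.app _ $hs')).trans (n2.trans ?_))
    refine (congr(G.obj.map (homOfLE (inf_le_right : π ⁻¹ᵁ W ⊓ V ≤ V)).op $hs)).trans ?_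
    exact m1.symm.trans m2

end SupportedOn

/-! ### Lifting global sections of `𝒪_C / I ^ n`. -/

section LiftRing

variable {C S : Scheme.{u}} (π : C ⟶ S) (I : C.IdealSheafData) [IsSection π I]

/-- Multiplication by a global section `g` of `𝒪_C / I ^ n`, as a morphism `𝒪_P ⟶ 𝒪_C / I ^ n`. -/
def subschemeSheafMul (n : ℕ) (g : QuotSections (nbhds I) ⊤ n) :
    subschemeSheaf I ⟶ quotSheaf (nbhds I) n := ⟨{
  app U := AddCommGrpCat.ofHom ((AddMonoidHom.mulRight (quotRes (nbhds I) le_top n g)).comp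
    (quotStructureMap π I n U.unop).toAddMonoidHom)
  naturality U V f := by
    ext (a : SubschemeSections I U.unop)
    have h : quotStructureMap π I n V.unop (subschemeRes I f.unop.le a) *
          quotRes (nbhds I) le_top n g =
        quotRes (nbhds I) f.unop.le n
          (quotStructureMap π I n U.unop a * quotRes (nbhds I) le_top n g) := by
      rw [map_mul, quotRes_quotStructureMap, quotRes_quotRes]
    exact h }⟩

end LiftRing

/-- The kernel of the projection is a single copy of `𝒪_P`, embedded by multiplication with the
power lift `g`; the projection is surjective on affine opens. -/
lemma quotProj_top_surjective {C S : Scheme.{u}} (π : C ⟶ S) {I : C.IdealSheafData}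
    [IsSection π I] {t : QuotSections (nbhds I) ⊤ 2} (hI : IsEffectiveCartier I)
    (hH1 : Subsingleton (Sheaf.H (structureSheafAb S) 1))
    (ht : IsConormalGenerator t) (n : ℕ) :
    Function.Surjective (quotProj (nbhds I) ⊤ n (n + 1) n.le_succ) := by
  obtain ⟨g, hg⟩ := ht.exists_isPowLift n
  refine surjective_app_top_of_isSupportedOn π I hH1 (isSupportedOn_quotSheaf I (n + 1))
    (isSupportedOn_quotSheaf I n) (quotSheafProj (nbhds I) n.le_succ) (r := 1)
    (fun _ ↦ subschemeSheafMul π I (n + 1) g) (fun _ ↦ ?_) (fun U a ha ↦ ?_) (fun U x hx ↦ ?_)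
    (fun U s x hx _ ↦ ?_)
  · refine ObjectProperty.hom_ext _ (NatTrans.ext (funext fun U ↦ ?_))
    ext (a : SubschemeSections I U.unop)
    have h : quotProj (nbhds I) U.unop n (n + 1) n.le_succ
        (quotStructureMap π I (n + 1) U.unop a * quotRes (nbhds I) le_top (n + 1) g) = 0 := by
      rw [map_mul, quotProj_quotRes, hg.quotProj_eq_zero ht, map_zero, mul_zero]
    exact h
  · rw [Fin.sum_univ_one] at ha
    ext i
    rw [Subsingleton.elim i 0]
    exact hg.eq_zero_of_quotStructureMap_mul π hI ht ha
  · obtain ⟨a, ha⟩ := hg.exists_quotStructureMap_mul_eq π hI ht hx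
    exact ⟨fun _ ↦ a, by rw [Fin.sum_univ_one]; exact ha⟩
  · obtain ⟨V, hxV, hV⟩ := exists_affine_le hx
    obtain ⟨b, hb⟩ := toQuot_surjective I V n (quotRes (nbhds I) hV n s)
    exact ⟨V, hV, hxV, toQuot (nbhds I) V.1 (n + 1) b,
      (quotProj_toQuot (nbhds I) V.1 n.le_succ b).trans hb⟩

/-! ### Evaluating power series at nilpotent elements -/

section TruncEval

variable {A B : Type*} [CommRing A] [CommRing B]

lemma eval₂_eq_of_X_pow_dvd_sub (σ : A →+* B) {b : B} {n : ℕ} (hb : b ^ n = 0)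
    {p q : Polynomial A} (h : Polynomial.X ^ n ∣ p - q) : p.eval₂ σ b = q.eval₂ σ b := by
  obtain ⟨r, hr⟩ := h
  rw [← sub_eq_zero, ← Polynomial.eval₂_sub, hr, Polynomial.eval₂_mul, Polynomial.eval₂_X_pow, hb,
    zero_mul]

/-- The value of a power series at an element with vanishing `n`-th power. -/
def truncEval (σ : A →+* B) {b : B} {n : ℕ} (hb : b ^ n = 0) : PowerSeries A →+* B where
  toFun f := (PowerSeries.trunc n f).eval₂ σ b
  map_zero' := by simp
  map_one' := by
    rw [eval₂_eq_of_X_pow_dvd_sub σ hb (q := 1), Polynomial.eval₂_one]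
    rw [Polynomial.X_pow_dvd_iff]
    intro d hd
    rw [Polynomial.coeff_sub, PowerSeries.coeff_trunc, if_pos hd, PowerSeries.coeff_one,
      Polynomial.coeff_one, sub_self]
  map_add' f g := by simp [Polynomial.eval₂_add]
  map_mul' f g := by
    rw [← Polynomial.eval₂_mul]
    refine eval₂_eq_of_X_pow_dvd_sub σ hb ?_
    rw [Polynomial.X_pow_dvd_iff]
    intro d hd
    rw [Polynomial.coeff_sub, PowerSeries.coeff_trunc, if_pos hd,
      PowerSeries.coeff_mul_eq_coeff_trunc_mul_trunc _ _ hd, ← Polynomial.coe_mul,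
      Polynomial.coeff_coe, sub_self]

lemma truncEval_eq_eval₂ (σ : A →+* B) {b : B} {n : ℕ} (hb : b ^ n = 0) {m : ℕ} (h : n ≤ m)
    (f : PowerSeries A) : truncEval σ hb f = (PowerSeries.trunc m f).eval₂ σ b := by
  refine eval₂_eq_of_X_pow_dvd_sub σ hb ?_
  rw [Polynomial.X_pow_dvd_iff]
  intro d hd
  rw [Polynomial.coeff_sub, PowerSeries.coeff_trunc, PowerSeries.coeff_trunc, if_pos hd,
    if_pos (hd.trans_le h), sub_self]

lemma truncEval_C (σ : A →+* B) {b : B} {n : ℕ} (hb : b ^ n = 0) (a : A) :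
    truncEval σ hb (PowerSeries.C a) = σ a := by
  -- The truncation order is raised to `n + 1` so that the constant term survives when `n = 0`.
  rw [truncEval_eq_eval₂ σ hb n.le_succ, PowerSeries.trunc_C, Polynomial.eval₂_C]

lemma truncEval_X (σ : A →+* B) {b : B} {n : ℕ} (hb : b ^ n = 0) :
    truncEval σ hb PowerSeries.X = b := by
  -- Order `n + 2` keeps the linear term also for `n ≤ 1`.
  rw [truncEval_eq_eval₂ σ hb (Nat.le_add_right n 2), PowerSeries.trunc_X,
    Polynomial.eval₂_X]

lemma truncEval_comp {A' B' : Type*} [CommRing A'] [CommRing B'] (σ : A →+* B) (σ' : A' →+* B')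
    (φ : A →+* A') (ψ : B →+* B') (h : ∀ a, ψ (σ a) = σ' (φ a)) {b : B} {b' : B'} {m n : ℕ}
    (hmn : m ≤ n) (hb : b ^ n = 0) (hb' : b' ^ m = 0) (hbb : ψ b = b') (f : PowerSeries A) :
    ψ (truncEval σ hb f) = truncEval σ' hb' (PowerSeries.map φ f) := by
  rw [truncEval_eq_eval₂ σ' hb' hmn, truncEval_eq_eval₂ σ hb le_rfl, Polynomial.hom_eval₂, hbb,
    PowerSeries.trunc_map, Polynomial.eval₂_map]
  congr 1
  ext a
  exact h a

end TruncEval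

/-! ### Compatible families -/

lemma exists_compatible_family {X : ℕ → Type*} (q : ∀ m n : ℕ, m ≤ n → X n → X m)
    (hrfl : ∀ n x, q n n le_rfl x = x)
    (hq : ∀ (l m n : ℕ) (h : l ≤ m) (h' : m ≤ n) (x : X n),
      q l m h (q m n h' x) = q l n (h.trans h') x)
    (m : ℕ) (hsurj : ∀ n, m ≤ n → Function.Surjective (q n (n + 1) n.le_succ)) (x : X m) :
    ∃ s : ∀ n, X n, (∀ (l n : ℕ) (h : l ≤ n), q l n h (s n) = s l) ∧ s m = x := by
  choose c hc using fun k ↦ hsurj (m + k) (Nat.le_add_right m k)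
  -- Successive lifts start at level `m`. The final family projects `s n` from level `m + n` to
  -- level `n`, which also covers the levels below `m`.
  let s : ∀ k, X (m + k) := fun k ↦ Nat.rec x (fun k y ↦ c k y) k
  have hs : ∀ k l (h : k ≤ l), q (m + k) (m + l) (Nat.add_le_add_left h m) (s l) = s k := by
    intro k l h
    induction l, h using Nat.le_induction with
    | base => exact hrfl _ _
    | succ l h ih =>
      rw [← ih, ← hc l (s l), hq]
      rfl
  refine ⟨fun n ↦ q n (m + n) (Nat.le_add_left n m) (s n), fun l n h ↦ ?_, ?_⟩
  · dsimp only
    rw [hq, ← hs l n h, hq]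
  · exact hs 0 m m.zero_le

/-! ### The conormal generator lifted to `𝒪̂_C`. -/

section PowerSeries

variable {C S : Scheme.{u}} {I : C.IdealSheafData} {t : QuotSections (nbhds I) ⊤ 2}

lemma exists_completionRing_eq (π : C ⟶ S) [IsSection π I] (hI : IsEffectiveCartier I)
    (hH1 : Subsingleton (Sheaf.H (structureSheafAb S) 1)) (ht : IsConormalGenerator t) :
    ∃ τ : completionRing (nbhds I) ⊤, τ.1 2 = t := by
  obtain ⟨s, hs, h2⟩ := exists_compatible_family
    (fun m n h ↦ quotProj (nbhds I) ⊤ m n h) (fun n x ↦ quotProj_rfl I ⊤ n x)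
    (fun l m n h h' x ↦ quotProj_nbhds I ⊤ h h' x) 2
    (fun n _ ↦ quotProj_top_surjective π hI hH1 ht n) t
  exact ⟨⟨s, hs⟩, h2⟩

variable (τ : completionRing (nbhds I) ⊤)

lemma exists_toQuot_eq_and_toQuot_two_eq (V : C.affineOpens) (n : ℕ) :
    ∃ t' : Γ(C, V.1), toQuot (nbhds I) V.1 n t' = quotRes (nbhds I) le_top n (τ.1 n) ∧
      toQuot (nbhds I) V.1 2 t' = quotRes (nbhds I) le_top 2 (τ.1 2) := by
  -- Level `n + 2` lies above both `n` and `2`, so a single lift serves for both.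
  obtain ⟨t', ht'⟩ := toQuot_surjective I V (n + 2) (quotRes (nbhds I) le_top _ (τ.1 (n + 2)))
  refine ⟨t', ?_, ?_⟩
  · rw [← quotProj_toQuot (nbhds I) V.1 (Nat.le_add_right n 2), ht', quotProj_quotRes, τ.2]
  · rw [← quotProj_toQuot (nbhds I) V.1 (Nat.le_add_left 2 n), ht', quotProj_quotRes, τ.2]

variable {τ} (hτ : IsConormalGenerator (τ.1 2))
include hτ

/-- Locally `τ` lifts to an element of `I`. This nilpotency lets power series be evaluated at `τ`
modulo `I ^ n`. -/
lemma IsConormalGenerator.pow_eq_zero (n : ℕ) : τ.1 n ^ n = 0 := by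
  refine quot_ext _ _ _ fun x hx ↦ ?_
  obtain ⟨V, hxV, hV⟩ := exists_affine_le hx
  obtain ⟨t', h1, h2⟩ := exists_toQuot_eq_and_toQuot_two_eq τ V n
  refine ⟨V, hV, hxV, ?_⟩
  rw [map_pow, ← h1, map_zero, ← map_pow, toQuot_eq_zero_iff]
  exact Ideal.pow_mem_pow (hτ.mem_of_toQuot_eq h2) n

/-- With this, the description of the graded pieces applies to the powers of `τ` itself. -/
lemma IsConormalGenerator.isPowLift (n : ℕ) : IsPowLift (τ.1 2) n (τ.1 (n + 1) ^ n) := by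
  intro V hV t' ht'
  obtain ⟨t'', h1, h2⟩ := exists_toQuot_eq_and_toQuot_two_eq τ V (n + 1)
  rw [map_pow (quotRes (nbhds I) hV (n + 1)), ← h1, ← map_pow, ← sub_eq_zero, ← map_sub,
    toQuot_eq_zero_iff]
  refine pow_sub_pow_mem (hτ.mem_of_toQuot_eq ht') (hτ.mem_of_toQuot_eq h2) ?_ n
  rw [← toQuot_eq_zero_iff, map_sub, ht', h2, sub_self]

lemma IsConormalGenerator.res_pow_eq_zero (U : C.Opens) (n : ℕ) :
    quotRes (nbhds I) (le_top : U ≤ ⊤) n (τ.1 n) ^ n = 0 := by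
  rw [← map_pow, hτ.pow_eq_zero, map_zero]

end PowerSeries

/-! ### The comparison of `𝒪_P⟦z⟧` with `𝒪̂_C`. -/

section SeriesEval

variable {C S : Scheme.{u}} (π : C ⟶ S) {I : C.IdealSheafData} [IsSection π I]
  {τ : completionRing (nbhds I) ⊤} (hτ : IsConormalGenerator (τ.1 2))

/-- The homomorphism `𝒪_P⟦z⟧ ⟶ 𝒪_C / I ^ n` which maps `z` to `τ`. -/
def seriesEval (U : C.Opens) (n : ℕ) : PowerSeriesSections I U →+* QuotSections (nbhds I) U n :=
  truncEval (quotStructureMap π I n U) (hτ.res_pow_eq_zero U n)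

lemma quotProj_seriesEval (U : C.Opens) {m n : ℕ} (h : m ≤ n) (f : PowerSeriesSections I U) :
    quotProj (nbhds I) U m n h (seriesEval π hτ U n f) = seriesEval π hτ U m f := by
  have := truncEval_comp (quotStructureMap π I n U) (quotStructureMap π I m U) (RingHom.id _)
    (quotProj (nbhds I) U m n h) (quotProj_quotStructureMap π I U h) h (hτ.res_pow_eq_zero U n)
    (hτ.res_pow_eq_zero U m) (by rw [quotProj_quotRes, τ.2]) f
  rwa [PowerSeries.map_id] at this

lemma quotRes_seriesEval {U V : C.Opens} (h : V ≤ U) (n : ℕ) (f : PowerSeriesSections I U) :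
    quotRes (nbhds I) h n (seriesEval π hτ U n f) =
      seriesEval π hτ V n (powerSeriesRes I h f) :=
  truncEval_comp (quotStructureMap π I n U) (quotStructureMap π I n V) (subschemeRes I h)
    (quotRes (nbhds I) h n) (quotRes_quotStructureMap π I h n) le_rfl (hτ.res_pow_eq_zero U n)
    (hτ.res_pow_eq_zero V n) (by rw [quotRes_quotRes]) f

lemma seriesEval_C (U : C.Opens) (n : ℕ) (a : SubschemeSections I U) :
    seriesEval π hτ U n (PowerSeries.C a) = quotStructureMap π I n U a :=
  truncEval_C _ _ _

lemma seriesEval_X (U : C.Opens) (n : ℕ) :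
    seriesEval π hτ U n PowerSeries.X = quotRes (nbhds I) le_top n (τ.1 n) :=
  truncEval_X _ _

lemma subsingleton_quotSections_zero (U : C.Opens) : Subsingleton (QuotSections (nbhds I) U 0) := by
  refine subsingleton_of_forall_eq 0 fun x ↦ quot_ext _ _ _ fun y hy ↦ ?_
  obtain ⟨V, hyV, hV⟩ := exists_affine_le hy
  obtain ⟨b, hb⟩ := toQuot_surjective I V 0 (quotRes (nbhds I) hV 0 x)
  refine ⟨V, hV, hyV, ?_⟩
  rw [← hb, map_zero, toQuot_eq_zero_iff, pow_zero, Ideal.one_eq_top]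
  trivial

lemma seriesEval_eq_zero_of_dvd {U : C.Opens} {n : ℕ} {f : PowerSeriesSections I U}
    (h : PowerSeries.X ^ n ∣ f) : seriesEval π hτ U n f = 0 := by
  obtain ⟨f', rfl⟩ := h
  rw [map_mul, map_pow, seriesEval_X, hτ.res_pow_eq_zero, zero_mul]

/-- Inductively `f = X ^ n * f'`. Modulo `I ^ (n + 1)` only the constant term `a` of `f'`
contributes, so `a * τ ^ n = 0`, and `a = 0` because `τ ^ n` freely generates the graded piece. -/
lemma X_pow_dvd_of_seriesEval_eq_zero (hI : IsEffectiveCartier I) {U : C.Opens} {n : ℕ}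
    {f : PowerSeriesSections I U} (h : seriesEval π hτ U n f = 0) : PowerSeries.X ^ n ∣ f := by
  induction n with
  | zero => simp
  | succ n ih =>
    obtain ⟨f', rfl⟩ := ih (by rw [← quotProj_seriesEval π hτ U n.le_succ, h, map_zero])
    obtain ⟨f'', hf''⟩ := PowerSeries.X_dvd_iff.mpr
      (show PowerSeries.constantCoeff (f' - PowerSeries.C (PowerSeries.constantCoeff f')) = 0 by
        simp)
    rw [sub_eq_iff_eq_add] at hf''
    generalize PowerSeries.constantCoeff f' = a at hf''
    have h1 : quotStructureMap π I (n + 1) U a *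
        quotRes (nbhds I) le_top (n + 1) (τ.1 (n + 1) ^ n) = 0 := by
      rw [hf'', mul_add, ← mul_assoc, ← pow_succ, map_add,
        seriesEval_eq_zero_of_dvd π hτ (dvd_mul_right _ _), zero_add, map_mul, map_pow,
        seriesEval_X, seriesEval_C, mul_comm] at h
      rw [map_pow, h]
    have h2 := (hτ.isPowLift n).eq_zero_of_quotStructureMap_mul π hI hτ h1
    rw [hf'', h2, map_zero, add_zero, ← mul_assoc, ← pow_succ]
    exact dvd_mul_right _ _

/-- A series matching `x` at level `n` misses it at level `n + 1` by an element of the kernel, which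
is `a * τ ^ n`; adding `a * X ^ n` corrects it. No cohomology is needed, so this holds over every
open. -/
lemma seriesEval_surjective (hI : IsEffectiveCartier I) (U : C.Opens) (n : ℕ) :
    Function.Surjective (seriesEval π hτ U n) := by
  induction n with
  | zero => exact fun x ↦ ⟨0, (subsingleton_quotSections_zero U).elim _ _⟩
  | succ n ih =>
    intro x
    obtain ⟨f, hf⟩ := ih (quotProj (nbhds I) U n (n + 1) n.le_succ x)
    obtain ⟨a, ha⟩ := (hτ.isPowLift n).exists_quotStructureMap_mul_eq π hI hτ
      (x := x - seriesEval π hτ U (n + 1) f) (by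
        rw [map_sub, quotProj_seriesEval, hf, sub_self])
    refine ⟨f + PowerSeries.C a * PowerSeries.X ^ n, ?_⟩
    rw [map_add, map_mul, map_pow, seriesEval_C, seriesEval_X, ← map_pow, ha,
      add_sub_cancel]

/-- The homomorphism `𝒪_P⟦z⟧ ⟶ 𝒪̂_C` which maps `z` to `τ`. -/
def completionEval (U : C.Opens) : PowerSeriesSections I U →+* completionRing (nbhds I) U :=
  (RingHom.pi fun n ↦ seriesEval π hτ U n).codRestrict (completionRing (nbhds I) U)
    fun f _ _ h ↦ quotProj_seriesEval π hτ U h f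

lemma completionEval_bijective (hI : IsEffectiveCartier I) (U : C.Opens) :
    Function.Bijective (completionEval π hτ U) := by
  refine ⟨(injective_iff_map_eq_zero _).mpr fun f hf ↦ ?_, fun s ↦ ?_⟩
  · ext k
    have h : seriesEval π hτ U (k + 1) f = 0 := congr($hf.1 (k + 1))
    exact PowerSeries.X_pow_dvd_iff.mp (X_pow_dvd_of_seriesEval_eq_zero π hτ hI h) k k.lt_succ_self
  · choose f hf using fun n ↦ seriesEval_surjective π hτ hI U n (s.1 n)
    -- The coefficient of `X ^ k` is read off at level `k + 1`, the first that determines it; at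
    -- higher levels the chosen series have the same coefficient, by the description of the kernel.
    refine ⟨PowerSeries.mk fun k ↦ PowerSeries.coeff k (f (k + 1)), Subtype.ext (funext fun n ↦ ?_)⟩
    refine Eq.trans ?_ (hf n)
    change seriesEval π hτ U n _ = _
    rw [← sub_eq_zero, ← map_sub]
    refine seriesEval_eq_zero_of_dvd π hτ (PowerSeries.X_pow_dvd_iff.mpr fun k hk ↦ ?_)
    rw [map_sub, PowerSeries.coeff_mk, ← map_sub]
    have h : seriesEval π hτ U (k + 1) (f (k + 1) - f n) = 0 := by
      rw [map_sub, hf, ← quotProj_seriesEval π hτ U hk, hf, s.2, sub_self]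
    exact PowerSeries.X_pow_dvd_iff.mp (X_pow_dvd_of_seriesEval_eq_zero π hτ hI h) k k.lt_succ_self

include hτ in
lemma isCompletionPowerSeries_of_generator (hI : IsEffectiveCartier I) :
    IsCompletionPowerSeries π I := by
  let e (U : C.Opens) := RingEquiv.ofBijective _ (completionEval_bijective π hτ hI U)
  refine ⟨fun U ↦ (e U).symm, fun U V h s ↦ ?_, fun U a ↦ ?_, fun U n s ↦ ?_⟩
  · obtain ⟨f, rfl⟩ := (e U).surjective s
    rw [RingEquiv.symm_apply_apply, RingEquiv.symm_apply_eq]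
    exact Subtype.ext (funext fun n ↦ quotRes_seriesEval π hτ h n f)
  · rw [RingEquiv.symm_apply_eq]
    exact Subtype.ext (funext fun n ↦ (seriesEval_C π hτ U n a).symm)
  · obtain ⟨f, rfl⟩ := (e U).surjective s
    rw [RingEquiv.symm_apply_apply]
    exact ⟨X_pow_dvd_of_seriesEval_eq_zero π hτ hI, seriesEval_eq_zero_of_dvd π hτ⟩

end SeriesEval

/-! ### Bases of sheaves of modules -/

section Pullback

variable {X Y Z : Scheme.{u}}

lemma secRes_rfl (G : X.Modules) {U : X.Opens} (h : U ≤ U) (x : Sec G U) : secRes G h x = x :=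
  congr($(G.presheaf.map_id (.op U)).hom x)

lemma secMap_comp {G H K : X.Modules} (φ : G ⟶ H) (ψ : H ⟶ K) (U : X.Opens) (x : Sec G U) :
    secMap (φ ≫ ψ) U x = secMap ψ U (secMap φ U x) := rfl

lemma secMap_id (G : X.Modules) (U : X.Opens) (x : Sec G U) : secMap (𝟙 G) U x = x := rfl

lemma secMap_secPullback (g : X ⟶ Y) {G H : Y.Modules} (φ : G ⟶ H) (V : Y.Opens) (x : Sec G V) :
    secMap ((Scheme.Modules.pullback g).map φ) (g ⁻¹ᵁ V) (secPullback g G V x) =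
      secPullback g H V (secMap φ V x) := by
  have := (Scheme.Modules.pullbackPushforwardAdjunction g).unit.naturality φ
  exact congr(($(this).app V).hom x).symm

/-- The inverse of `pullbackComp` is conjugate to the comparison of the push-forwards, so it carries
the unit of the composite morphism to the composite of the two units. -/
lemma secMap_pullbackComp (g : X ⟶ Y) (f : Y ⟶ Z) (F : Z.Modules) (U : Z.Opens) (x : Sec F U) :
    secMap ((Scheme.Modules.pullbackComp g f).hom.app F) ((g ≫ f) ⁻¹ᵁ U)
      (secPullback g _ (f ⁻¹ᵁ U) (secPullback f F U x)) = secPullback (g ≫ f) F U x := by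
  have h := Scheme.Modules.conjugateEquiv_pullbackComp_inv g f
  have h2 := unit_conjugateEquiv ((Scheme.Modules.pullbackPushforwardAdjunction f).comp
    (Scheme.Modules.pullbackPushforwardAdjunction g))
    (Scheme.Modules.pullbackPushforwardAdjunction (g ≫ f))
    (Scheme.Modules.pullbackComp g f).inv F
  rw [h] at h2
  have h3 : secPullback g _ (f ⁻¹ᵁ U) (secPullback f F U x) =
      secMap ((Scheme.Modules.pullbackComp g f).inv.app F) ((g ≫ f) ⁻¹ᵁ U)
        (secPullback (g ≫ f) F U x) := congr(($(h2).app U).hom x)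
  rw [h3, ← secMap_comp, Iso.inv_hom_id_app]
  rfl

/-- A section of `F` on `C` thus gives a compatible family in the `F / I ^ n F`; local bases of the
tower arise in this way. -/
lemma pullbackRes_secPullback (g : X ⟶ Y) (f : Y ⟶ Z) (h : X ⟶ Z) (w : g ≫ f = h) (F : Z.Modules)
    (U : Z.Opens) (x : Sec F U) :
    pullbackRes g f h w F U (secPullback f F U x) = secPullback h F U x := by
  subst w
  simp only [pullbackRes, AddMonoidHom.comp_apply, pullbackFactor, secMap_comp]
  exact (secRes_rfl _ _ _).trans (secMap_pullbackComp g f F U x)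

instance isIso_pullbackFactor (g : X ⟶ Y) (f : Y ⟶ Z) (h : X ⟶ Z) (w : g ≫ f = h)
    (F : Z.Modules) : IsIso (pullbackFactor g f h w F) := by
  unfold pullbackFactor
  infer_instance

/-- The pull-back of a section over `U` along a morphism with image in `U`. -/
def secPull (g : X ⟶ Y) (G : Y.Modules) {U : Y.Opens} (h : ⊤ ≤ g ⁻¹ᵁ U) :
    Sec G U →+ Sec ((Scheme.Modules.pullback g).obj G) ⊤ :=
  (secRes _ h).comp (secPullback g G U)

lemma secMap_secPull_secPull (g : X ⟶ Y) (f : Y ⟶ Z) (k : X ⟶ Z) (w : g ≫ f = k) (F : Z.Modules)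
    {U : Z.Opens} {V : Y.Opens} (hV : V ≤ f ⁻¹ᵁ U) (hg : ⊤ ≤ g ⁻¹ᵁ V) (hk : ⊤ ≤ k ⁻¹ᵁ U)
    (x : Sec F U) :
    secMap (pullbackFactor g f k w F) ⊤
      (secPull g _ hg (secRes _ hV (secPullback f F U x))) = secPull k F hk x := by
  have h := congr(secRes _ hk $(pullbackRes_secPullback g f k w F U x))
  simp only [pullbackRes, AddMonoidHom.comp_apply, secRes_secRes] at h
  simp only [secPull, AddMonoidHom.comp_apply, secPullback_secRes, secRes_secRes]
  rw [← h, secMap_secRes]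

end Pullback

/-! ### Bases formed by global sections. -/

section Basis

variable {X Y Z : Scheme.{u}}

/-- The structure sheaf as a module over itself. -/
def unitModule (X : Scheme.{u}) : X.Modules := SheafOfModules.unit X.ringCatSheaf

/-- A section of the structure sheaf as a section of the module `𝒪_X`. -/
def unitSec {U : X.Opens} (a : Γ(X, U)) : Sec (unitModule X) U := a

lemma smul_unitSec {U : X.Opens} (a b : Γ(X, U)) : a • unitSec b = unitSec (a * b) := rfl

lemma secRes_unitSec {U V : X.Opens} (h : V ≤ U) (a : Γ(X, U)) :
    secRes (unitModule X) h (unitSec a) = unitSec ((X.presheaf.map (homOfLE h).op).hom a) := rfl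

lemma secMap_unit {M : X.Modules} (φ : unitModule X ⟶ M) {U : X.Opens} (a : Γ(X, U)) :
    secMap φ U (unitSec a) = a • secRes M le_top (secMap φ ⊤ (unitSec 1)) := by
  rw [← secMap_secRes, secRes_unitSec, map_one, ← secMap_smul, smul_unitSec, mul_one]

/-- `M` is the direct sum of copies of `𝒪_X` generated by the global sections `s`. -/
def IsFreeBasis {M : X.Modules} {r : ℕ} (s : Fin r → Sec M ⊤) : Prop :=
  ∃ (φ : Fin r → (unitModule X ⟶ M)) (ψ : Fin r → (M ⟶ unitModule X)),
    (∀ i, secMap (φ i) ⊤ (unitSec 1) = s i) ∧ (∀ i, φ i ≫ ψ i = 𝟙 _) ∧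
    (∀ i j, i ≠ j → φ i ≫ ψ j = 0) ∧ ∑ i, ψ i ≫ φ i = 𝟙 M

lemma secMap_sum {M N : X.Modules} {ι : Type*} (t : Finset ι) (f : ι → (M ⟶ N)) (U : X.Opens)
    (x : Sec M U) : secMap (∑ i ∈ t, f i) U x = ∑ i ∈ t, secMap (f i) U x := by
  let ev : (M ⟶ N) →+ Sec N U := AddMonoidHom.mk' (fun f ↦ secMap f U x) fun _ _ ↦ rfl
  exact map_sum ev f t

lemma IsFreeBasis.bijective {M : X.Modules} {r : ℕ} {s : Fin r → Sec M ⊤} (hs : IsFreeBasis s)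
    (V : X.Opens) : Function.Bijective
      (fun a : Fin r → Γ(X, V) ↦ ∑ i, a i • (secRes M (le_top : V ≤ ⊤) (s i) : Sec M V)) := by
  obtain ⟨φ, ψ, h1, h2, h3, h4⟩ := hs
  have e : ∀ a : Fin r → Γ(X, V), ∑ i, a i • (secRes M (le_top : V ≤ ⊤) (s i) : Sec M V) =
      ∑ i, secMap (φ i) V (unitSec (a i)) := fun a ↦ by
    refine Finset.sum_congr rfl fun i _ ↦ ?_
    rw [secMap_unit, h1]
  have e2 : ∀ (a : Fin r → Γ(X, V)) j,
      secMap (ψ j) V (∑ i, secMap (φ i) V (unitSec (a i))) = unitSec (a j) := fun a j ↦ by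
    rw [map_sum, Finset.sum_eq_single j]
    · rw [← secMap_comp, h2, secMap_id]
    · intro i _ hij
      rw [← secMap_comp, h3 i j hij]
      rfl
    · simp
  refine ⟨fun a b hab ↦ ?_, fun x ↦ ⟨fun i ↦ secMap (ψ i) V x, ?_⟩⟩
  · simp only [e] at hab
    ext j
    have := congr(secMap (ψ j) V $hab)
    rwa [e2, e2] at this
  · refine (e _).trans ?_
    have := congr(secMap $h4 V x)
    rw [secMap_sum, secMap_id] at this
    exact this

lemma IsFreeBasis.map {M N : X.Modules} {r : ℕ} {s : Fin r → Sec M ⊤} (hs : IsFreeBasis s)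
    (e : M ⟶ N) [IsIso e] : IsFreeBasis (fun i ↦ secMap e ⊤ (s i)) := by
  obtain ⟨φ, ψ, h1, h2, h3, h4⟩ := hs
  refine ⟨fun i ↦ φ i ≫ e, fun i ↦ inv e ≫ ψ i, fun i ↦ ?_, fun i ↦ ?_, fun i j hij ↦ ?_, ?_⟩
  · rw [secMap_comp, h1]
  · simp [h2]
  · simp [h3 i j hij]
  · simp only [Category.assoc, ← Preadditive.comp_sum]
    simp only [← Category.assoc (ψ _), ← Preadditive.sum_comp, h4]
    simp

end Basis

/-! ### Pull-back of bases. -/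

section BasisPullback

variable {X Y Z : Scheme.{u}}

/-- Every structured arrow maps to the one with target `⊤`. This finality makes the canonical map
`g^* 𝒪_Y ⟶ 𝒪_X` an isomorphism. -/
instance final_opensMap (g : X ⟶ Y) : (Opens.map g.base).Final where
  out d := by
    let t : StructuredArrow d (Opens.map g.base) := StructuredArrow.mk (Y := ⊤) (homOfLE le_top)
    let f (j : StructuredArrow d (Opens.map g.base)) : j ⟶ t :=
      StructuredArrow.homMk (homOfLE le_top) (Subsingleton.elim _ _)
    have : Nonempty (StructuredArrow d (Opens.map g.base)) := ⟨t⟩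
    exact zigzag_isConnected fun j₁ j₂ ↦
      (Zigzag.of_hom (f j₁)).trans (Zigzag.of_inv (f j₂))

instance isRightAdjoint_pushforward (g : X ⟶ Y) :
    (SheafOfModules.pushforward.{u} g.toRingCatSheafHom).IsRightAdjoint :=
  ⟨_, ⟨Scheme.Modules.pullbackPushforwardAdjunction g⟩⟩

/-- The canonical map `g^* 𝒪_Y ⟶ 𝒪_X`. -/
def pullbackUnit (g : X ⟶ Y) : (Scheme.Modules.pullback g).obj (unitModule Y) ⟶ unitModule X :=
  SheafOfModules.pullbackObjUnitToUnit g.toRingCatSheafHom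

instance isIso_pullbackUnit (g : X ⟶ Y) : IsIso (pullbackUnit g) := by
  have := final_opensMap g
  exact SheafOfModules.instIsIsoPullbackObjUnitToUnitOfFinal g.toRingCatSheafHom

lemma secMap_pullbackUnit (g : X ⟶ Y) (V : Y.Opens) (a : Γ(Y, V)) :
    secMap (pullbackUnit g) (g ⁻¹ᵁ V) (secPullback g (unitModule Y) V (unitSec a)) =
      unitSec ((g.app V).hom a) := by
  have h := SheafOfModules.pullbackPushforwardAdjunction_homEquiv_pullbackObjUnitToUnit
    g.toRingCatSheafHom
  rw [Adjunction.homEquiv_unit] at h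
  exact congr(($(h).val.app (.op V)).hom a)

/-- A basis is given by morphisms subject to additive identities. An additive functor preserves
these, and `pullbackUnit` replaces `g^* 𝒪_Y` by `𝒪_X`. -/
lemma IsFreeBasis.pullback {M : Y.Modules} {r : ℕ} {s : Fin r → Sec M ⊤} (hs : IsFreeBasis s)
    (g : X ⟶ Y) : IsFreeBasis (fun i ↦ secPull g M (U := ⊤) le_rfl (s i)) := by
  obtain ⟨φ, ψ, h1, h2, h3, h4⟩ := hs
  refine ⟨fun i ↦ inv (pullbackUnit g) ≫ (Scheme.Modules.pullback g).map (φ i),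
    fun i ↦ (Scheme.Modules.pullback g).map (ψ i) ≫ pullbackUnit g, fun i ↦ ?_, fun i ↦ ?_,
    fun i j hij ↦ ?_, ?_⟩
  · have h5 := secMap_pullbackUnit g ⊤ 1
    rw [map_one] at h5
    have h6 : secMap (inv (pullbackUnit g)) (g ⁻¹ᵁ ⊤) (unitSec 1) =
        secPullback g (unitModule Y) ⊤ (unitSec 1) := by
      rw [← h5, ← secMap_comp, IsIso.hom_inv_id, secMap_id]
    have h7 : secMap (inv (pullbackUnit g) ≫ (Scheme.Modules.pullback g).map (φ i)) (g ⁻¹ᵁ ⊤)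
        (unitSec 1) = secPullback g M ⊤ (s i) := by
      rw [secMap_comp, h6, secMap_secPullback, h1]
    exact h7.trans (secRes_rfl _ _ _).symm
  · simp [← Functor.map_comp_assoc, h2]
  · simp [← Functor.map_comp_assoc, h3 i j hij]
  · simp [← Functor.map_comp, ← Functor.map_sum, h4]

end BasisPullback

/-! ### Free modules and their ranks. -/

section Free

variable (X : Scheme.{u})

/-- The free module on a type `J`. -/
def freeModule (J : Type u) : X.Modules := SheafOfModules.free (R := X.ringCatSheaf) J

variable {X} {J : Type u}

/-- The inclusion of a summand of a free module. -/
def freeι (j : J) : unitModule X ⟶ freeModule X J := SheafOfModules.ιFree j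

lemma freeModule_hom_ext {M : X.Modules} {f g : freeModule X J ⟶ M}
    (h : ∀ j, freeι j ≫ f = freeι j ≫ g) : f = g :=
  Limits.Cofan.IsColimit.hom_ext (SheafOfModules.isColimitFreeCofan (R := X.ringCatSheaf) J) f g h

/-- The morphism from a free module given by a family of sections. -/
def freeDesc {M : X.Modules} (f : J → (unitModule X ⟶ M)) : freeModule X J ⟶ M :=
  Limits.Cofan.IsColimit.desc (SheafOfModules.isColimitFreeCofan (R := X.ringCatSheaf) J) f

lemma freeι_freeDesc {M : X.Modules} (f : J → (unitModule X ⟶ M)) (j : J) :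
    freeι j ≫ freeDesc f = f j :=
  Limits.Cofan.IsColimit.fac (SheafOfModules.isColimitFreeCofan (R := X.ringCatSheaf) J) f j

open Classical in
/-- The projection to a summand of a free module. -/
def freeπ (j : J) : freeModule X J ⟶ unitModule X :=
  freeDesc (fun i ↦ if i = j then 𝟙 (unitModule X) else 0)

open Classical in
lemma freeι_freeπ (i j : J) :
    freeι i ≫ freeπ j = if i = j then 𝟙 (unitModule X) else 0 :=
  freeι_freeDesc _ i

lemma sum_freeπ_freeι [Fintype J] : ∑ j : J, freeπ j ≫ freeι j = 𝟙 (freeModule X J) := by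
  classical
  refine freeModule_hom_ext fun i ↦ ?_
  rw [Preadditive.comp_sum, Finset.sum_eq_single i]
  · rw [← Category.assoc, freeι_freeπ, if_pos rfl, Category.id_comp, Category.comp_id]
  · intro j _ hj
    rw [← Category.assoc, freeι_freeπ, if_neg hj.symm, Limits.zero_comp]
  · simp

lemma isFreeBasis_freeModule {r : ℕ} (σ : Fin r ≃ J) :
    IsFreeBasis (fun i ↦ secMap (freeι (X := X) (σ i)) ⊤ (unitSec 1)) := by
  classical
  have : Fintype J := Fintype.ofEquiv _ σ
  refine ⟨fun i ↦ freeι (σ i), fun i ↦ freeπ (σ i), fun i ↦ rfl, fun i ↦ ?_, fun i j hij ↦ ?_, ?_⟩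
  · rw [freeι_freeπ, if_pos rfl]
  · rw [freeι_freeπ, if_neg (σ.injective.ne hij)]
  · exact (Equiv.sum_comp σ (fun j ↦ freeπ j ≫ freeι j)).trans sum_freeπ_freeι

/-- The underlying global section of an endomorphism of `𝒪_X`. -/
def endSec (f : unitModule X ⟶ unitModule X) : Γ(X, ⊤) := secMap f ⊤ (unitSec 1)

lemma endSec_comp (f g : unitModule X ⟶ unitModule X) :
    endSec (f ≫ g) = endSec f * endSec g := by
  have h := secMap_unit g (U := ⊤) (endSec f)
  rw [secRes_rfl] at h
  exact h

lemma endSec_sum {ι : Type*} (t : Finset ι) (f : ι → (unitModule X ⟶ unitModule X)) :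
    endSec (∑ i ∈ t, f i) = ∑ i ∈ t, endSec (f i) := secMap_sum t f ⊤ _

/-- If a free module on `J` is a retract of the free module on a finite type `K`, then `J` has at
most as many elements as `K`. -/
lemma card_le_of_retract [Nontrivial Γ(X, ⊤)] {K : Type u} [Fintype K] [Fintype J]
    (f : freeModule X J ⟶ freeModule X K) (g : freeModule X K ⟶ freeModule X J)
    (h : f ≫ g = 𝟙 _) : Fintype.card J ≤ Fintype.card K := by
  classical
  -- The matrices of `f` and `g`: `endSec` turns composition into multiplication, so `A * B = 1`.
  -- Then `A` is a surjection from functions on `K` to functions on `J`, and over a nontrivial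
  -- commutative ring this bounds the cardinality.
  let A : Matrix J K Γ(X, ⊤) := fun j k ↦ endSec (freeι j ≫ f ≫ freeπ k)
  let B : Matrix K J Γ(X, ⊤) := fun k j ↦ endSec (freeι k ≫ g ≫ freeπ j)
  have hAB : A * B = 1 := by
    ext i j
    have h1 : ∑ k : K, (freeι i ≫ f ≫ freeπ k) ≫ (freeι k ≫ g ≫ freeπ j) =
        if i = j then 𝟙 (unitModule X) else 0 := by
      have : ∑ k : K, (freeι i ≫ f ≫ freeπ k) ≫ (freeι k ≫ g ≫ freeπ j) =
          (freeι i ≫ f) ≫ (∑ k : K, freeπ k ≫ freeι k) ≫ (g ≫ freeπ j) := by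
        simp only [Preadditive.sum_comp, Preadditive.comp_sum, Category.assoc]
      rw [this, sum_freeπ_freeι, Category.id_comp, Category.assoc, ← Category.assoc f, h,
        Category.id_comp, freeι_freeπ]
    have h2 := congr(endSec $h1)
    rw [endSec_sum] at h2
    simp only [endSec_comp _ (freeι _ ≫ g ≫ freeπ j)] at h2
    rw [Matrix.mul_apply, Matrix.one_apply]
    refine h2.trans ?_
    split_ifs <;> rfl
  have hsurj : Function.Surjective A.mulVecLin := fun v ↦ ⟨B.mulVec v, by
    simp [Matrix.mulVec_mulVec, hAB]⟩
  exact card_le_of_surjective Γ(X, ⊤) A.mulVecLin hsurj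

/-- Nothing says beforehand that `J` is finite. Each finite subset `t` of `J` gives a retract of the
free module on `J`, hence of one of rank `r`, which bounds `t.card`; once `J` is finite, both
inequalities follow from the isomorphism. -/
lemma nonempty_equiv_of_iso [Nontrivial Γ(X, ⊤)] {r : ℕ}
    (e : freeModule X J ≅ freeModule X (ULift.{u} (Fin r))) : Nonempty (Fin r ≃ J) := by
  classical
  have hfin : ∀ t : Finset J, t.card ≤ r := by
    intro t
    let a : freeModule X t ⟶ freeModule X J := freeDesc (fun i ↦ freeι i.1)
    let b : freeModule X J ⟶ freeModule X t :=
      freeDesc (fun i ↦ if h : i ∈ t then freeι (⟨i, h⟩ : t) else 0)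
    have ha : ∀ i : t, freeι i ≫ a = freeι i.1 := fun i ↦ freeι_freeDesc _ i
    have hb : ∀ i : t, freeι i.1 ≫ b = freeι i := fun i ↦
      (freeι_freeDesc _ i.1).trans (dif_pos i.2)
    have hab : a ≫ b = 𝟙 _ := freeModule_hom_ext fun i ↦ by
      rw [← Category.assoc, ha, hb, Category.comp_id]
    have := card_le_of_retract (a ≫ e.hom) (e.inv ≫ b) (by simp [hab])
    simpa using this
  have : Finite J := by
    by_contra hJ
    rw [not_finite_iff_infinite] at hJ
    obtain ⟨t, ht⟩ := Infinite.exists_subset_card_eq J (r + 1)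
    have := hfin t
    omega
  have := Fintype.ofFinite J
  have h1 := card_le_of_retract e.hom e.inv e.hom_inv_id
  have h2 := card_le_of_retract e.inv e.hom e.inv_hom_id
  exact ⟨Fintype.equivOfCardEq (by simp at h1 h2 ⊢; omega)⟩

/-- The pull-back of a free module is free. -/
def pullbackFreeIso {X Y : Scheme.{u}} (g : X ⟶ Y) (J : Type u) :
    (Scheme.Modules.pullback g).obj (freeModule Y J) ≅ freeModule X J :=
  let G : SheafOfModules.{u} Y.ringCatSheaf ⥤ SheafOfModules.{u} X.ringCatSheaf :=
    Scheme.Modules.pullback g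
  have : Limits.PreservesColimitsOfShape (Discrete J) G :=
    (Scheme.Modules.pullbackPushforwardAdjunction g).leftAdjoint_preservesColimits.1
  (SheafOfModules.mapFreeIso G J (asIso (pullbackUnit g)).symm).symm

end Free

/-! ### Bases of locally free modules. -/

section LocallyFree

lemma secRes_bijective_of_eq {X : Scheme.{u}} (M : X.Modules) {U V : X.Opens} (h : V = U) :
    Function.Bijective (secRes M h.le) := by
  subst h
  exact (funext fun x ↦ secRes_rfl M _ x : ⇑(secRes M le_rfl) = id) ▸ Function.bijective_id

lemma secMap_bijective {X : Scheme.{u}} {M N : X.Modules} (f : M ⟶ N) [IsIso f] (U : X.Opens) :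
    Function.Bijective (secMap f U) := by
  refine Function.bijective_iff_has_inverse.mpr ⟨secMap (inv f) U, fun x ↦ ?_, fun x ↦ ?_⟩
  · rw [← secMap_comp, IsIso.hom_inv_id, secMap_id]
  · rw [← secMap_comp, IsIso.inv_hom_id, secMap_id]

/-- Restriction and pull-back along an open immersion are both left adjoint to push-forward.
Uniqueness of left adjoints matches their units, and the unit for restriction is plain restriction
of sections. -/
lemma secPullback_bijective {X Y : Scheme.{u}} (f : X ⟶ Y) [IsOpenImmersion f] (M : Y.Modules)
    {V : Y.Opens} (hV : V ≤ f.opensRange) : Function.Bijective (secPullback f M V) := by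
  have h := Adjunction.unit_leftAdjointUniq_hom_app (Scheme.Modules.restrictAdjunction f)
    (Scheme.Modules.pullbackPushforwardAdjunction f) M
  have himg : f ''ᵁ f ⁻¹ᵁ V = V := by
    rw [Scheme.Hom.image_preimage_eq_opensRange_inf, inf_eq_right]
    exact hV
  have h2 : ⇑(secPullback f M V) =
      ⇑(secMap ((Scheme.Modules.restrictFunctorIsoPullback f).hom.app M) (f ⁻¹ᵁ V)) ∘
        ⇑(secRes M himg.le) := by
    funext x
    exact congr(($(h).app V).hom x).symm
  rw [h2]
  exact (secMap_bijective _ _).comp (secRes_bijective_of_eq M himg)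

lemma secPull_ι_bijective {X : Scheme.{u}} (M : X.Modules) (U : X.Opens) :
    Function.Bijective (secPull U.ι M (U := U) (by simp)) := by
  refine Function.Bijective.comp (g := secRes _ (by simp))
    (secRes_bijective_of_eq _ (by simp)) (secPullback_bijective U.ι M (by simp))

variable {X Y : Scheme.{u}}

/-- The sections `s` over `U` form a basis of the restriction of `M` to `U`. -/
def IsFreeBasisOn (M : X.Modules) (U : X.Opens) {r : ℕ} (s : Fin r → Sec M U) : Prop :=
  IsFreeBasis (fun i ↦ secPull U.ι M (U := U) (by simp) (s i))

lemma IsFreeBasisOn.bijective {M : X.Modules} {U : X.Opens} {r : ℕ} {s : Fin r → Sec M U}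
    (hs : IsFreeBasisOn M U s) {V : X.Opens} (hV : V ≤ U) : Function.Bijective
      (fun a : Fin r → Γ(X, V) ↦ ∑ i, a i • (secRes M hV (s i) : Sec M V)) := by
  have h1 := IsFreeBasis.bijective hs (U.ι ⁻¹ᵁ V)
  have h2 := secPullback_bijective U.ι M (V := V) (by simpa using hV)
  have h3 : Function.Bijective (fun a : Fin r → Γ(X, V) ↦ fun i ↦ (U.ι.app V).hom (a i)) := by
    have : IsIso (U.ι.app V) := U.ι.isIso_app V (by simpa using hV)
    have hb : Function.Bijective (U.ι.app V).hom := ConcreteCategory.bijective_of_isIso (U.ι.app V)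
    exact ⟨hb.1.comp_left, hb.2.comp_left⟩
  have h4 : ⇑(secPullback U.ι M V) ∘
      (fun a : Fin r → Γ(X, V) ↦ ∑ i, a i • (secRes M hV (s i) : Sec M V)) =
      (fun a ↦ ∑ i, a i • (secRes _ le_top (secPull U.ι M (U := U) (by simp) (s i)) :
        Sec ((Scheme.Modules.pullback U.ι).obj M) (U.ι ⁻¹ᵁ V))) ∘
      (fun a : Fin r → Γ(X, V) ↦ fun i ↦ (U.ι.app V).hom (a i)) := by
    funext a
    simp only [Function.comp_apply, map_sum]
    refine Finset.sum_congr rfl fun i _ ↦ ?_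
    rw [secPullback_smul, secPullback_secRes, secPull, AddMonoidHom.comp_apply, secRes_secRes]
  exact (Function.Bijective.of_comp_iff' h2 _).mp (h4 ▸ h1.comp h3)

lemma IsFreeBasis.of_secMap_eq {M N : X.Modules} {r : ℕ} {s : Fin r → Sec M ⊤}
    (hs : IsFreeBasis s) (e : N ⟶ M) [IsIso e] {t : Fin r → Sec N ⊤}
    (h : ∀ i, secMap e ⊤ (t i) = s i) : IsFreeBasis t := by
  obtain rfl : s = fun i ↦ secMap e ⊤ (t i) := funext fun i ↦ (h i).symm
  have h' := hs.map (inv e)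
  simpa only [← secMap_comp, IsIso.hom_inv_id, secMap_id] using h'

lemma secPull_apply (g : X ⟶ Y) (G : Y.Modules) {U : Y.Opens} (h : ⊤ ≤ g ⁻¹ᵁ U) (x : Sec G U) :
    secPull g G h x = secRes _ h (secPullback g G U x) := rfl

lemma IsFreeBasis.exists_map {M N : X.Modules} {r : ℕ} {s : Fin r → Sec M ⊤} (hs : IsFreeBasis s)
    (e : M ⟶ N) [IsIso e] :
    ∃ t : Fin r → Sec N ⊤, IsFreeBasis t ∧ ∀ i, t i = secMap e ⊤ (s i) :=
  ⟨_, hs.map e, fun _ ↦ rfl⟩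

lemma IsFreeBasis.exists_pullback {M : Y.Modules} {r : ℕ} {s : Fin r → Sec M ⊤}
    (hs : IsFreeBasis s) (g : X ⟶ Y) :
    ∃ t : Fin r → Sec ((Scheme.Modules.pullback g).obj M) ⊤,
      IsFreeBasis t ∧ ∀ i, t i = secPull g M (U := ⊤) le_rfl (s i) :=
  ⟨_, hs.pullback g, fun _ ↦ rfl⟩

lemma isFreeBasisOn_iff {M : X.Modules} {U : X.Opens} {r : ℕ} {s : Fin r → Sec M U} :
    IsFreeBasisOn M U s ↔ ∃ t, IsFreeBasis t ∧ ∀ i, t i = secPull U.ι M (U := U) (by simp) (s i) :=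
  ⟨fun h ↦ ⟨_, h, fun _ ↦ rfl⟩, fun ⟨t, h, ht⟩ ↦ by
    rwa [funext ht] at h⟩

/-- The basis is pulled back along the restricted morphism `g ∣_ U`. Both ways around the square `w`
give the same pull-back of `F`-sections to `g ⁻¹ᵁ U`, up to canonical isomorphism. -/
lemma IsFreeBasisOn.pullback {M : Y.Modules} {U : Y.Opens} {r : ℕ} {s : Fin r → Sec M U}
    (hs : IsFreeBasisOn M U s) (g : X ⟶ Y)
    {t : Fin r → Sec ((Scheme.Modules.pullback g).obj M) (g ⁻¹ᵁ U)}
    (ht : ∀ i, t i = secPullback g M U (s i)) :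
    IsFreeBasisOn ((Scheme.Modules.pullback g).obj M) (g ⁻¹ᵁ U) t := by
  have w : (g ∣_ U) ≫ U.ι = (g ⁻¹ᵁ U).ι ≫ g := morphismRestrict_ι g U
  have hw : (⊤ : (g ⁻¹ᵁ U : Scheme.{u}).Opens) ≤ ((g ⁻¹ᵁ U).ι ≫ g) ⁻¹ᵁ U := by simp
  obtain ⟨a, ha, has⟩ := isFreeBasisOn_iff.mp hs
  obtain ⟨b, hb, hba⟩ := ha.exists_pullback (g ∣_ U)
  obtain ⟨c, hc, hcb⟩ := hb.exists_map (pullbackFactor _ _ _ w M)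
  obtain ⟨d, hdt⟩ : ∃ d : Fin r → _, ∀ i, d i =
      secPull (g ⁻¹ᵁ U).ι _ (U := g ⁻¹ᵁ U) (by simp) (t i) := ⟨_, fun _ ↦ rfl⟩
  refine isFreeBasisOn_iff.mpr ⟨d, hc.of_secMap_eq (pullbackFactor (g ⁻¹ᵁ U).ι g _ rfl M)
    fun i ↦ ?_, hdt⟩
  have h2 := secMap_secPull_secPull (g ∣_ U) U.ι _ w M (V := ⊤) (by simp) le_rfl hw (s i)
  have h3 := secMap_secPull_secPull (g ⁻¹ᵁ U).ι g _ rfl M le_rfl (by simp) hw (s i)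
  rw [secRes_rfl] at h3
  rw [hdt, ht, hcb, hba, has, secPull_apply U.ι]
  exact h3.trans h2.symm

lemma exists_isFreeBasisOn_of_iso {M : X.Modules} {U : X.Opens} {J : Type u} {r : ℕ}
    (e : freeModule U J ≅ (Scheme.Modules.pullback U.ι).obj M) (σ : Fin r ≃ J) :
    ∃ s : Fin r → Sec M U, IsFreeBasisOn M U s := by
  have h := (isFreeBasis_freeModule (X := U) σ).map e.hom
  choose s hs using fun i ↦ (secPull_ι_bijective M U).2
    (secMap e.hom ⊤ (secMap (freeι (X := U) (σ i)) ⊤ (unitSec 1)))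
  refine ⟨s, ?_⟩
  simp only [← hs] at h
  exact h

/-- A locally free module is isomorphic to a free module in a neighbourhood of every point. -/
lemma exists_freeModule_iso_restrict (M : X.Modules)
    (hM : SheafOfModules.IsLocallyFree (R := X.ringCatSheaf) M) (x : X) :
    ∃ (U : X.Opens) (_ : x ∈ U) (J : Type u), Nonempty (freeModule U J ≅ M.restrict U.ι) := by
  obtain ⟨q, hq⟩ := hM.exists_isLocallyFreeData
  have cov := q.coversTop
  rw [Opens.coversTop_iff, IsOpenCover] at cov
  have hx : x ∈ iSup q.X := cov ▸ Opens.mem_top x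
  obtain ⟨i, hi⟩ := Opens.mem_iSup.mp hx
  let U : X.Opens := q.X i
  have := hq.isIso i
  -- Local freeness is expressed on the slice over `U`; `overEquiv` carries it to modules on the
  -- open subscheme, where the free module has to be recognized again.
  have e1 : SheafOfModules.unit (U : Scheme.{u}).ringCatSheaf ≅
      (Scheme.Modules.overEquiv U).functor.obj (SheafOfModules.unit (X.ringCatSheaf.over U)) :=
    (Scheme.Modules.restrictUnitIso U.ι).symm ≪≫
      ((Scheme.Modules.overFunctorEquiv U).app (SheafOfModules.unit X.ringCatSheaf)).symm
  let G : SheafOfModules.{u} (X.ringCatSheaf.over U) ⥤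
    SheafOfModules.{u} (U : Scheme.{u}).ringCatSheaf := (Scheme.Modules.overEquiv U).functor
  have : Limits.PreservesColimitsOfShape (Discrete (q.generators i).I) G :=
    (Scheme.Modules.overEquiv U).toAdjunction.leftAdjoint_preservesColimits.1
  have e2 : freeModule (U : Scheme.{u}) (q.generators i).I ≅
      (Scheme.Modules.overEquiv U).functor.obj (SheafOfModules.free (R := X.ringCatSheaf.over U) (q.generators i).I) :=
    SheafOfModules.mapFreeIso G _ e1
  have e3 := (Scheme.Modules.overEquiv U).functor.mapIso (asIso (q.generators i).π)
  exact ⟨U, hi, _, ⟨e2 ≪≫ e3 ≪≫ (Scheme.Modules.overFunctorEquiv U).app M⟩⟩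

/-- A module which is locally free near a closed subscheme and whose restriction to the subscheme
is free of rank `r` has a basis with `r` elements near every point of the subscheme. -/
lemma exists_isFreeBasisOn {I : X.IdealSheafData} {F : X.Modules} {r : ℕ}
    (hF : IsLocallyFreeNear I F) (hP : IsFreeOnSubscheme I F r) {x : X} (hx : x ∈ I.support) :
    ∃ (U : X.Opens) (s : Fin r → Sec F U), x ∈ U ∧ IsFreeBasisOn F U s := by
  obtain ⟨W, hW, hfree⟩ := hF
  obtain ⟨eP⟩ := hP
  obtain ⟨U', hxU', J, ⟨e⟩⟩ := exists_freeModule_iso_restrict _ hfree ⟨x, hW hx⟩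
  let U : X.Opens := W.ι ''ᵁ U'
  have hxU : x ∈ U := ⟨⟨x, hW hx⟩, hxU', rfl⟩
  have hk : Set.range U.ι ⊆ Set.range (U'.ι ≫ W.ι) := by
    rintro _ ⟨y, rfl⟩
    obtain ⟨z, hz, hzy⟩ := y.2
    exact ⟨⟨z, hz⟩, hzy⟩
  -- The open `U'` of `W` and its image `U` in `X` are different schemes; `k` maps `U` to `U'` over
  -- `X`.
  let k := IsOpenImmersion.lift (U'.ι ≫ W.ι) U.ι hk
  have hkι : k ≫ (U'.ι ≫ W.ι) = U.ι := IsOpenImmersion.lift_fac _ _ hk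
  let e1 : freeModule U' J ≅ (Scheme.Modules.pullback (U'.ι ≫ W.ι)).obj F :=
    e ≪≫ (Scheme.Modules.restrictFunctorIsoPullback U'.ι).app _ ≪≫
      (Scheme.Modules.pullback U'.ι).mapIso
        ((Scheme.Modules.restrictFunctorIsoPullback W.ι).app F) ≪≫
      asIso (pullbackFactor U'.ι W.ι _ rfl F)
  let e2 : freeModule U J ≅ (Scheme.Modules.pullback U.ι).obj F :=
    (pullbackFreeIso k J).symm ≪≫ (Scheme.Modules.pullback k).mapIso e1 ≪≫
      asIso (pullbackFactor k _ _ hkι F)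
  let U₀ : I.subscheme.Opens := I.subschemeι ⁻¹ᵁ U
  have w : (I.subschemeι ∣_ U) ≫ U.ι = U₀.ι ≫ I.subschemeι := morphismRestrict_ι _ U
  -- On the trace of `U` on the subscheme, `F` is free both on `J` and on `r` elements. This trace
  -- contains the point over `x`, so its ring of functions is nontrivial and the ranks agree.
  let e3 : freeModule U₀ J ≅ freeModule U₀ (ULift.{u} (Fin r)) :=
    (pullbackFreeIso (I.subschemeι ∣_ U) J).symm ≪≫
      (Scheme.Modules.pullback (I.subschemeι ∣_ U)).mapIso e2 ≪≫
      asIso (pullbackFactor _ _ _ w F) ≪≫ (asIso (pullbackFactor U₀.ι I.subschemeι _ rfl F)).symm ≪≫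
      (Scheme.Modules.pullback U₀.ι).mapIso eP ≪≫ pullbackFreeIso U₀.ι _
  have hne : Nonempty (U₀ : Scheme.{u}) := by
    rw [← SetLike.mem_coe, ← Scheme.IdealSheafData.range_subschemeι] at hx
    obtain ⟨y, hy⟩ := hx
    exact ⟨⟨y, show I.subschemeι y ∈ U from hy ▸ hxU⟩⟩
  have : Nontrivial Γ((U₀ : Scheme.{u}), ⊤) :=
    have : Nonempty (⊤ : (U₀ : Scheme.{u}).Opens) := hne.map fun y ↦ ⟨y, trivial⟩
    Scheme.component_nontrivial _ _
  obtain ⟨σ⟩ := nonempty_equiv_of_iso e3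
  obtain ⟨s, hs⟩ := exists_isFreeBasisOn_of_iso e2 σ
  exact ⟨U, s, hxU, hs⟩

/-- The restriction of `F` to the subscheme, if free, has a basis. -/
lemma IsFreeOnSubscheme.exists_isFreeBasis {I : X.IdealSheafData} {F : X.Modules} {r : ℕ}
    (hP : IsFreeOnSubscheme I F r) :
    ∃ s : Fin r → Sec ((Scheme.Modules.pullback I.subschemeι).obj F) ⊤, IsFreeBasis s := by
  obtain ⟨e⟩ := hP
  let e' : freeModule _ (ULift.{u} (Fin r)) ≅ (Scheme.Modules.pullback I.subschemeι).obj F := e.symm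
  exact ⟨_, (isFreeBasis_freeModule Equiv.ulift.symm).map e'.hom⟩

end LocallyFree

/-! ### Multiplication by powers of the uniformizer. -/

section UniformizerPow

variable {C S : Scheme.{u}} (π : C ⟶ S) {I : C.IdealSheafData} [IsSection π I]
  (τ : completionRing (nbhds I) ⊤)

/-- The `n`-th power of the generator `τ`, as a section of `𝒪_C / I ^ (n + 1)`. -/
def uniformizerPow (U : C.Opens) (n : ℕ) : QuotSections (nbhds I) U (n + 1) :=
  quotRes (nbhds I) le_top (n + 1) (τ.1 (n + 1)) ^ n

variable {τ} (hτ : IsConormalGenerator (τ.1 2))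

lemma seriesEval_X_pow (U : C.Opens) (n : ℕ) :
    seriesEval π hτ U (n + 1) (PowerSeries.X ^ n) = uniformizerPow τ U n := by
  rw [map_pow, seriesEval_X, uniformizerPow]

include π hτ
variable (hI : IsEffectiveCartier I) {U : C.Opens}
include hI

lemma quotProj_surjective (U : C.Opens) {m n : ℕ} (h : m ≤ n) :
    Function.Surjective (quotProj (nbhds I) U m n h) := fun x ↦ by
  obtain ⟨f, rfl⟩ := seriesEval_surjective π hτ hI U m x
  exact ⟨_, quotProj_seriesEval π hτ U h f⟩

/-- In terms of power series: `z ^ (n + 1)` divides `z ^ n * f` exactly when `z` divides `f`. -/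
lemma uniformizerPow_mul_eq_zero_iff {n : ℕ} {a : QuotSections (nbhds I) U (n + 1)} :
    uniformizerPow τ U n * a = 0 ↔ quotProj (nbhds I) U 1 (n + 1) (Nat.le_add_left 1 n) a = 0 := by
  obtain ⟨f, rfl⟩ := seriesEval_surjective π hτ hI U (n + 1) a
  rw [quotProj_seriesEval, ← seriesEval_X_pow π hτ, ← map_mul]
  constructor
  · intro h
    obtain ⟨f', hf'⟩ := X_pow_dvd_of_seriesEval_eq_zero π hτ hI h
    rw [pow_succ, mul_assoc] at hf'
    rw [PowerSeries.X_pow_mul_cancel hf']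
    exact seriesEval_eq_zero_of_dvd π hτ (by simp)
  · intro h
    obtain ⟨f', rfl⟩ := X_pow_dvd_of_seriesEval_eq_zero π hτ hI h
    rw [← mul_assoc, ← pow_add]
    exact seriesEval_eq_zero_of_dvd π hτ (dvd_mul_right _ _)

lemma exists_uniformizerPow_mul_eq {n : ℕ} {a : QuotSections (nbhds I) U (n + 1)}
    (ha : quotProj (nbhds I) U n (n + 1) n.le_succ a = 0) : ∃ b, uniformizerPow τ U n * b = a := by
  obtain ⟨f, rfl⟩ := seriesEval_surjective π hτ hI U (n + 1) a
  rw [quotProj_seriesEval] at ha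
  obtain ⟨f', rfl⟩ := X_pow_dvd_of_seriesEval_eq_zero π hτ hI ha
  exact ⟨seriesEval π hτ U (n + 1) f', by rw [map_mul, seriesEval_X_pow]⟩

/-- Injectivity comes from the retraction, surjectivity from reducing a power series modulo `z` to
its constant term. -/
lemma quotStructureMap_one_bijective : Function.Bijective (quotStructureMap π I 1 U) := by
  refine ⟨fun a b hab ↦ ?_, fun x ↦ ?_⟩
  · have := congr(subschemeProj (pow_succ_le I 0) U $hab)
    rwa [subschemeProj_quotStructureMap, subschemeProj_quotStructureMap] at this
  · obtain ⟨f, rfl⟩ := seriesEval_surjective π hτ hI U 1 x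
    refine ⟨PowerSeries.constantCoeff f, ?_⟩
    rw [← seriesEval_C π hτ, ← sub_eq_zero, ← map_sub]
    refine seriesEval_eq_zero_of_dvd π hτ ?_
    rw [pow_one, PowerSeries.X_dvd_iff]
    simp

end UniformizerPow

/-! ### Towers of modules -/

section Tower

open Opposite

/-- The presheaf with given sections and restriction maps. -/
def presheafOfRes {C : Scheme.{u}} (M : C.Opens → Type u) [∀ U, AddCommGroup (M U)]
    (res : ∀ {U V : C.Opens}, V ≤ U → (M U →+ M V))
    (res_rfl : ∀ {U : C.Opens} (h : U ≤ U) (x : M U), res h x = x)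
    (res_res : ∀ {U V W : C.Opens} (h : V ≤ U) (h' : W ≤ V) (x : M U),
      res h' (res h x) = res (h'.trans h) x) : TopCat.Presheaf AddCommGrpCat.{u} C where
  obj U := .of (M U.unop)
  map f := AddCommGrpCat.ofHom (res f.unop.le)
  map_id U := by
    ext x
    exact res_rfl _ x
  map_comp f g := by
    ext x
    exact (res_res f.unop.le g.unop.le x).symm

/-- A sequence of presheaves of rings `A n` and sheaves of modules `M n` on a scheme, with
projections from the `n`-th to the `m`-th for `m ≤ n`. -/
structure ModuleTower (C : Scheme.{u}) where
  /-- the sections of the rings -/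
  A : C.Opens → ℕ → Type u
  /-- the sections of the modules -/
  M : C.Opens → ℕ → Type u
  [ring (U : C.Opens) (n : ℕ) : CommRing (A U n)]
  [group (U : C.Opens) (n : ℕ) : AddCommGroup (M U n)]
  [module (U : C.Opens) (n : ℕ) : Module (A U n) (M U n)]
  /-- restriction of sections of the rings -/
  aRes {U V : C.Opens} (h : V ≤ U) (n : ℕ) : A U n →+* A V n
  /-- the projections between the rings -/
  aProj (U : C.Opens) (m n : ℕ) (h : m ≤ n) : A U n →+* A U m
  /-- restriction of sections of the modules -/
  mRes {U V : C.Opens} (h : V ≤ U) (n : ℕ) : M U n →+ M V n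
  /-- the projections between the modules -/
  mProj (U : C.Opens) (m n : ℕ) (h : m ≤ n) : M U n →+ M U m
  aRes_aRes {U V W : C.Opens} (h : V ≤ U) (h' : W ≤ V) (n : ℕ) (a : A U n) :
    aRes h' n (aRes h n a) = aRes (h'.trans h) n a
  aProj_aRes {U V : C.Opens} (i : V ≤ U) (m n : ℕ) (h : m ≤ n) (a : A U n) :
    aProj V m n h (aRes i n a) = aRes i m (aProj U m n h a)
  mRes_rfl {U : C.Opens} (n : ℕ) (h : U ≤ U) (x : M U n) : mRes h n x = x
  mRes_mRes {U V W : C.Opens} (n : ℕ) (h : V ≤ U) (h' : W ≤ V) (x : M U n) :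
    mRes h' n (mRes h n x) = mRes (h'.trans h) n x
  mRes_smul {U V : C.Opens} (h : V ≤ U) (n : ℕ) (a : A U n) (x : M U n) :
    mRes h n (a • x) = aRes h n a • mRes h n x
  mProj_mRes {U V : C.Opens} (i : V ≤ U) (m n : ℕ) (h : m ≤ n) (x : M U n) :
    mProj V m n h (mRes i n x) = mRes i m (mProj U m n h x)
  mProj_smul (U : C.Opens) (m n : ℕ) (h : m ≤ n) (a : A U n) (x : M U n) :
    mProj U m n h (a • x) = aProj U m n h a • mProj U m n h x
  isSheaf (n : ℕ) : (presheafOfRes (fun U ↦ M U n) (fun h ↦ mRes h n) (mRes_rfl n)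
    (mRes_mRes n)).IsSheaf

namespace ModuleTower

attribute [instance] ModuleTower.ring ModuleTower.group ModuleTower.module

variable {C : Scheme.{u}} (T : ModuleTower C)

/-- The `n`-th module of a tower, as a sheaf of abelian groups. -/
def mSheaf (n : ℕ) : TopCat.Sheaf AddCommGrpCat.{u} C :=
  ⟨presheafOfRes (fun U ↦ T.M U n) (fun h ↦ T.mRes h n) (T.mRes_rfl n) (T.mRes_mRes n),
    T.isSheaf n⟩

lemma m_ext {n : ℕ} {U : C.Opens} (s t : T.M U n)
    (h : ∀ x ∈ U, ∃ (V : C.Opens) (i : V ≤ U), x ∈ V ∧ T.mRes i n s = T.mRes i n t) : s = t :=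
  sheaf_ext (T.mSheaf n) s t h

lemma m_glue {n : ℕ} {U : C.Opens} (P : ∀ V : C.Opens, T.M V n → Prop)
    (hres : ∀ (V W : C.Opens) (i : W ≤ V) (s : T.M V n), P V s → P W (T.mRes i n s))
    (huniq : ∀ (V : C.Opens) (s t : T.M V n), V ≤ U → P V s → P V t → s = t)
    (hloc : ∀ x ∈ U, ∃ V : C.Opens, x ∈ V ∧ V ≤ U ∧ ∃ s, P V s) :
    ∃ s : T.M U n, ∀ x ∈ U, ∃ (V : C.Opens) (i : V ≤ U), x ∈ V ∧ P V (T.mRes i n s) :=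
  sheaf_glue (T.mSheaf n) P hres huniq hloc

/-- The projections of a tower, as morphisms of sheaves. -/
def mSheafProj {m n : ℕ} (h : m ≤ n) : T.mSheaf n ⟶ T.mSheaf m := ⟨{
  app U := AddCommGrpCat.ofHom (T.mProj U.unop m n h)
  naturality U V f := by
    ext x
    exact T.mProj_mRes f.unop.le m n h x }⟩

end ModuleTower

end Tower

/-! ### Local bases of a tower. -/

section LocalBasis

variable {C : Scheme.{u}} {T : ModuleTower C}

/-- The linear combination over `V` of sections over `U` of the `n`-th module of a tower. -/
def moduleComb {U V : C.Opens} (h : V ≤ U) (n : ℕ) {r : ℕ}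
    (b : Fin r → T.M U n) (a : Fin r → T.A V n) :
    T.M V n :=
  ∑ i, a i • T.mRes h n (b i)

section

variable {U V W : C.Opens} {r n : ℕ}

lemma moduleRes_moduleComb (h : V ≤ U) (h' : W ≤ V)
    (b : Fin r → T.M U n) (a : Fin r → T.A V n) :
    T.mRes h' n (moduleComb h n b a) =
      moduleComb (h'.trans h) n b (fun i ↦ T.aRes h' n (a i)) := by
  simp only [moduleComb, map_sum, T.mRes_smul, T.mRes_mRes]

lemma moduleProj_moduleComb (h : V ≤ U) {m : ℕ} (hmn : m ≤ n)
    {b : Fin r → T.M U n}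
    {b' : Fin r → T.M U m}
    (hb : ∀ i, T.mProj U m n hmn (b i) = b' i)
    (a : Fin r → T.A V n) :
    T.mProj V m n hmn (moduleComb h n b a) =
      moduleComb h m b' (fun i ↦ T.aProj V m n hmn (a i)) := by
  simp only [moduleComb, map_sum, T.mProj_smul, T.mProj_mRes, hb]

lemma moduleComb_moduleRes (h : V ≤ U) (h' : W ≤ V)
    (b : Fin r → T.M U n) (a : Fin r → T.A W n) :
    moduleComb h' n (fun i ↦ T.mRes h n (b i)) a = moduleComb (h'.trans h) n b a := by
  simp only [moduleComb, T.mRes_mRes]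

lemma smul_moduleComb (h : V ≤ U) (b : Fin r → T.M U n)
    (c : T.A V n) (a : Fin r → T.A V n) :
    c • moduleComb h n b a = moduleComb h n b (fun i ↦ c * a i) := by
  simp only [moduleComb, Finset.smul_sum, mul_smul]

lemma moduleComb_zero (h : V ≤ U) (b : Fin r → T.M U n) :
    moduleComb h n b (fun _ ↦ 0) = 0 := by
  simp [moduleComb]

lemma moduleComb_sub (h : V ≤ U) (b : Fin r → T.M U n)
    (a a' : Fin r → T.A V n) :
    moduleComb h n b (fun i ↦ a i - a' i) = moduleComb h n b a - moduleComb h n b a' := by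
  simp [moduleComb, sub_smul]

lemma moduleComb_add (h : V ≤ U) (b : Fin r → T.M U n)
    (a a' : Fin r → T.A V n) :
    moduleComb h n b (fun i ↦ a i + a' i) = moduleComb h n b a + moduleComb h n b a' := by
  simp [moduleComb, add_smul, Finset.sum_add_distrib]

end

variable (T) in
/-- Compatible bases, over all opens contained in `V`, of the modules of a tower. -/
structure IsLocalBasis (V : C.Opens) {r : ℕ}
    (b : ∀ n, Fin r → T.M V n) : Prop where
  proj (m n : ℕ) (h : m ≤ n) (i : Fin r) : T.mProj V m n h (b n i) = b m i
  bijective (W : C.Opens) (h : W ≤ V) (n : ℕ) : Function.Bijective (moduleComb h n (b n))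

variable (T) in
/-- Compatible bases of the modules of a tower exist locally. -/
def HasLocalBases (r : ℕ) : Prop :=
  ∀ x : C, ∃ (V : C.Opens) (b : ∀ n, Fin r → T.M V n), x ∈ V ∧
    IsLocalBasis T V b

/-- For use away from `P`: over zero rings the modules vanish, and any `r` sections form a basis. -/
lemma isLocalBasis_of_subsingleton {V : C.Opens}
    (hV : ∀ W ≤ V, ∀ n, Subsingleton (T.A W n)) (r : ℕ) :
    IsLocalBasis T V (fun _ (_ : Fin r) ↦ 0) where
  proj _ _ h _ := map_zero _
  bijective W h n := by
    have := hV W h n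
    have := Module.subsingleton (T.A W n) (T.M W n)
    exact ⟨Function.injective_of_subsingleton _, fun x ↦ ⟨0, Subsingleton.elim _ _⟩⟩

end LocalBasis

/-! ### The graded pieces of a tower. -/

section Uniformized

variable {C : Scheme.{u}} {T : ModuleTower C}

/-- The restriction to `U` of the `n`-th member of a family of global sections. -/
def resTop (g : ∀ n, T.A ⊤ (n + 1)) (n : ℕ) (U : C.Opens) : T.A U (n + 1) :=
  T.aRes le_top (n + 1) (g n)

lemma quotRes_resTop (g : ∀ n, T.A ⊤ (n + 1)) (n : ℕ) {U V : C.Opens} (h : V ≤ U) :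
    T.aRes h (n + 1) (resTop g n U) = resTop g n V :=
  T.aRes_aRes _ h _ _

variable (T) in
/-- The rings of a tower behave like the quotients of `𝒪_P⟦z⟧` by `z ^ n`, where `z ^ n` gives the
section `g n` of the `n + 1`-st ring. -/
structure IsUniformized (g : ∀ n, T.A ⊤ (n + 1)) : Prop where
  subsingleton (U : C.Opens) : Subsingleton (T.A U 0)
  proj_rfl (U : C.Opens) (n : ℕ) (a : T.A U n) : T.aProj U n n le_rfl a = a
  proj_proj (U : C.Opens) (l m n : ℕ) (h : l ≤ m) (h' : m ≤ n) (a : T.A U n) :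
    T.aProj U l m h (T.aProj U m n h' a) = T.aProj U l n (h.trans h') a
  proj_surjective (U : C.Opens) (m n : ℕ) (h : m ≤ n) : Function.Surjective (T.aProj U m n h)
  proj_eq_zero (n : ℕ) : T.aProj ⊤ n (n + 1) n.le_succ (g n) = 0
  mul_eq_zero_iff (U : C.Opens) (n : ℕ) (a : T.A U (n + 1)) :
    resTop g n U * a = 0 ↔ T.aProj U 1 (n + 1) (Nat.le_add_left 1 n) a = 0
  exists_mul_eq (U : C.Opens) (n : ℕ) (a : T.A U (n + 1))
    (ha : T.aProj U n (n + 1) n.le_succ a = 0) :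
    ∃ b, resTop g n U * b = a

variable {r : ℕ}

lemma IsLocalBasis.res {V W : C.Opens} {b : ∀ n, Fin r → T.M V n}
    (hb : IsLocalBasis T V b) (h : W ≤ V) :
    IsLocalBasis T W (fun n i ↦ T.mRes h n (b n i)) where
  proj m n hmn i := by rw [T.mProj_mRes, hb.proj]
  bijective W' h' n := by
    have := hb.bijective W' (h'.trans h) n
    convert this using 1
    funext a
    exact moduleComb_moduleRes h h' (b n) a

lemma HasLocalBases.exists_le (hF : HasLocalBases T r) {U : C.Opens} {x : C} (hx : x ∈ U) :
    ∃ (V : C.Opens) (b : ∀ n, Fin r → T.M V n), x ∈ V ∧ V ≤ U ∧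
      IsLocalBasis T V b := by
  obtain ⟨V, b, hxV, hb⟩ := hF x
  exact ⟨U ⊓ V, _, ⟨hx, hxV⟩, inf_le_left, hb.res inf_le_right⟩

lemma moduleComb_eq_zero_iff {U V : C.Opens} {h : V ≤ U} {n : ℕ}
    {b : Fin r → T.M U n} (hb : Function.Injective (moduleComb h n b))
    (a : Fin r → T.A V n) : moduleComb h n b a = 0 ↔ ∀ i, a i = 0 := by
  constructor
  · intro h0
    have := hb (h0.trans (moduleComb_zero h b).symm)
    exact fun i ↦ congr_fun this i
  · intro h0
    rw [funext h0]
    exact moduleComb_zero h b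

namespace IsLocalBasis

variable {V : C.Opens} {b : ∀ n, Fin r → T.M V n} (hb : IsLocalBasis T V b)
include hb

lemma exists_moduleComb_eq {n : ℕ} (x : T.M V n) :
    ∃ a, moduleComb le_rfl n (b n) a = x := (hb.bijective V le_rfl n).2 x

lemma proj_moduleComb {m n : ℕ} (h : m ≤ n) (a : Fin r → T.A V n) :
    T.mProj V m n h (moduleComb le_rfl n (b n) a) =
      moduleComb le_rfl m (b m) (fun i ↦ T.aProj V m n h (a i)) :=
  moduleProj_moduleComb le_rfl h (hb.proj m n h) a

lemma moduleComb_eq_zero_iff {n : ℕ} (a : Fin r → T.A V n) :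
    moduleComb le_rfl n (b n) a = 0 ↔ ∀ i, a i = 0 :=
  FormalCompletion.moduleComb_eq_zero_iff (hb.bijective V le_rfl n).1 a

variable {g : ∀ n, T.A ⊤ (n + 1)} (hT : IsUniformized T g)
include hT

/-- The identities for the module projections are inherited from the rings through coordinates, so
no coherence between iterated pull-backs has to be checked. -/
lemma moduleProj_rfl {n : ℕ} (x : T.M V n) :
    T.mProj V n n le_rfl x = x := by
  obtain ⟨a, rfl⟩ := hb.exists_moduleComb_eq x
  rw [hb.proj_moduleComb]
  simp only [hT.proj_rfl]

lemma moduleProj_moduleProj {l m n : ℕ} (h : l ≤ m) (h' : m ≤ n)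
    (x : T.M V n) :
    T.mProj V l m h (T.mProj V m n h' x) = T.mProj V l n (h.trans h') x := by
  obtain ⟨a, rfl⟩ := hb.exists_moduleComb_eq x
  rw [hb.proj_moduleComb, hb.proj_moduleComb, hb.proj_moduleComb]
  simp only [hT.proj_proj]

lemma moduleProj_surjective {m n : ℕ} (h : m ≤ n) :
    Function.Surjective (T.mProj V m n h) := fun x ↦ by
  obtain ⟨a, rfl⟩ := hb.exists_moduleComb_eq x
  choose a' ha' using fun i ↦ hT.proj_surjective V m n h (a i)
  refine ⟨moduleComb le_rfl n (b n) a', ?_⟩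
  rw [hb.proj_moduleComb]
  simp only [ha']

lemma smul_eq_zero_iff {n : ℕ} (x : T.M V (n + 1)) :
    resTop g n V • x = 0 ↔
      T.mProj V 1 (n + 1) (Nat.le_add_left 1 n) x = 0 := by
  obtain ⟨a, rfl⟩ := hb.exists_moduleComb_eq x
  rw [hb.proj_moduleComb, smul_moduleComb, hb.moduleComb_eq_zero_iff, hb.moduleComb_eq_zero_iff]
  simp only [hT.mul_eq_zero_iff]

lemma exists_smul_eq {n : ℕ} {x : T.M V (n + 1)}
    (hx : T.mProj V n (n + 1) n.le_succ x = 0) :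
    ∃ y, resTop g n V • y = x := by
  obtain ⟨a, rfl⟩ := hb.exists_moduleComb_eq x
  rw [hb.proj_moduleComb, hb.moduleComb_eq_zero_iff] at hx
  choose a' ha' using fun i ↦ hT.exists_mul_eq V n (a i) (hx i)
  refine ⟨moduleComb le_rfl (n + 1) (b (n + 1)) a', ?_⟩
  rw [smul_moduleComb]
  simp only [ha']

end IsLocalBasis

/-- The section `y` is the product of `g n` with any lift of `c`. -/
def IsMulLift (g : ∀ n, T.A ⊤ (n + 1)) {U : C.Opens} {n : ℕ}
    (c : T.M U 1) (y : T.M U (n + 1)) : Prop :=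
  ∀ (W : C.Opens) (h : W ≤ U) (b : T.M W (n + 1)),
    T.mProj W 1 (n + 1) (Nat.le_add_left 1 n) b = T.mRes h 1 c →
      resTop g n W • b = T.mRes h (n + 1) y

variable {g : ∀ n, T.A ⊤ (n + 1)} (hT : IsUniformized T g) (hF : HasLocalBases T r)
  {U V : C.Opens} {n : ℕ}

lemma IsMulLift.res {c : T.M U 1} {y : T.M U (n + 1)}
    (hy : IsMulLift g c y) (h : V ≤ U) :
    IsMulLift g (T.mRes h 1 c) (T.mRes h (n + 1) y) := by
  intro W h' b hb
  rw [T.mRes_mRes] at hb ⊢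
  exact hy W _ b hb

lemma moduleRes_smul_res (h : V ≤ U) (x : T.M U (n + 1)) :
    T.mRes h (n + 1) (resTop g n U • x) =
      resTop g n V • T.mRes h (n + 1) x := by
  rw [T.mRes_smul, quotRes_resTop]

include hT hF

lemma HasLocalBases.moduleProj_rfl (x : T.M U n) :
    T.mProj U n n le_rfl x = x :=
  T.m_ext _ _ fun p hp ↦ by
    obtain ⟨V, b, hpV, hV, hb⟩ := hF.exists_le hp
    exact ⟨V, hV, hpV, by rw [← T.mProj_mRes, hb.moduleProj_rfl hT]⟩

lemma HasLocalBases.moduleProj_moduleProj {l m : ℕ} (h : l ≤ m) (h' : m ≤ n)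
    (x : T.M U n) :
    T.mProj U l m h (T.mProj U m n h' x) = T.mProj U l n (h.trans h') x :=
  T.m_ext _ _ fun p hp ↦ by
    obtain ⟨V, b, hpV, hV, hb⟩ := hF.exists_le hp
    exact ⟨V, hV, hpV, by
      rw [← T.mProj_mRes, ← T.mProj_mRes, ← T.mProj_mRes,
        hb.moduleProj_moduleProj hT]⟩

lemma HasLocalBases.smul_eq_zero_iff (x : T.M U (n + 1)) :
    resTop g n U • x = 0 ↔
      T.mProj U 1 (n + 1) (Nat.le_add_left 1 n) x = 0 := by
  constructor
  · intro h
    refine T.m_ext _ _ fun p hp ↦ ?_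
    obtain ⟨V, b, hpV, hV, hb⟩ := hF.exists_le hp
    refine ⟨V, hV, hpV, ?_⟩
    rw [← T.mProj_mRes, map_zero, ← hb.smul_eq_zero_iff hT, ← moduleRes_smul_res hV, h,
      map_zero]
  · intro h
    refine T.m_ext _ _ fun p hp ↦ ?_
    obtain ⟨V, b, hpV, hV, hb⟩ := hF.exists_le hp
    refine ⟨V, hV, hpV, ?_⟩
    rw [moduleRes_smul_res, map_zero, hb.smul_eq_zero_iff hT, T.mProj_mRes, h, map_zero]

/-- Two lifts of the same section at level one differ by something that `g n` kills. `IsMulLift` is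
thus the graph of the map from level one to level `n + 1` induced by multiplication with `g n`. -/
lemma HasLocalBases.isMulLift_smul (x : T.M U (n + 1)) :
    IsMulLift g (T.mProj U 1 (n + 1) (Nat.le_add_left 1 n) x)
      (resTop g n U • x) := by
  intro W h b hb
  rw [moduleRes_smul_res, ← sub_eq_zero, ← smul_sub, hF.smul_eq_zero_iff hT, map_sub, hb,
    T.mProj_mRes, sub_self]

/-- Locally, sections related by `IsMulLift` come from a common lift. -/
lemma HasLocalBases.exists_lift {c : T.M U 1} {p : C} (hp : p ∈ U) (n : ℕ) :
    ∃ (V : C.Opens) (h : V ≤ U) (b : T.M V (n + 1)), p ∈ V ∧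
      T.mProj V 1 (n + 1) (Nat.le_add_left 1 n) b = T.mRes h 1 c := by
  obtain ⟨V, b, hpV, hV, hb⟩ := hF.exists_le hp
  obtain ⟨b', hb'⟩ := hb.moduleProj_surjective hT (Nat.le_add_left 1 n) (T.mRes hV 1 c)
  exact ⟨V, hV, b', hpV, hb'⟩

lemma IsMulLift.right_unique {c : T.M U 1}
    {y y' : T.M U (n + 1)} (hy : IsMulLift g c y) (hy' : IsMulLift g c y') :
    y = y' := by
  refine T.m_ext _ _ fun p hp ↦ ?_
  obtain ⟨V, hV, b, hpV, hb⟩ := hF.exists_lift hT (c := c) hp n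
  exact ⟨V, hV, hpV, (hy V hV b hb).symm.trans (hy' V hV b hb)⟩

/-- Injectivity of the map from level one: `g n` kills only sections that vanish at level one. -/
lemma IsMulLift.left_unique {c c' : T.M U 1}
    {y : T.M U (n + 1)} (hy : IsMulLift g c y) (hy' : IsMulLift g c' y) :
    c = c' := by
  refine T.m_ext _ _ fun p hp ↦ ?_
  obtain ⟨V, b, hpV, hV, hb⟩ := hF.exists_le hp
  obtain ⟨b₁, hb₁⟩ := hb.moduleProj_surjective hT (Nat.le_add_left 1 n) (T.mRes hV 1 c)
  obtain ⟨b₂, hb₂⟩ := hb.moduleProj_surjective hT (Nat.le_add_left 1 n) (T.mRes hV 1 c')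
  refine ⟨V, hV, hpV, ?_⟩
  rw [← hb₁, ← hb₂, ← sub_eq_zero, ← map_sub, ← hb.smul_eq_zero_iff hT, smul_sub, sub_eq_zero]
  exact (hy V hV b₁ hb₁).trans (hy' V hV b₂ hb₂).symm

lemma IsMulLift.moduleProj_eq_zero {c : T.M U 1}
    {y : T.M U (n + 1)} (hy : IsMulLift g c y) :
    T.mProj U n (n + 1) n.le_succ y = 0 := by
  refine T.m_ext _ _ fun p hp ↦ ?_
  obtain ⟨V, hV, b, hpV, hb⟩ := hF.exists_lift hT (c := c) hp n
  refine ⟨V, hV, hpV, ?_⟩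
  rw [← T.mProj_mRes, ← hy V hV b hb, T.mProj_smul, resTop,
    T.aProj_aRes, hT.proj_eq_zero, map_zero, zero_smul, map_zero]

/-- Lifts of `c` exist only locally, but their products with `g n` are independent of the lift and
glue. -/
lemma HasLocalBases.exists_isMulLift (n : ℕ) (c : T.M U 1) :
    ∃ y : T.M U (n + 1), IsMulLift g c y := by
  refine Exists.elim (T.m_glue (n := n + 1) (U := U)
    (fun V y ↦ ∃ h : V ≤ U, IsMulLift g (T.mRes h 1 c) y) (fun V W i s hs ↦ ?_)
    (fun V s t hV hs ht ↦ ?_) (fun p hp ↦ ?_)) fun y hy ↦ ?_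
  · obtain ⟨h, hs⟩ := hs
    refine ⟨i.trans h, ?_⟩
    have := hs.res i
    rwa [T.mRes_mRes] at this
  · exact IsMulLift.right_unique hT hF hs.2 ht.2
  · obtain ⟨V, hV, b, hpV, hb⟩ := hF.exists_lift hT (c := c) hp n
    exact ⟨V, hpV, hV, _, hV, hb ▸ hF.isMulLift_smul hT b⟩
  · refine ⟨y, fun W h b hb ↦ T.m_ext _ _ fun p hp ↦ ?_⟩
    obtain ⟨V, hV, hpV, _, hy'⟩ := hy p (h hp)
    refine ⟨W ⊓ V, inf_le_left, ⟨hp, hpV⟩, ?_⟩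
    have := hy' (W ⊓ V) inf_le_right (T.mRes inf_le_left (n + 1) b) (by
      rw [T.mProj_mRes, hb, T.mRes_mRes, T.mRes_mRes])
    rw [moduleRes_smul_res, this, T.mRes_mRes, T.mRes_mRes]

/-- Conversely, an element of the kernel is locally `g n` times a section, whose reduction to level
one is unique and therefore glues. So level one is identified with the whole kernel. -/
lemma HasLocalBases.exists_isMulLift_of_moduleProj_eq_zero
    {y : T.M U (n + 1)} (hy : T.mProj U n (n + 1) n.le_succ y = 0) :
    ∃ c : T.M U 1, IsMulLift g c y := by
  refine Exists.elim (T.m_glue (n := 1) (U := U)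
    (fun V c ↦ ∃ h : V ≤ U, IsMulLift g c (T.mRes h (n + 1) y)) (fun V W i s hs ↦ ?_)
    (fun V s t hV hs ht ↦ ?_) (fun p hp ↦ ?_)) fun c hc ↦ ?_
  · obtain ⟨h, hs⟩ := hs
    refine ⟨i.trans h, ?_⟩
    have := hs.res i
    rwa [T.mRes_mRes] at this
  · exact IsMulLift.left_unique hT hF hs.2 ht.2
  · obtain ⟨V, b, hpV, hV, hb⟩ := hF.exists_le hp
    obtain ⟨d, hd⟩ := hb.exists_smul_eq hT (n := n) (x := T.mRes hV (n + 1) y) (by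
      rw [T.mProj_mRes, hy, map_zero])
    exact ⟨V, hpV, hV, _, hV, hd ▸ hF.isMulLift_smul hT d⟩
  · refine ⟨c, fun W h b hb ↦ T.m_ext _ _ fun p hp ↦ ?_⟩
    obtain ⟨V, hV, hpV, _, hy'⟩ := hc p (h hp)
    refine ⟨W ⊓ V, inf_le_left, ⟨hp, hpV⟩, ?_⟩
    have := hy' (W ⊓ V) inf_le_right (T.mRes inf_le_left (n + 1) b) (by
      rw [T.mProj_mRes, hb, T.mRes_mRes, T.mRes_mRes])
    rw [moduleRes_smul_res, this, T.mRes_mRes, T.mRes_mRes]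

/-- The identification of level one with the kernel is linear, with coefficients acting on level one
through their reductions. -/
lemma IsMulLift.moduleComb {k : ℕ} {c : Fin k → T.M U 1}
    {y : Fin k → T.M U (n + 1)} (hy : ∀ i, IsMulLift g (c i) (y i))
    (h : V ≤ U) (a : Fin k → T.A V (n + 1)) :
    IsMulLift g (FormalCompletion.moduleComb h 1 c
      (fun i ↦ T.aProj V 1 (n + 1) (Nat.le_add_left 1 n) (a i)))
      (FormalCompletion.moduleComb h (n + 1) y a) := by
  intro W h' b hb
  refine T.m_ext _ _ fun p hp ↦ ?_
  obtain ⟨V', b', hpV', hV', hb'⟩ := hF.exists_le hp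
  choose β hβ using fun i ↦ hb'.moduleProj_surjective hT (Nat.le_add_left 1 n)
    (T.mRes (hV'.trans (h'.trans h)) 1 (c i))
  refine ⟨V', hV', hpV', ?_⟩
  have e : T.mRes (hV'.trans h') (n + 1) (FormalCompletion.moduleComb h (n + 1) y a) =
      resTop g n V' • FormalCompletion.moduleComb le_rfl (n + 1) β
        (fun i ↦ T.aRes (hV'.trans h') (n + 1) (a i)) := by
    rw [moduleRes_moduleComb, FormalCompletion.moduleComb, FormalCompletion.moduleComb,
      Finset.smul_sum]
    refine Finset.sum_congr rfl fun i _ ↦ ?_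
    rw [T.mRes_rfl, smul_comm, hy i V' _ (β i) (hβ i)]
  rw [moduleRes_smul_res, T.mRes_mRes, e, ← sub_eq_zero, ← smul_sub,
    hF.smul_eq_zero_iff hT, map_sub, T.mProj_mRes, hb, moduleProj_moduleComb le_rfl _ hβ,
    T.mRes_mRes, moduleRes_moduleComb, sub_eq_zero]
  simp only [T.aProj_aRes]
  exact (moduleComb_moduleRes _ le_rfl c _).symm

/-- A compatible sequence of families of global sections which is a basis for `n = 1` is a basis
for all `n`. -/
lemma HasLocalBases.moduleComb_bijective {k : ℕ} {β : ∀ n, Fin k → T.M ⊤ n}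
    (hβ : ∀ m n h i, T.mProj ⊤ m n h (β n i) = β m i)
    (h1 : ∀ U : C.Opens, Function.Bijective (FormalCompletion.moduleComb (le_top : U ≤ ⊤) 1 (β 1)))
    (n : ℕ) (U : C.Opens) :
    Function.Bijective (FormalCompletion.moduleComb (le_top : U ≤ ⊤) n (β n)) := by
  induction n generalizing U with
  | zero =>
    have := hT.subsingleton U
    have := Module.subsingleton (T.A U 0) (T.M U 0)
    exact ⟨Function.injective_of_subsingleton _, fun x ↦ ⟨0, Subsingleton.elim _ _⟩⟩
  | succ n ih =>
    have hlift : ∀ i, IsMulLift g (β 1 i) (resTop g n ⊤ • β (n + 1) i) :=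
      fun i ↦ hβ 1 (n + 1) (Nat.le_add_left 1 n) i ▸ hF.isMulLift_smul hT (β (n + 1) i)
    constructor
    · intro a a' haa'
      rw [← sub_eq_zero, ← moduleComb_sub] at haa'
      have h0 := congr(T.mProj U n (n + 1) n.le_succ $haa')
      rw [map_zero, moduleProj_moduleComb le_top _ (hβ n (n + 1) n.le_succ),
        moduleComb_eq_zero_iff (ih U).1] at h0
      -- The coefficients vanish at level `n`, so they are multiples `g n * d`. The relation then
      -- says that the reductions of `d` give a relation at level one, hence vanish, and so do the
      -- products.
      choose d hd using fun i ↦ hT.exists_mul_eq U n _ (h0 i)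
      simp only [← hd] at haa'
      rw [← smul_moduleComb, hF.smul_eq_zero_iff hT,
        moduleProj_moduleComb le_top _ (hβ 1 (n + 1) (Nat.le_add_left 1 n)),
        moduleComb_eq_zero_iff (h1 U).1] at haa'
      funext i
      rw [← sub_eq_zero, ← hd, hT.mul_eq_zero_iff, haa']
    · intro x
      obtain ⟨α, hα⟩ := (ih U).2 (T.mProj U n (n + 1) n.le_succ x)
      choose a ha using fun i ↦ hT.proj_surjective U n (n + 1) n.le_succ (α i)
      have h0 : T.mProj U n (n + 1) n.le_succ
          (x - FormalCompletion.moduleComb (le_top : U ≤ ⊤) (n + 1) (β (n + 1)) a) = 0 := by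
        rw [map_sub, moduleProj_moduleComb le_top _ (hβ n (n + 1) n.le_succ)]
        simp only [ha]
        rw [hα, sub_self]
      -- The error of a lifted combination lies in the kernel. Expanding the corresponding section
      -- in the basis at level one corrects the coefficients by multiples of `g n`.
      obtain ⟨c, hc⟩ := hF.exists_isMulLift_of_moduleProj_eq_zero hT h0
      obtain ⟨γ, rfl⟩ := (h1 U).2 c
      choose d hd using fun i ↦ hT.proj_surjective U 1 (n + 1) (Nat.le_add_left 1 n) (γ i)
      obtain rfl : (fun i ↦ T.aProj U 1 (n + 1) (Nat.le_add_left 1 n) (d i)) = γ := funext hd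
      have h2 := hc.right_unique hT hF (IsMulLift.moduleComb hT hF hlift le_top d)
      have h3 : FormalCompletion.moduleComb (le_top : U ≤ ⊤) (n + 1)
          (fun i ↦ resTop g n ⊤ • β (n + 1) i) d =
          FormalCompletion.moduleComb (le_top : U ≤ ⊤) (n + 1) (β (n + 1))
            (fun i ↦ resTop g n U * d i) := by
        simp only [FormalCompletion.moduleComb, moduleRes_smul_res, smul_smul, mul_comm]
      refine ⟨fun i ↦ a i + resTop g n U * d i, ?_⟩
      rw [moduleComb_add, ← h3, ← h2, add_sub_cancel]

end Uniformized

/-! ### Limits of towers. -/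

namespace ModuleTower

variable {C : Scheme.{u}} (T : ModuleTower C)

/-- The sections over `U` of the limit of the rings of a tower. -/
abbrev limA (U : C.Opens) : Subring (∀ n, T.A U n) := limRing (T.aProj U)

/-- The sections over `U` of the limit of the modules of a tower. -/
abbrev limM (U : C.Opens) : Submodule (T.limA U) (∀ n, T.M U n) :=
  limModule (T.aProj U) (T.mProj U) (T.mProj_smul U)

/-- The restriction maps of the limit of the rings of a tower. -/
def limARes {U V : C.Opens} (h : V ≤ U) : T.limA U →+* T.limA V :=
  limRingMap (T.aProj U) (T.aProj V) (T.aRes h) (T.aProj_aRes h)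

/-- The restriction maps of the limit of the modules of a tower. -/
def limMRes {U V : C.Opens} (h : V ≤ U) : T.limM U →+ T.limM V :=
  limModuleMap (T.aProj U) (T.mProj U) (T.mProj_smul U) (T.aProj V) (T.mProj V) (T.mProj_smul V)
    (T.mRes h) (T.mProj_mRes h)

/-- The limit of the modules of a tower is free of rank `r` over the limit of the rings. -/
def IsLimitFree (r : ℕ) : Prop :=
  ∃ e : ∀ U : C.Opens, (Fin r → T.limA U) ≃ₗ[T.limA U] T.limM U,
    ∀ (U V : C.Opens) (h : V ≤ U) (s : Fin r → T.limA U),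
      e V (fun i ↦ T.limARes h (s i)) = T.limMRes h (e U s)

end ModuleTower

section Unbundled

variable {C : Scheme.{u}} {A M : C.Opens → ℕ → Type u} [ring : ∀ U n, CommRing (A U n)]
  [group : ∀ U n, AddCommGroup (M U n)] [module : ∀ U n, Module (A U n) (M U n)]
  {aRes : ∀ {U V : C.Opens} (_ : V ≤ U) (n : ℕ), A U n →+* A V n}
  {aProj : ∀ (U : C.Opens) (m n : ℕ) (_ : m ≤ n), A U n →+* A U m}
  {mRes : ∀ {U V : C.Opens} (_ : V ≤ U) (n : ℕ), M U n →+ M V n}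
  {mProj : ∀ (U : C.Opens) (m n : ℕ) (_ : m ≤ n), M U n →+ M U m}
  {h₁ h₂ h₃ h₄ h₅ h₆ h₇ h₈} {LA : ∀ U, Subring (∀ n, A U n)}
  {hc : ∀ U, SubsemiringClass (Subring (∀ n, A U n)) (∀ n, A U n)}
  {hinv : ∀ U, RingHomInvPair (RingHom.id (LA U)) (RingHom.id (LA U))}
  {LM : ∀ U, Submodule (LA U) (∀ n, M U n)} {resA : ∀ {U V : C.Opens} (_ : V ≤ U), LA U →+* LA V}
  {resM : ∀ {U V : C.Opens} (_ : V ≤ U), LM U →+ LM V} {r : ℕ}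

/-- `ModuleTower.IsLimitFree`, in terms of arbitrary models of the limits. The instances `hc` and
`hinv` are arguments so that they can be matched syntactically. -/
lemma exists_equiv_of_isLimitFree (hLA : ∀ U s, s ∈ LA U ↔ s ∈ limRing (aProj U))
    (hLM : ∀ U x, x ∈ LM U ↔ x ∈ limModule (aProj U) (mProj U) (h₇ U))
    (hresA : ∀ {U V : C.Opens} (h : V ≤ U) (s : LA U) (n : ℕ), (resA h s).1 n = aRes h n (s.1 n))
    (hresM : ∀ {U V : C.Opens} (h : V ≤ U) (x : LM U) (n : ℕ), (resM h x).1 n = mRes h n (x.1 n))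
    (hfree : (@ModuleTower.mk C A M ring group module @aRes aProj @mRes mProj
      @h₁ @h₂ @h₃ @h₄ @h₅ @h₆ h₇ h₈).IsLimitFree r) :
    ∃ e : ∀ U : C.Opens, (Fin r → LA U) ≃ₗ[LA U] LM U,
      ∀ (U V : C.Opens) (h : V ≤ U) (s : Fin r → LA U),
        e V (fun i ↦ resA h (s i)) = resM h (e U s) := by
  obtain rfl : LA = fun U ↦ limRing (aProj U) := funext fun U ↦ SetLike.ext (hLA U)
  obtain rfl : LM = fun U ↦ limModule (aProj U) (mProj U) (h₇ U) :=
    funext fun U ↦ SetLike.ext (hLM U)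
  obtain ⟨e, he⟩ := hfree
  refine ⟨e, fun U V h s ↦ ?_⟩
  refine (?_ : _ = _).trans ((he U V h s).trans ?_)
  · congr 1
    funext i
    exact Subtype.ext (funext fun n ↦ hresA h (s i) n)
  · exact Subtype.ext (funext fun n ↦ (hresM h (e U s) n).symm)

end Unbundled

section CompletionFree

variable {C : Scheme.{u}} {T : ModuleTower C} {r : ℕ}

/-- The linear combinations of a compatible family of global sections with coefficients in the
limit of the rings. -/
def limComb {β : ∀ n, Fin r → T.M ⊤ n} (hβ : ∀ m n h i, T.mProj ⊤ m n h (β n i) = β m i)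
    (U : C.Opens) : (Fin r → T.limA U) →ₗ[T.limA U] T.limM U where
  toFun s := ⟨fun n ↦ moduleComb le_top n (β n) (fun i ↦ (s i).1 n), fun m n h ↦ by
    rw [moduleProj_moduleComb le_top h (hβ m n h)]
    exact congr(moduleComb le_top m (β m) $(funext fun i ↦ (s i).2 m n h))⟩
  map_add' s t := Subtype.ext (funext fun n ↦ moduleComb_add le_top (β n) _ _)
  map_smul' c s := Subtype.ext (funext fun n ↦ (smul_moduleComb le_top (β n) (c.1 n) _).symm)

lemma limComb_bijective {β : ∀ n, Fin r → T.M ⊤ n}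
    (hβ : ∀ m n h i, T.mProj ⊤ m n h (β n i) = β m i)
    (hbij : ∀ (n : ℕ) (U : C.Opens), Function.Bijective (moduleComb (le_top : U ≤ ⊤) n (β n)))
    (U : C.Opens) : Function.Bijective (limComb hβ U) := by
  refine ⟨fun s t hst ↦ ?_, fun x ↦ ?_⟩
  · funext i
    refine Subtype.ext (funext fun n ↦ ?_)
    have h : moduleComb (le_top : U ≤ ⊤) n (β n) (fun i ↦ (s i).1 n) =
        moduleComb le_top n (β n) (fun i ↦ (t i).1 n) := congr($hst.1 n)
    exact congr_fun ((hbij n U).1 h) i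
  · choose a ha using fun n ↦ (hbij n U).2 (x.1 n)
    -- Coordinates at level `m` are unique, so those at level `n` project to them.
    have hcompat : ∀ i (m n : ℕ) (h : m ≤ n), T.aProj U m n h (a n i) = a m i := by
      intro i m n h
      refine congr_fun (f := fun i ↦ T.aProj U m n h (a n i)) ((hbij m U).1 ?_) i
      rw [← moduleProj_moduleComb le_top h (hβ m n h), ha, ha]
      exact x.2 m n h
    exact ⟨fun i ↦ ⟨fun n ↦ a n i, hcompat i⟩, Subtype.ext (funext ha)⟩

lemma isLimitFree_of_bijective {β : ∀ n, Fin r → T.M ⊤ n}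
    (hβ : ∀ m n h i, T.mProj ⊤ m n h (β n i) = β m i)
    (hbij : ∀ (n : ℕ) (U : C.Opens), Function.Bijective (moduleComb (le_top : U ≤ ⊤) n (β n))) :
    T.IsLimitFree r :=
  ⟨fun U ↦ LinearEquiv.ofBijective _ (limComb_bijective hβ hbij U), fun _ _ h s ↦
    Subtype.ext (funext fun n ↦ (moduleRes_moduleComb le_top h (β n) fun i ↦ (s i).1 n).symm)⟩

end CompletionFree

/-! ### The kernel of a projection described by a basis at level one. -/

section MulLift

variable {C : Scheme.{u}} {T : ModuleTower C} {r k n : ℕ}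
  {g : ∀ n, T.A ⊤ (n + 1)} (hT : IsUniformized T g) (hF : HasLocalBases T k)
  {c : Fin r → T.M ⊤ 1}
  (hc : ∀ U : C.Opens, Function.Bijective (moduleComb (le_top : U ≤ ⊤) 1 c))
  {y : Fin r → T.M ⊤ (n + 1)} (hy : ∀ i, IsMulLift g (c i) (y i))
  {U : C.Opens}

include hT hF hc hy

lemma moduleComb_eq_zero_of_isMulLift {a : Fin r → T.A U (n + 1)}
    (ha : moduleComb (le_top : U ≤ ⊤) (n + 1) y a = 0) (i : Fin r) :
    T.aProj U 1 (n + 1) (Nat.le_add_left 1 n) (a i) = 0 := by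
  have h := IsMulLift.moduleComb hT hF hy (le_top : U ≤ ⊤) a
  rw [ha] at h
  have h0 := hF.isMulLift_smul hT (0 : T.M U (n + 1))
  rw [smul_zero, map_zero] at h0
  exact (moduleComb_eq_zero_iff (hc U).1 _).mp (h.left_unique hT hF h0) i

lemma exists_moduleComb_eq_of_isMulLift {x : T.M U (n + 1)}
    (hx : T.mProj U n (n + 1) n.le_succ x = 0) :
    ∃ α : Fin r → T.A U 1, ∀ a : Fin r → T.A U (n + 1),
      (∀ i, T.aProj U 1 (n + 1) (Nat.le_add_left 1 n) (a i) = α i) →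
        moduleComb (le_top : U ≤ ⊤) (n + 1) y a = x := by
  obtain ⟨δ, hδ⟩ := hF.exists_isMulLift_of_moduleProj_eq_zero hT hx
  obtain ⟨α, rfl⟩ := (hc U).2 δ
  refine ⟨α, fun a ha ↦ ?_⟩
  obtain rfl := funext ha
  exact (IsMulLift.moduleComb hT hF hy (le_top : U ≤ ⊤) a).right_unique hT hF hδ

end MulLift

/-! ### Lifting a basis at level one to the limit. -/

section Lifting

open Opposite

variable {C S : Scheme.{u}} (π : C ⟶ S) {I : C.IdealSheafData} [IsSection π I]
  {T : ModuleTower C} {r k n : ℕ} {g : ∀ n, T.A ⊤ (n + 1)}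

/-- The morphism from `𝒪_P` to the `n`-th module of a tower given by a global section `y`, for
homomorphisms `σ` from `𝒪_P` to the `n`-th ring. -/
def subschemeSheafSmul {n : ℕ} (σ : ∀ U : C.Opens, SubschemeSections I U →+* T.A U n)
    (hσ : ∀ (U V : C.Opens) (h : V ≤ U) (a : SubschemeSections I U),
      σ V (subschemeRes I h a) = T.aRes h n (σ U a)) (y : T.M ⊤ n) :
    subschemeSheaf I ⟶ T.mSheaf n := ⟨{
  app U := AddCommGrpCat.ofHom (AddMonoidHom.mk'
    (fun a ↦ σ U.unop a • T.mRes (le_top : U.unop ≤ ⊤) n y)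
    fun a b ↦ by rw [map_add, add_smul] : SubschemeSections I U.unop →+ T.M U.unop n)
  naturality U V f := by
    ext (a : SubschemeSections I U.unop)
    have h : σ V.unop (subschemeRes I f.unop.le a) • T.mRes le_top n y =
        T.mRes f.unop.le n (σ U.unop a • T.mRes le_top n y) := by
      rw [hσ _ _ f.unop.le, T.mRes_smul, T.mRes_mRes]
    exact h }⟩

include π

/-- Let `y i` be the section of the kernel corresponding to `c i`. Since `σ` followed by reduction
to level one is bijective, the `y i` identify the kernel with `𝒪_P ^ r`, and the vanishing of `H¹`
on `S` applies. -/
lemma mProj_top_surjective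
    (hH1 : Subsingleton (Sheaf.H (structureSheafAb S) 1))
    (hT : IsUniformized T g) (hF : HasLocalBases T k) {c : Fin r → T.M ⊤ 1}
    (hc : ∀ U : C.Opens, Function.Bijective (moduleComb (le_top : U ≤ ⊤) 1 c))
    (hsupp : ∀ n, IsSupportedOn I (T.mSheaf n))
    (σ : ∀ U : C.Opens, SubschemeSections I U →+* T.A U (n + 1))
    (hσ : ∀ (U V : C.Opens) (h : V ≤ U) (a : SubschemeSections I U),
      σ V (subschemeRes I h a) = T.aRes h (n + 1) (σ U a))
    (hσ1 : ∀ U : C.Opens, Function.Bijective (fun a : SubschemeSections I U ↦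
      T.aProj U 1 (n + 1) (Nat.le_add_left 1 n) (σ U a))) :
    Function.Surjective (T.mProj ⊤ n (n + 1) n.le_succ) := by
  choose y hy using fun i ↦ hF.exists_isMulLift hT n (c i)
  refine surjective_app_top_of_isSupportedOn π I hH1 (hsupp (n + 1)) (hsupp n)
    (T.mSheafProj n.le_succ) (r := r) (fun i ↦ subschemeSheafSmul σ hσ (y i)) (fun i ↦ ?_)
    (fun U a ha ↦ ?_) (fun U x hx ↦ ?_) (fun U s x hx _ ↦ ?_)
  · refine ObjectProperty.hom_ext _ (NatTrans.ext (funext fun U ↦ ?_))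
    ext (a : SubschemeSections I U.unop)
    have h : T.mProj U.unop n (n + 1) n.le_succ (σ U.unop a • T.mRes le_top (n + 1) (y i)) = 0 := by
      rw [T.mProj_smul, T.mProj_mRes, (hy i).moduleProj_eq_zero hT hF, map_zero, smul_zero]
    exact h
  · have h := moduleComb_eq_zero_of_isMulLift hT hF hc hy (a := fun i ↦ σ U (a i)) ha
    funext i
    refine (hσ1 U).1 ((h i).trans ?_)
    simp
  · obtain ⟨α, hα⟩ := exists_moduleComb_eq_of_isMulLift hT hF hc hy hx
    choose a ha using fun i ↦ (hσ1 U).2 (α i)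
    exact ⟨a, hα (fun i ↦ σ U (a i)) ha⟩
  · obtain ⟨V, b, hxV, hV, hb⟩ := hF.exists_le hx
    obtain ⟨s', hs'⟩ := hb.moduleProj_surjective hT n.le_succ (T.mRes hV n s)
    exact ⟨V, hV, hxV, s', hs'⟩

lemma isLimitFree (hH1 : Subsingleton (Sheaf.H (structureSheafAb S) 1))
    (hT : IsUniformized T g) (hF : HasLocalBases T k) {c : Fin r → T.M ⊤ 1}
    (hc : ∀ U : C.Opens, Function.Bijective (moduleComb (le_top : U ≤ ⊤) 1 c))
    (hsupp : ∀ n, IsSupportedOn I (T.mSheaf n))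
    (σ : ∀ (n : ℕ) (U : C.Opens), SubschemeSections I U →+* T.A U n)
    (hσ : ∀ (n : ℕ) (U V : C.Opens) (h : V ≤ U) (a : SubschemeSections I U),
      σ n V (subschemeRes I h a) = T.aRes h n (σ n U a))
    (hσ1 : ∀ (n : ℕ) (U : C.Opens), Function.Bijective (fun a : SubschemeSections I U ↦
      T.aProj U 1 (n + 1) (Nat.le_add_left 1 n) (σ (n + 1) U a))) :
    T.IsLimitFree r := by
  -- Each `c i` is lifted separately, starting at level one, to a compatible family of global
  -- sections.
  choose β hβ h1 using fun i ↦ exists_compatible_family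
    (fun m n h ↦ T.mProj ⊤ m n h) (fun n x ↦ hF.moduleProj_rfl hT x)
    (fun l m n h h' x ↦ hF.moduleProj_moduleProj hT h h' x) 1
    (fun n _ ↦ mProj_top_surjective π hH1 hT hF hc hsupp _ (hσ (n + 1)) (hσ1 n)) (c i)
  refine isLimitFree_of_bijective (β := fun n i ↦ β i n) (fun m n h i ↦ hβ i m n h) ?_
  refine hF.moduleComb_bijective hT (fun m n h i ↦ hβ i m n h) ?_
  simpa only [h1] using hc

end Lifting

/-! ### The tower attached to a module and a sequence of thickenings. -/

section QuotTower

variable {C : Scheme.{u}} (T : Thickenings C) (F : C.Modules)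

lemma moduleRes_rfl {U : C.Opens} (n : ℕ) (h : U ≤ U) (x : QuotModuleSections T F U n) :
    moduleRes T F h n x = x :=
  secRes_rfl _ _ x

lemma moduleRes_moduleRes {U V W : C.Opens} (n : ℕ) (h : V ≤ U) (h' : W ≤ V)
    (x : QuotModuleSections T F U n) :
    moduleRes T F h' n (moduleRes T F h n x) = moduleRes T F (h'.trans h) n x :=
  secRes_secRes _ _ _ x

lemma moduleRes_smul {U V : C.Opens} (h : V ≤ U) (n : ℕ) (a : QuotSections T U n)
    (x : QuotModuleSections T F U n) :
    moduleRes T F h n (a • x) = quotRes T h n a • moduleRes T F h n x :=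
  secRes_smul _ _ a x

lemma isSheaf_moduleRes (n : ℕ) : (presheafOfRes (fun U ↦ QuotModuleSections T F U n)
    (fun h ↦ moduleRes T F h n) (moduleRes_rfl T F n) (moduleRes_moduleRes T F n)).IsSheaf :=
  (quotModuleSheaf T F n).2

/-- The tower of the modules `F / I ^ n F` over the rings `𝒪_C / I ^ n`. -/
def quotTower : ModuleTower C where
  A := QuotSections T
  M := QuotModuleSections T F
  ring := instCommRingQuotSections T
  group := instAddCommGroupQuotModuleSections T F
  module := instModuleQuotModuleSections T F
  aRes := @quotRes C T
  aProj := quotProj T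
  mRes := @moduleRes C T F
  mProj := moduleProj T F
  aRes_aRes := quotRes_quotRes T
  aProj_aRes := quotProj_quotRes T
  mRes_rfl := moduleRes_rfl T F
  mRes_mRes := moduleRes_moduleRes T F
  mRes_smul := moduleRes_smul T F
  mProj_mRes := moduleProj_moduleRes T F
  mProj_smul := moduleProj_smul T F
  isSheaf := isSheaf_moduleRes T F

lemma completionRes_apply {U V : C.Opens} (h : V ≤ U) (s : completionRing T U) (n : ℕ) :
    (completionRes T h s).1 n = quotRes T h n (s.1 n) := rfl

lemma completionModuleRes_apply {U V : C.Opens} (h : V ≤ U) (x : completionModule T F U) (n : ℕ) :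
    (completionModuleRes T F h x).1 n = moduleRes T F h n (x.1 n) := rfl

lemma mem_completionModule_iff (U : C.Opens) (x : ∀ n, QuotModuleSections T F U n) :
    x ∈ completionModule T F U ↔
      x ∈ limModule (quotProj T U) (moduleProj T F U) (moduleProj_smul T F U) := Iff.rfl

variable {T F}

lemma moduleComb_quotTower_bijective {U : C.Opens} {n r : ℕ}
    {b : Fin r → Sec ((Scheme.Modules.pullback (T.toBase n)).obj F) (T.toBase n ⁻¹ᵁ U)}
    (hb : IsFreeBasisOn _ _ b) {V : C.Opens} (h : V ≤ U) :
    Function.Bijective (moduleComb (T := quotTower T F) h n b) :=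
  hb.bijective ((T.toBase n).preimage_mono h)

/-- The scheme `P` is kept apart from `T.obj 1` because the subschemes of `I` and `I ^ 1` agree only
through a comparison map `h`. -/
lemma exists_bijective_moduleComb_one {r : ℕ} {P : Scheme.{u}} (h : T.obj 1 ⟶ P) (f : P ⟶ C)
    (w : h ≫ f = T.toBase 1) {s : Fin r → Sec ((Scheme.Modules.pullback f).obj F) ⊤}
    (hs : IsFreeBasis s) :
    ∃ c : Fin r → (quotTower T F).M ⊤ 1,
      ∀ U : C.Opens, Function.Bijective (moduleComb (le_top : U ≤ ⊤) 1 c) := by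
  obtain ⟨a, ha, -⟩ := hs.exists_pullback h
  obtain ⟨c, hc, -⟩ := ha.exists_map (pullbackFactor _ _ _ w F)
  exact ⟨c, fun _ ↦ hc.bijective _⟩

lemma isLocalBasis_of_isFreeBasisOn {V : C.Opens} {r : ℕ} {s : Fin r → Sec F V}
    (hs : IsFreeBasisOn F V s) :
    ∃ b, IsLocalBasis (quotTower T F) V (r := r) b := by
  obtain ⟨b, hb⟩ : ∃ b : ∀ n, Fin r → QuotModuleSections T F V n,
    ∀ n i, b n i = secPullback (T.toBase n) F V (s i) := ⟨_, fun _ _ ↦ rfl⟩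
  refine ⟨b, fun m n h i ↦ ?_, fun _ h n ↦
    moduleComb_quotTower_bijective (hs.pullback (T.toBase n) (hb n)) h⟩
  have := pullbackRes_secPullback (T.incl h) (T.toBase n) (T.toBase m) (T.incl_toBase h) F V (s i)
  rw [← hb, ← hb] at this
  exact this

end QuotTower

/-! ### The tower of the infinitesimal neighbourhoods of `P`. -/

section Neighbourhoods

variable {C S : Scheme.{u}} (π : C ⟶ S) {I : C.IdealSheafData} [IsSection π I]
  {F : C.Modules} {r : ℕ}

lemma isSupportedOn_quotTower (n : ℕ) : IsSupportedOn I ((quotTower (nbhds I) F).mSheaf n) :=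
  fun _ _ h h' ↦ bijective_map_of_le
    ((Scheme.Modules.pullback (I ^ n).subschemeι).obj F).presheaf
    (homOfLE ((I ^ n).subschemeι.preimage_mono h)) (preimage_le_of_subscheme I h' n)

lemma subsingleton_quotSections_of_disjoint {U : C.Opens} (hU : Disjoint (U : Set C) I.support)
    (n : ℕ) : Subsingleton (QuotSections (nbhds I) U n) := by
  have h : (nbhds I).toBase n ⁻¹ᵁ U ≤ ⊥ := (preimage_le_of_subscheme I (U := U) (V := ⊥)
    (fun x hx ↦ (Set.disjoint_left.mp hU hx (by
      rw [← Scheme.IdealSheafData.range_subschemeι]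
      exact ⟨x, rfl⟩)).elim) n)
  have h' := le_bot_iff.mp h
  change Subsingleton Γ((nbhds I).obj n, (nbhds I).toBase n ⁻¹ᵁ U)
  rw [h']
  infer_instance

/-- At points of `P`, a local basis of `F` pulls back to all thickenings; on the complement of `P`
all the rings are zero. -/
lemma hasLocalBases_quotTower (hF : IsLocallyFreeNear I F) (hP : IsFreeOnSubscheme I F r) :
    HasLocalBases (quotTower (nbhds I) F) r := fun x ↦ by
  by_cases hx : x ∈ I.support
  · obtain ⟨U, s, hxU, hs⟩ := exists_isFreeBasisOn hF hP hx
    obtain ⟨b, hb⟩ := isLocalBasis_of_isFreeBasisOn hs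
    exact ⟨U, b, hxU, hb⟩
  · exact ⟨⟨(I.support : Set C)ᶜ, I.support.isClosed.isOpen_compl⟩, _, hx,
      isLocalBasis_of_subsingleton (fun W hW n ↦ subsingleton_quotSections_of_disjoint
        (Set.disjoint_left.mpr fun y hy ↦ hW hy) n) r⟩

lemma IsFreeOnSubscheme.exists_basis (hP : IsFreeOnSubscheme I F r) :
    ∃ c : Fin r → (quotTower (nbhds I) F).M ⊤ 1,
      ∀ U : C.Opens, Function.Bijective (moduleComb (le_top : U ≤ ⊤) 1 c) := by
  obtain ⟨s, hs⟩ := hP.exists_isFreeBasis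
  exact exists_bijective_moduleComb_one (T := nbhds I)
    (Scheme.IdealSheafData.inclusion (pow_one I).ge) I.subschemeι
    (Scheme.IdealSheafData.inclusion_subschemeι _) hs

set_option linter.auxLemma false in
lemma isCompletionFree_of_isLimitFree (h : (quotTower (nbhds I) F).IsLimitFree r) :
    IsCompletionFree I F r :=
  exists_equiv_of_isLimitFree (aRes := @quotRes C (nbhds I)) (aProj := quotProj (nbhds I))
    (mRes := @moduleRes C (nbhds I) F) (mProj := moduleProj (nbhds I) F)
    (h₁ := quotRes_quotRes (nbhds I)) (h₂ := quotProj_quotRes (nbhds I))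
    (h₃ := moduleRes_rfl (nbhds I) F) (h₄ := moduleRes_moduleRes (nbhds I) F)
    (h₅ := moduleRes_smul (nbhds I) F) (h₆ := moduleProj_moduleRes (nbhds I) F)
    (h₇ := moduleProj_smul (nbhds I) F) (h₈ := isSheaf_moduleRes (nbhds I) F)
    (hc := IsCompletionFree._proof_1 I) (hinv := IsCompletionFree._proof_2 I)
    (LA := completionRing (nbhds I)) (LM := completionModule (nbhds I) F)
    (resA := @completionRes C (nbhds I)) (resM := @completionModuleRes C (nbhds I) F)
    (fun _ _ ↦ Iff.rfl) (mem_completionModule_iff (nbhds I) F) (completionRes_apply (nbhds I))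
    (completionModuleRes_apply (nbhds I) F) h

variable {τ : completionRing (nbhds I) ⊤} (hτ : IsConormalGenerator (τ.1 2))
  (hI : IsEffectiveCartier I)
include hτ hI π

lemma isUniformized_quotTower : IsUniformized (quotTower (nbhds I) F)
    (fun n ↦ (τ.1 (n + 1) ^ n : QuotSections (nbhds I) ⊤ (n + 1))) where
  subsingleton := subsingleton_quotSections_zero
  proj_rfl := quotProj_rfl I
  proj_proj U _ _ _ := quotProj_nbhds I U
  proj_surjective U _ _ := quotProj_surjective π hτ hI U
  proj_eq_zero n := (hτ.isPowLift n).quotProj_eq_zero hτ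
  mul_eq_zero_iff U n a := by
    have h := uniformizerPow_mul_eq_zero_iff π hτ hI (a := a)
    rw [uniformizerPow, ← map_pow] at h
    exact h
  exists_mul_eq U n a ha := by
    obtain ⟨b, hb⟩ := exists_uniformizerPow_mul_eq π hτ hI ha
    rw [uniformizerPow, ← map_pow] at hb
    exact ⟨b, hb⟩

lemma quotProj_quotStructureMap_bijective (n : ℕ) (U : C.Opens) :
    Function.Bijective (fun a : SubschemeSections I U ↦
      quotProj (nbhds I) U 1 (n + 1) (Nat.le_add_left 1 n) (quotStructureMap π I (n + 1) U a)) := by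
  simp only [quotProj_quotStructureMap π I U]
  exact quotStructureMap_one_bijective π hτ hI

lemma isLimitFree_quotTower (hH1 : Subsingleton (Sheaf.H (structureSheafAb S) 1))
    (hF : IsLocallyFreeNear I F) (hP : IsFreeOnSubscheme I F r) :
    (quotTower (nbhds I) F).IsLimitFree r := by
  obtain ⟨c, hc⟩ := hP.exists_basis
  exact isLimitFree π hH1 (isUniformized_quotTower π hτ hI)
    (hasLocalBases_quotTower hF hP) hc isSupportedOn_quotTower (quotStructureMap π I)
    (fun n U V h a ↦ (quotRes_quotStructureMap π I h n a).symm)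
    (quotProj_quotStructureMap_bijective π hτ hI)

theorem isCompletionFree (hH1 : Subsingleton (Sheaf.H (structureSheafAb S) 1))
    (hF : IsLocallyFreeNear I F) (hP : IsFreeOnSubscheme I F r) : IsCompletionFree I F r :=
  isCompletionFree_of_isLimitFree (isLimitFree_quotTower π hτ hI hH1 hF hP)

end Neighbourhoods

end FormalCompletion

end

theorem mainTheorem9 {S C : Scheme.{u}} [IsLocallyNoetherian S] (π : C ⟶ S) [LocallyOfFiniteType π]
    (I : C.IdealSheafData) [FormalCompletion.IsSection π I]
    (hcartier : FormalCompletion.IsEffectiveCartier I)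
    (hH1 : Subsingleton (Sheaf.H (FormalCompletion.structureSheafAb S) 1))
    (hconormal : FormalCompletion.IsConormalFreeOfRankOne I) :
    FormalCompletion.IsCompletionPowerSeries π I ∧
    ∀ (F : C.Modules) (r : ℕ),
      SheafOfModules.IsFinitePresentation (R := C.ringCatSheaf) F →
      FormalCompletion.IsLocallyFreeNear I F →
      FormalCompletion.IsFreeOnSubscheme I F r →
      FormalCompletion.IsCompletionFree I F r := by
  obtain ⟨t, ht⟩ := hconormal.exists_generator
  -- From here on the conormal generator is the component at level `2` of the global section `τ` of
  -- `𝒪̂_C`.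
  obtain ⟨τ, rfl⟩ := FormalCompletion.exists_completionRing_eq π hcartier hH1 ht
  exact ⟨FormalCompletion.isCompletionPowerSeries_of_generator π ht hcartier, fun F r _ hF hP ↦
    FormalCompletion.isCompletionFree π ht hcartier hH1 hF hP⟩
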